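/- **Theorem 2 (de Bruijn's identity and its dual).** Let $X$ and $Z$ be independent real-valued random variables. Write $h(Y)=\mathsf{E}\{\log\frac1{p(Y)}\}$ (natural logarithm) for the differential entropy of a random variable $Y$ with density $p$, called finite if this expectation converges absolutely; $J(Y)=\mathsf{E}\{(p'(Y)/p(Y))^2\}$ for its Fisher information, where $p$ is the locally absolutely continuous density of $Y$, with $J(Y)=+\infty$ if there is none; and $\mathsf{Var}(Z|Y)=\mathsf{E}\{(Z-\mathsf{E}\{Z|Y\})^2\}$ for the conditional variance. Gaussian means normal with positive variance. At $t=0$ the derivatives are right derivatives. (a) Suppose that $Z$ is Gaussian. Then $J(X+\sqrt t\,Z)<\infty$ for all $t>0$. For every $t\ge 0$ such that $J(X+\sqrt t\,Z)<\infty$ and $h(X+\sqrt t\,Z)$ is finite, $h(X+\sqrt s\,Z)$ is finite for all $s>0$ and $$\frac{d}{dt}h(X+\sqrt t\,Z)=\tfrac12\,J(X+\sqrt t\,Z)\,\mathsf{Var}(Z).$$ If $\mathsf{E}\log(1+|X|)<\infty$ (in particular if $X$ has finite variance), then $h(X+\sqrt t\,Z)$ is finite for every $t\ge0$ with $J(X+\sqrt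 t\,Z)<\infty$. (b) Suppose that $X$ is Gaussian and that $\mathsf{E}|Z|<\infty$. Then $J(X)<\infty$, $h(X+\sqrt t\,Z)$ is finite for all $t\ge 0$, and $\mathsf{Var}(Z|X+\sqrt t\,Z)<\infty$ for all $t>0$. For every $t\ge 0$ with $\mathsf{Var}(Z|X+\sqrt t\,Z)<\infty$ (at $t=0$ this says that $Z$ has finite variance), $$\frac{d}{dt}h(X+\sqrt t\,Z)=\tfrac12\,J(X)\,\mathsf{Var}(Z|X+\sqrt t\,Z).$$ -/

import Mathlib

open MeasureTheory ProbabilityTheory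
open scoped ENNReal NNReal

noncomputable section

/-- Differential entropy (natural logarithm) `h(X) = E{log (1 / p(X))}`, where `p` is the
probability density function of `X` with respect to Lebesgue measure. -/
def diffEntropy {Ω : Type*} [MeasurableSpace Ω] (X : Ω → ℝ) (P : Measure Ω) : ℝ :=
  ∫ ω, Real.log (1 / (pdf X P volume (X ω)).toReal) ∂P

/-- `X` has a density and its differential entropy is a finite, absolutely convergent
expectation. -/
def HasFiniteEntropy {Ω : Type*} [MeasurableSpace Ω] (X : Ω → ℝ) (P : Measure Ω) : Prop :=
  HasPDF X P volume ∧
    Integrable (fun ω => Real.log (1 / (pdf X P volume (X ω)).toReal)) P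

/-- `p` is a nonnegative, locally absolutely continuous probability density function of `X`.
There is at most one such `p`. -/
structure IsACDensity {Ω : Type*} [MeasurableSpace Ω] (p : ℝ → ℝ) (X : Ω → ℝ)
    (P : Measure Ω) : Prop where
  nonneg : ∀ x, 0 ≤ p x
  absCont : ∀ a b : ℝ, AbsolutelyContinuousOnInterval p a b
  map_eq : P.map X = volume.withDensity (fun x => ENNReal.ofReal (p x))

/-- Fisher information `J(X) = E{(p'(X) / p(X))²}`, where `p` is the locally absolutely
continuous density of `X`; by the usual convention `J(X) = ∞` if there is no such density.
The infimum ranges over at most one function `p`. -/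
def fisherInfo {Ω : Type*} [MeasurableSpace Ω] (X : Ω → ℝ) (P : Measure Ω) : ℝ≥0∞ :=
  ⨅ (p : ℝ → ℝ) (_ : IsACDensity p X P),
    ∫⁻ ω, ENNReal.ofReal ((deriv p (X ω) / p (X ω)) ^ 2) ∂P

/-- Conditional variance (minimum mean-square error)
`Var(Z | Y) = E{(Z - E{Z | Y})²}`, as an extended nonnegative number. -/
def condVariance {Ω : Type*} [MeasurableSpace Ω] (Z Y : Ω → ℝ) (P : Measure Ω) : ℝ≥0∞ :=
  ∫⁻ ω, ENNReal.ofReal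
    ((Z ω - (P[Z | MeasurableSpace.comap Y inferInstance]) ω) ^ 2) ∂P

end

/-! Write K_s for the density of a law smoothed by a centred Gaussian of variance s. It solves the
heat equation ∂K/∂s = K''/2, so differentiating -∫ K log K in s and integrating by parts gives (1/2)
∫ K'²/K: this is de Bruijn's identity at positive times. The analysis rests on comparing K_s with
K_B for s < B. The kernel and its derivatives are dominated by a wider kernel, and Jensen's
inequality for a power of the kernel bounds log K_s from below. Hence finite entropy at one later
time justifies every exchange of limits (`heatSmooth_dom`, `abs_log_heatSmooth_le`,
`hasDerivAt_integral_negMulLog_heatSmooth`).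

Finiteness of entropy is carried between times by a weight: a Lipschitz l with exp(-l) integrable
and E l(X) finite. Gibbs' inequality bounds the entropy by the cross entropy, and integrable noise
changes E l by a finite amount. If a density p has finite entropy and Fisher information, l = -log(p
* exp(-|·|)) is such a weight, because the Fisher information bounds p² locally by averages of p and
of p'²/p (`IsFisherDensity.exists_entropyWeight`). Under a logarithmic moment, l = log(1 + x²)
serves.

At time zero the right derivative is the limit of the derivatives at positive times, once the
entropy is known to be continuous there. Both limits combine Fatou's lemma with an upper bound for
the integrals (`tendsto_integral_of_nonneg_of_le`). For the Fisher information the bound is its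
decrease under convolution. For the entropy, Fatou is applied to the nonnegative integrand of the
relative entropy to exp(-l), and the bound comes from the increase of entropy under convolution and
the convergence of the cross entropy.

For the dual, X + √t Z = √t (Z + X/√t), so its entropy is (1/2) log t plus that of Z with Gaussian
noise of variance v/t. De Bruijn's identity gives the derivative (v - v² J)/(2vt), with J the Fisher
information of the output Y. Tweedie's formula says E[X | Y] = m - v S(Y), with S the score of Y,
and Z - E[Z | Y] = -(X - E[X | Y])/√t; together they identify (v - v² J)/t as Var(Z | Y). Only X is
squared here, so E|Z| < ∞ suffices. At t = 0, with Z square integrable, the entropy is squeezed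
between bounds linear in the second moment, and the conditional variance converges by Fatou with Var
Z as upper bound. -/

noncomputable section

open Filter Topology

/-! ### The Gaussian kernel: heat equation and domination by wider kernels. -/

/-- The centred Gaussian density with variance `s`, as a function of a real variance. -/
def heatKernel (s u : ℝ) : ℝ := (√(2 * Real.pi * s))⁻¹ * Real.exp (-u ^ 2 / (2 * s))

/-- The spatial derivative of `heatKernel`. -/
def heatKernelDeriv (s u : ℝ) : ℝ := -(u / s) * heatKernel s u

/-- The second spatial derivative of `heatKernel`. -/
def heatKernelDeriv2 (s u : ℝ) : ℝ := (u ^ 2 / s ^ 2 - 1 / s) * heatKernel s u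

lemma heatKernel_pos {s : ℝ} (hs : 0 < s) (u : ℝ) : 0 < heatKernel s u := by
  unfold heatKernel; positivity

lemma heatKernel_nonneg (s u : ℝ) : 0 ≤ heatKernel s u := by
  unfold heatKernel; positivity

lemma heatKernel_le (s : ℝ) (hs : 0 < s) (u : ℝ) : heatKernel s u ≤ (√(2 * Real.pi * s))⁻¹ := by
  unfold heatKernel
  have : Real.exp (-u ^ 2 / (2 * s)) ≤ 1 := Real.exp_le_one_iff.2 (by
    rw [neg_div]; exact neg_nonpos.2 (by positivity))
  exact mul_le_of_le_one_right (by positivity) this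

lemma heatKernel_eq_gaussianPDFReal (v : ℝ≥0) (u : ℝ) :
    heatKernel v u = gaussianPDFReal 0 v u := by
  simp [heatKernel, gaussianPDFReal]

lemma continuous_heatKernel (s : ℝ) : Continuous (heatKernel s) := by
  unfold heatKernel; fun_prop

lemma continuous_heatKernelDeriv (s : ℝ) : Continuous (heatKernelDeriv s) := by
  unfold heatKernelDeriv; have := continuous_heatKernel s; fun_prop

lemma continuous_heatKernelDeriv2 (s : ℝ) : Continuous (heatKernelDeriv2 s) := by
  unfold heatKernelDeriv2; have := continuous_heatKernel s; fun_prop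

lemma integrable_heatKernel {s : ℝ} (hs : 0 < s) : Integrable (heatKernel s) := by
  have := integrable_gaussianPDFReal 0 ⟨s, hs.le⟩
  refine this.congr (ae_of_all _ fun u => ?_)
  exact (heatKernel_eq_gaussianPDFReal ⟨s, hs.le⟩ u).symm

lemma integral_heatKernel {s : ℝ} (hs : 0 < s) : ∫ u, heatKernel s u = 1 := by
  rw [← integral_gaussianPDFReal_eq_one 0 (v := ⟨s, hs.le⟩) (by
    intro h; exact hs.ne' (congrArg NNReal.toReal h))]
  exact integral_congr_ae (ae_of_all _ fun u => heatKernel_eq_gaussianPDFReal ⟨s, hs.le⟩ u)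

lemma hasDerivAt_heatKernel {s : ℝ} (hs : 0 < s) (u : ℝ) :
    HasDerivAt (heatKernel s) (heatKernelDeriv s u) u := by
  unfold heatKernelDeriv heatKernel
  have h := ((((hasDerivAt_id u).pow 2).neg.div_const (2 * s)).exp).const_mul
    (√(2 * Real.pi * s))⁻¹
  convert! h using 1
  simp
  field_simp

lemma hasDerivAt_heatKernelDeriv {s : ℝ} (hs : 0 < s) (u : ℝ) :
    HasDerivAt (heatKernelDeriv s) (heatKernelDeriv2 s u) u := by
  have h := (((hasDerivAt_id u).div_const s).neg).mul (hasDerivAt_heatKernel hs u)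
  convert! h using 1
  simp [heatKernelDeriv, heatKernelDeriv2]
  field_simp
  ring

/-- The heat equation, which lets a derivative in the noise level be integrated by parts in space.
-/
lemma hasDerivAt_heatKernel_time {s : ℝ} (hs : 0 < s) (u : ℝ) :
    HasDerivAt (fun t => heatKernel t u) (heatKernelDeriv2 s u / 2) s := by
  have hpi := Real.pi_pos
  have h1 : HasDerivAt (fun t : ℝ => (√(2 * Real.pi * t))⁻¹)
      (-(1 / (2 * s)) * (√(2 * Real.pi * s))⁻¹) s := by
    have h := (((hasDerivAt_id s).const_mul (2 * Real.pi)).sqrt (by simp; positivity)).inv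
      (by simp; positivity)
    convert! h using 1
    have : √(2 * Real.pi * s) ≠ 0 := by positivity
    have h2 : √(2 * Real.pi * s) ^ 2 = 2 * Real.pi * s := Real.sq_sqrt (by positivity)
    simp only [id]
    rw [h2]
    field_simp
  have h2 : HasDerivAt (fun t : ℝ => Real.exp (-u ^ 2 / (2 * t)))
      (Real.exp (-u ^ 2 / (2 * s)) * (u ^ 2 / (2 * s ^ 2))) s := by
    have h := ((hasDerivAt_const s (-u ^ 2)).div ((hasDerivAt_id s).const_mul 2)
      (by simp; positivity)).exp
    convert! h using 2
    simp
    field_simp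
  have := h1.mul h2
  convert! this using 1
  simp only [heatKernelDeriv2, heatKernel]
  field_simp
  ring

/-- Compared with variance `B`, the narrower kernel has an extra factor `exp (-c u²)`, which absorbs
`1 + u²`. The strict inequality `b < B` is what makes `c` positive. -/
lemma heatKernel_moment_bound {a b B : ℝ} (ha : 0 < a) (hab : a ≤ b) (hbB : b < B) :
    ∃ C > 0, ∀ s ∈ Set.Icc a b, ∀ u, (1 + u ^ 2) * heatKernel s u ≤ C * heatKernel B u := by
  have hpi := Real.pi_pos
  have hb : 0 < b := ha.trans_le hab
  have hB : 0 < B := hb.trans hbB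
  set c : ℝ := 1 / (2 * b) - 1 / (2 * B) with hc
  have hcpos : 0 < c := by
    rw [hc, sub_pos]; apply one_div_lt_one_div_of_lt <;> linarith
  refine ⟨√(B / a) * (1 + 1 / c), by positivity, fun s hs u => ?_⟩
  have hs0 : 0 < s := ha.trans_le hs.1
  have e1 : (√(2 * Real.pi * s))⁻¹ ≤ √(B / a) * (√(2 * Real.pi * B))⁻¹ := by
    rw [← Real.sqrt_inv, ← Real.sqrt_inv, ← Real.sqrt_mul (by positivity)]
    apply Real.sqrt_le_sqrt
    have : B / a * (2 * Real.pi * B)⁻¹ = (2 * Real.pi * a)⁻¹ := by field_simp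
    rw [this]
    apply inv_anti₀ (by positivity)
    have := hs.1
    gcongr
  have e2 : Real.exp (-u ^ 2 / (2 * s)) ≤
    Real.exp (-(c * u ^ 2)) * Real.exp (-u ^ 2 / (2 * B)) := by
    rw [← Real.exp_add]
    apply Real.exp_le_exp.2
    have h1 : 1 / (2 * b) ≤ 1 / (2 * s) := by
      apply one_div_le_one_div_of_le (by positivity); linarith [hs.2]
    have h2 : -(c * u ^ 2) + -u ^ 2 / (2 * B) = - (u ^ 2 * (1 / (2 * b))) := by rw [hc]; ring
    have h3 : -u ^ 2 / (2 * s) = - (u ^ 2 * (1 / (2 * s))) := by ring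
    rw [h2, h3]
    exact neg_le_neg (mul_le_mul_of_nonneg_left h1 (sq_nonneg u))
  have e3 : (1 + u ^ 2) * Real.exp (-(c * u ^ 2)) ≤ 1 + 1 / c := by
    rw [Real.exp_neg, ← div_eq_mul_inv, div_le_iff₀ (Real.exp_pos _)]
    have h1 := Real.add_one_le_exp (c * u ^ 2)
    have h2 : 0 ≤ c * u ^ 2 := by positivity
    have h3 : (1 + 1 / c) * (c * u ^ 2 + 1) = 1 + u ^ 2 + 1 / c + c * u ^ 2 := by field_simp; ring
    calc 1 + u ^ 2 ≤ (1 + 1 / c) * (c * u ^ 2 + 1) := by rw [h3]; have : 0 < 1 / c := by positivity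
                                                         linarith
      _ ≤ _ := by gcongr
  calc (1 + u ^ 2) * heatKernel s u
      ≤ (1 + u ^ 2) * ((√(B / a) * (√(2 * Real.pi * B))⁻¹) *
        (Real.exp (-(c * u ^ 2)) * Real.exp (-u ^ 2 / (2 * B)))) := by
        unfold heatKernel; gcongr
    _ = √(B / a) * ((1 + u ^ 2) * Real.exp (-(c * u ^ 2))) * heatKernel B u := by
        unfold heatKernel; ring
    _ ≤ √(B / a) * (1 + 1 / c) * heatKernel B u := by
        have := heatKernel_nonneg B u
        gcongr

lemma heatKernel_dom {a b B : ℝ} (ha : 0 < a) (hab : a ≤ b) (hbB : b < B) :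
    ∃ C > 0, ∀ s ∈ Set.Icc a b, ∀ u, heatKernel s u ≤ C * heatKernel B u ∧
      |heatKernelDeriv s u| ≤ C * heatKernel B u ∧ |heatKernelDeriv2 s u| ≤ C * heatKernel B u ∧
      (u / s) ^ 2 * heatKernel s u ≤ C * heatKernel B u := by
  obtain ⟨C, hC, h⟩ := heatKernel_moment_bound ha hab hbB
  refine ⟨(1 + 1 / a + 1 / a ^ 2) * C, by positivity, fun s hs u => ?_⟩
  have hs0 : 0 < s := ha.trans_le hs.1
  have i1 : 1 / s ≤ 1 / a := one_div_le_one_div_of_le ha hs.1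
  have i2 : 1 / s ^ 2 ≤ 1 / a ^ 2 :=
    one_div_le_one_div_of_le (by positivity) (by gcongr; exact hs.1)
  have i0 : 0 < 1 / s := by positivity
  have i3 : 0 < 1 / s ^ 2 := by positivity
  have hk := heatKernel_nonneg s u
  have key : ∀ w : ℝ, w ≤ (1 + 1 / a + 1 / a ^ 2) * (1 + u ^ 2) →
      w * heatKernel s u ≤ (1 + 1 / a + 1 / a ^ 2) * C * heatKernel B u := by
    intro w hw
    calc w * heatKernel s u ≤ (1 + 1 / a + 1 / a ^ 2) * (1 + u ^ 2) * heatKernel s u := by gcongr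
      _ = (1 + 1 / a + 1 / a ^ 2) * ((1 + u ^ 2) * heatKernel s u) := by ring
      _ ≤ (1 + 1 / a + 1 / a ^ 2) * (C * heatKernel B u) := by
          exact mul_le_mul_of_nonneg_left (h s hs u) (by positivity)
      _ = _ := by ring
  have hu := sq_nonneg u
  have ia : 0 < 1 / a := by positivity
  have ia2 : 0 < 1 / a ^ 2 := by positivity
  have habs : |u| ≤ 1 + u ^ 2 := by
    rw [abs_le]; constructor <;> nlinarith [sq_nonneg (u - 1), sq_nonneg (u + 1)]
  refine ⟨?_, ?_, ?_, ?_⟩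
  · have := key 1 (by nlinarith)
    simpa using this
  · unfold heatKernelDeriv
    rw [abs_mul, abs_of_nonneg hk]
    apply key
    rw [abs_neg, abs_div, abs_of_pos hs0, div_eq_mul_one_div]
    calc |u| * (1 / s) ≤ (1 + u ^ 2) * (1 / a) := by gcongr
      _ ≤ _ := by nlinarith [mul_nonneg ia2.le hu]
  · unfold heatKernelDeriv2
    rw [abs_mul, abs_of_nonneg hk]
    apply key
    have e : u ^ 2 / s ^ 2 = u ^ 2 * (1 / s ^ 2) := by ring
    have e2 : u ^ 2 * (1 / s ^ 2) ≤ u ^ 2 * (1 / a ^ 2) := by gcongr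
    have e3 : 0 ≤ u ^ 2 * (1 / s ^ 2) := by positivity
    have e4 : 0 ≤ u ^ 2 * (1 / a) := by positivity
    rw [e, abs_le]
    constructor <;> nlinarith
  · apply key
    have e : (u / s) ^ 2 = u ^ 2 * (1 / s ^ 2) := by field_simp
    have e2 : u ^ 2 * (1 / s ^ 2) ≤ u ^ 2 * (1 / a ^ 2) := by gcongr
    have e4 : 0 ≤ u ^ 2 * (1 / a) := by positivity
    rw [e]
    nlinarith

lemma heatKernel_bounds {a b : ℝ} (ha : 0 < a) (hab : a ≤ b) :
    ∃ C > 0, ∀ s ∈ Set.Icc a b, ∀ u, heatKernel s u ≤ C ∧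
      |heatKernelDeriv s u| ≤ C ∧ |heatKernelDeriv2 s u| ≤ C ∧ (u / s) ^ 2 * heatKernel s u ≤
        C := by
  have hb : 0 < b + 1 := by linarith
  obtain ⟨C, hC, h⟩ := heatKernel_dom ha hab (lt_add_one b)
  have hpi := Real.pi_pos
  refine ⟨C * (√(2 * Real.pi * (b + 1)))⁻¹, by positivity, fun s hs u => ?_⟩
  have hle : C * heatKernel (b + 1) u ≤ C * (√(2 * Real.pi * (b + 1)))⁻¹ := by
    gcongr; exact heatKernel_le _ hb u
  obtain ⟨h1, h2, h3, h4⟩ := h s hs u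
  exact ⟨h1.trans hle, h2.trans hle, h3.trans hle, h4.trans hle⟩

/-! ### Smoothed densities and their derivatives. -/

section Smoothing

variable (μ : Measure ℝ) [IsProbabilityMeasure μ]

/-- The density of `μ` convolved with the centred Gaussian of variance `s`. -/
def heatSmooth (μ : Measure ℝ) (s y : ℝ) : ℝ := ∫ x, heatKernel s (y - x) ∂μ

/-- The spatial derivative of `heatSmooth`. -/
def heatSmoothDeriv (μ : Measure ℝ) (s y : ℝ) : ℝ := ∫ x, heatKernelDeriv s (y - x) ∂μ

/-- The second spatial derivative of `heatSmooth`. -/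
def heatSmoothDeriv2 (μ : Measure ℝ) (s y : ℝ) : ℝ := ∫ x, heatKernelDeriv2 s (y - x) ∂μ

lemma integrable_heatKernel_sub {s : ℝ} (hs : 0 < s) (y : ℝ) :
    Integrable (fun x => heatKernel s (y - x)) μ := by
  obtain ⟨C, -, h⟩ := heatKernel_bounds hs le_rfl
  refine Integrable.of_bound (C := C) ?_ (ae_of_all _ fun x => ?_)
  · have := continuous_heatKernel s
    exact (by fun_prop : Continuous fun x => heatKernel s (y - x)).aestronglyMeasurable
  · rw [Real.norm_eq_abs, abs_of_nonneg (heatKernel_nonneg _ _)]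
    exact (h s (by simp) (y - x)).1

lemma integrable_heatKernelDeriv_sub {s : ℝ} (hs : 0 < s) (y : ℝ) :
    Integrable (fun x => heatKernelDeriv s (y - x)) μ := by
  obtain ⟨C, -, h⟩ := heatKernel_bounds hs le_rfl
  refine Integrable.of_bound (C := C) ?_ (ae_of_all _ fun x => ?_)
  · have := continuous_heatKernelDeriv s
    exact (by fun_prop : Continuous fun x => heatKernelDeriv s (y - x)).aestronglyMeasurable
  · exact (h s (by simp) (y - x)).2.1

lemma integrable_heatKernelDeriv2_sub {s : ℝ} (hs : 0 < s) (y : ℝ) :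
    Integrable (fun x => heatKernelDeriv2 s (y - x)) μ := by
  obtain ⟨C, -, h⟩ := heatKernel_bounds hs le_rfl
  refine Integrable.of_bound (C := C) ?_ (ae_of_all _ fun x => ?_)
  · have := continuous_heatKernelDeriv2 s
    exact (by fun_prop : Continuous fun x => heatKernelDeriv2 s (y - x)).aestronglyMeasurable
  · exact (h s (by simp) (y - x)).2.2.1

lemma integrable_heatKernel_sq_sub {s : ℝ} (hs : 0 < s) (y : ℝ) :
    Integrable (fun x => ((y - x) / s) ^ 2 * heatKernel s (y - x)) μ := by
  obtain ⟨C, -, h⟩ := heatKernel_bounds hs le_rfl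
  refine Integrable.of_bound (C := C) ?_ (ae_of_all _ fun x => ?_)
  · have := continuous_heatKernel s
    exact (by fun_prop :
      Continuous fun x => ((y - x) / s) ^ 2 * heatKernel s (y - x)).aestronglyMeasurable
  · have := heatKernel_nonneg s (y - x)
    rw [Real.norm_eq_abs, abs_of_nonneg (by positivity)]
    exact (h s (by simp) (y - x)).2.2.2

lemma heatSmooth_pos {s : ℝ} (hs : 0 < s) (y : ℝ) : 0 < heatSmooth μ s y := by
  unfold heatSmooth
  rw [integral_pos_iff_support_of_nonneg (fun x => heatKernel_nonneg _ _)
    (integrable_heatKernel_sub μ hs y)]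
  have : Function.support (fun x => heatKernel s (y - x)) = Set.univ := by
    ext x; simp [(heatKernel_pos hs (y - x)).ne']
  simp [this]

lemma heatSmooth_nonneg (μ : Measure ℝ) (s y : ℝ) : 0 ≤ heatSmooth μ s y :=
  integral_nonneg fun _ => heatKernel_nonneg _ _

lemma heatSmooth_le {s : ℝ} (hs : 0 < s) (y : ℝ) :
    heatSmooth μ s y ≤ (√(2 * Real.pi * s))⁻¹ := by
  unfold heatSmooth
  calc ∫ x, heatKernel s (y - x) ∂μ ≤ ∫ x, (√(2 * Real.pi * s))⁻¹ ∂μ :=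
        integral_mono (integrable_heatKernel_sub μ hs y) (integrable_const _)
          fun x => heatKernel_le s hs _
    _ = _ := by simp

lemma hasDerivAt_heatSmooth {s : ℝ} (hs : 0 < s) (y : ℝ) :
    HasDerivAt (heatSmooth μ s) (heatSmoothDeriv μ s y) y := by
  obtain ⟨C, -, h⟩ := heatKernel_bounds hs le_rfl
  refine (hasDerivAt_integral_of_dominated_loc_of_deriv_le (s := Set.univ) (bound := fun _ => C)
    univ_mem (.of_forall fun z => (integrable_heatKernel_sub μ hs z).aestronglyMeasurable)
    (integrable_heatKernel_sub μ hs y)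
    (integrable_heatKernelDeriv_sub μ hs y).aestronglyMeasurable
    (ae_of_all _ fun x z _ => (h s (by simp) (z - x)).2.1) (integrable_const _)
    (ae_of_all _ fun x z _ => ?_)).2
  exact (hasDerivAt_heatKernel hs (z - x)).comp_sub_const z x

lemma hasDerivAt_heatSmoothDeriv {s : ℝ} (hs : 0 < s) (y : ℝ) :
    HasDerivAt (heatSmoothDeriv μ s) (heatSmoothDeriv2 μ s y) y := by
  obtain ⟨C, -, h⟩ := heatKernel_bounds hs le_rfl
  refine (hasDerivAt_integral_of_dominated_loc_of_deriv_le (s := Set.univ) (bound := fun _ => C)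
    univ_mem (.of_forall fun z => (integrable_heatKernelDeriv_sub μ hs z).aestronglyMeasurable)
    (integrable_heatKernelDeriv_sub μ hs y)
    (integrable_heatKernelDeriv2_sub μ hs y).aestronglyMeasurable
    (ae_of_all _ fun x z _ => (h s (by simp) (z - x)).2.2.1) (integrable_const _)
    (ae_of_all _ fun x z _ => ?_)).2
  exact (hasDerivAt_heatKernelDeriv hs (z - x)).comp_sub_const z x

lemma hasDerivAt_heatSmooth_time {s : ℝ} (hs : 0 < s) (y : ℝ) :
    HasDerivAt (fun t => heatSmooth μ t y) (heatSmoothDeriv2 μ s y / 2) s := by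
  obtain ⟨C, -, h⟩ := heatKernel_bounds (a := s / 2) (b := 2 * s) (by linarith) (by linarith)
  have hpos : ∀ t ∈ Set.Icc (s / 2) (2 * s), 0 < t := fun t ht => by linarith [ht.1]
  have := (hasDerivAt_integral_of_dominated_loc_of_deriv_le (μ := μ)
    (F := fun t x => heatKernel t (y - x)) (F' := fun t x => heatKernelDeriv2 t (y - x) / 2)
    (x₀ := s) (s := Set.Icc (s / 2) (2 * s)) (bound := fun _ => C)
    (Icc_mem_nhds (by linarith) (by linarith))
    ((eventually_gt_nhds hs).mono fun t ht =>
      (integrable_heatKernel_sub μ ht y).aestronglyMeasurable)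
    (integrable_heatKernel_sub μ hs y)
    ((integrable_heatKernelDeriv2_sub μ hs y).div_const 2).aestronglyMeasurable
    (ae_of_all _ fun x t ht => ?_) (integrable_const _)
    (ae_of_all _ fun x t ht => hasDerivAt_heatKernel_time (hpos t ht) (y - x))).2
  · rw [integral_div] at this
    exact this
  · have := (h t ht (y - x)).2.2.1
    rw [Real.norm_eq_abs, abs_div, abs_two]
    have := abs_nonneg (heatKernelDeriv2 t (y - x))
    linarith

lemma continuous_heatSmooth {s : ℝ} (hs : 0 < s) : Continuous (heatSmooth μ s) :=
  continuous_iff_continuousAt.2 fun y => (hasDerivAt_heatSmooth μ hs y).continuousAt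

lemma continuous_heatSmoothDeriv {s : ℝ} (hs : 0 < s) : Continuous (heatSmoothDeriv μ s) :=
  continuous_iff_continuousAt.2 fun y => (hasDerivAt_heatSmoothDeriv μ hs y).continuousAt

end Smoothing

/-! ### Cauchy–Schwarz, and Fubini for convolutions. -/

/-- Cauchy–Schwarz for a function whose square is dominated by a product. -/
lemma sq_integral_le_of_sq_le_mul {α : Type*} [MeasurableSpace α] {μ : Measure α} {f F G : α → ℝ}
    (hF : Integrable F μ) (hG : Integrable G μ) (hf : AEStronglyMeasurable f μ)
    (hF0 : ∀ x, 0 ≤ F x) (hG0 : ∀ x, 0 ≤ G x) (h : ∀ x, f x ^ 2 ≤ F x * G x) :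
    Integrable f μ ∧ (∫ x, f x ∂μ) ^ 2 ≤ (∫ x, F x ∂μ) * ∫ x, G x ∂μ := by
  have hfi : Integrable f μ := by
    refine (hF.add hG).mono' hf (ae_of_all _ fun x => ?_)
    have h1 : f x ^ 2 ≤ (F x + G x) ^ 2 := by
      nlinarith [h x, hF0 x, hG0 x, mul_nonneg (hF0 x) (hG0 x)]
    exact abs_le_of_sq_le_sq h1 (add_nonneg (hF0 x) (hG0 x))
  refine ⟨hfi, ?_⟩
  have key : ∀ c : ℝ, 0 ≤ (∫ x, F x ∂μ) * (c * c) + (2 * ∫ x, f x ∂μ) * c + ∫ x, G x ∂μ := by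
    intro c
    have e : (∫ x, F x ∂μ) * (c * c) + (2 * ∫ x, f x ∂μ) * c + ∫ x, G x ∂μ
        = ∫ x, (F x * (c * c) + f x * (2 * c) + G x) ∂μ := by
      have i1 := hF.mul_const (c * c)
      have i2 := hfi.mul_const (2 * c)
      have e1 := integral_add i1 i2
      have e2 := integral_add (i1.add i2) hG
      simp only [Pi.add_apply] at e2
      rw [e2, e1, integral_mul_const, integral_mul_const]
      ring
    rw [e]
    refine integral_nonneg fun x => ?_
    rcases (hF0 x).eq_or_lt with h0 | h0
    · have : f x = 0 := by have := h x; rw [← h0, zero_mul] at this; nlinarith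
      simp [← h0, this, hG0 x]
    · have : 0 ≤ F x * (F x * (c * c) + f x * (2 * c) + G x) := by
        nlinarith [sq_nonneg (F x * c + f x), h x]
      exact nonneg_of_mul_nonneg_right this h0
  have := discrim_le_zero key
  unfold discrim at this
  nlinarith

lemma integrable_mul_comp_sub {κ : Measure ℝ} [SFinite κ] {h g : ℝ → ℝ} (hh : Integrable h κ)
    (hg : Integrable g) :
    Integrable (fun z : ℝ × ℝ => h z.1 * g (z.2 - z.1)) (κ.prod volume) := by
  have h1 := (measurePreserving_prod_neg_add κ (volume : Measure ℝ))
  have h2 : Integrable (fun z : ℝ × ℝ => h z.1 * g z.2) (κ.prod volume) := hh.mul_prod hg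
  have h3 := h1.integrable_comp_of_integrable h2
  refine h3.congr (ae_of_all _ fun z => ?_)
  simp only [Function.comp_apply]
  rw [neg_add_eq_sub]

lemma integrable_integral_mul_comp_sub {κ : Measure ℝ} [SFinite κ] {h g : ℝ → ℝ}
    (hh : Integrable h κ) (hg : Integrable g) :
    Integrable (fun y => ∫ x, h x * g (y - x) ∂κ) :=
  (integrable_mul_comp_sub hh hg).integral_prod_right

lemma integral_integral_mul_comp_sub {κ : Measure ℝ} [SFinite κ] {h g : ℝ → ℝ}
    (hh : Integrable h κ) (hg : Integrable g) :
    ∫ y, ∫ x, h x * g (y - x) ∂κ = (∫ x, h x ∂κ) * ∫ y, g y := by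
  have h1 := integral_integral_swap (f := fun x y => h x * g (y - x))
    (integrable_mul_comp_sub hh hg)
  rw [← h1]
  simp_rw [integral_const_mul, integral_sub_right_eq_self g]
  rw [integral_mul_const]

lemma integrable_integral_comp_sub {κ : Measure ℝ} [IsProbabilityMeasure κ] {g : ℝ → ℝ}
    (hg : Integrable g) : Integrable (fun y => ∫ x, g (y - x) ∂κ) := by
  simpa using integrable_integral_mul_comp_sub (integrable_const (1 : ℝ)) hg (κ := κ)

lemma integral_integral_comp_sub {κ : Measure ℝ} [IsProbabilityMeasure κ] {g : ℝ → ℝ}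
    (hg : Integrable g) : ∫ y, ∫ x, g (y - x) ∂κ = ∫ y, g y := by
  simpa using integral_integral_mul_comp_sub (integrable_const (1 : ℝ)) hg (κ := κ)

/-! ### Comparison of smoothed densities, and de Bruijn's identity at positive times. -/

section Smoothing

variable (μ : Measure ℝ) [IsProbabilityMeasure μ]

lemma integrable_heatSmooth {s : ℝ} (hs : 0 < s) : Integrable (heatSmooth μ s) :=
  integrable_integral_comp_sub (integrable_heatKernel hs)

lemma integral_heatSmooth {s : ℝ} (hs : 0 < s) : ∫ y, heatSmooth μ s y = 1 :=
  (integral_integral_comp_sub (integrable_heatKernel hs)).trans (integral_heatKernel hs)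

/-- The bounds on the kernels integrate against `μ`, uniformly in the time. For the last one, `k'² =
k · (u / s)² k` and Cauchy–Schwarz bound the square of the derivative by the density times the
integral of `(u / s)² k`. -/
lemma heatSmooth_dom {a b B : ℝ} (ha : 0 < a) (hab : a ≤ b) (hbB : b < B) :
    ∃ C > 0, ∀ s ∈ Set.Icc a b, ∀ y, heatSmooth μ s y ≤ C * heatSmooth μ B y ∧
      |heatSmoothDeriv μ s y| ≤ C * heatSmooth μ B y ∧
      |heatSmoothDeriv2 μ s y| ≤ C * heatSmooth μ B y ∧
      heatSmoothDeriv μ s y ^ 2 / heatSmooth μ s y ≤ C * heatSmooth μ B y := by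
  obtain ⟨C, hC, h⟩ := heatKernel_dom ha hab hbB
  have hB : 0 < B := by linarith
  refine ⟨C, hC, fun s hs y => ?_⟩
  have hs0 : 0 < s := ha.trans_le hs.1
  have e : C * heatSmooth μ B y = ∫ x, C * heatKernel B (y - x) ∂μ := by
    rw [integral_const_mul]; rfl
  have hBi := (integrable_heatKernel_sub μ hB y).const_mul C
  have i0 := integrable_heatKernel_sub μ hs0 y
  have i1 := integrable_heatKernelDeriv_sub μ hs0 y
  have i3 := integrable_heatKernel_sq_sub μ hs0 y
  rw [e]
  refine ⟨integral_mono i0 hBi fun x => (h s hs (y - x)).1, ?_, ?_, ?_⟩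
  · exact (abs_integral_le_integral_abs).trans (integral_mono i1.abs hBi
      fun x => (h s hs (y - x)).2.1)
  · exact (abs_integral_le_integral_abs).trans (integral_mono
      (integrable_heatKernelDeriv2_sub μ hs0 y).abs hBi fun x => (h s hs (y - x)).2.2.1)
  · have hcs := (sq_integral_le_of_sq_le_mul i0 i3 i1.aestronglyMeasurable
      (fun x => heatKernel_nonneg _ _)
      (fun x => mul_nonneg (sq_nonneg _) (heatKernel_nonneg _ _))
      (fun x => le_of_eq (by unfold heatKernelDeriv; ring))).2
    have hp := heatSmooth_pos μ hs0 y
    rw [div_le_iff₀ hp, mul_comm]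
    refine hcs.trans ?_
    exact mul_le_mul_of_nonneg_left (integral_mono i3 hBi fun x => (h s hs (y - x)).2.2.2) hp.le

lemma heatKernel_rpow {s B : ℝ} (hs : 0 < s) (hB : 0 < B) (u : ℝ) :
    heatKernel B u ^ (B / s) =
      ((√(2 * Real.pi * B))⁻¹ ^ (B / s) * √(2 * Real.pi * s)) * heatKernel s u := by
  have hpi := Real.pi_pos
  unfold heatKernel
  rw [Real.mul_rpow (by positivity) (Real.exp_pos _).le, ← Real.exp_mul]
  have : -u ^ 2 / (2 * B) * (B / s) = -u ^ 2 / (2 * s) := by field_simp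
  rw [this]
  have : √(2 * Real.pi * s) ≠ 0 := by positivity
  field_simp

/-- Jensen for the power `B / s ≥ 1`, which up to a constant shrinks the variance of a Gaussian from
`B` to `s`. This bounds the narrower smoothing below by the wider one, the direction opposite to
`heatSmooth_dom`. -/
lemma heatSmooth_rpow_le {s B : ℝ} (hs : 0 < s) (hsB : s ≤ B) (y : ℝ) :
    heatSmooth μ B y ^ (B / s) ≤
      ((√(2 * Real.pi * B))⁻¹ ^ (B / s) * √(2 * Real.pi * s)) * heatSmooth μ s y := by
  have hB := hs.trans_le hsB
  have hr : 1 ≤ B / s := by rwa [one_le_div hs]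
  have hi : Integrable (fun x => heatKernel B (y - x) ^ (B / s)) μ := by
    simp_rw [heatKernel_rpow hs hB]
    exact (integrable_heatKernel_sub μ hs y).const_mul _
  have := (convexOn_rpow hr).map_integral_le (μ := μ) (f := fun x => heatKernel B (y - x))
    (Real.continuous_rpow_const (by linarith)).continuousOn isClosed_Ici
    (ae_of_all _ fun x => heatKernel_nonneg _ _) (integrable_heatKernel_sub μ hB y) hi
  refine this.trans (le_of_eq ?_)
  simp only [heatKernel_rpow hs hB]
  rw [integral_const_mul]; rfl

/-- The upper bound on the logarithm comes from domination by the wider smoothing, the lower one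
from `heatSmooth_rpow_le`. Uniformity in `s` is what allows differentiation of the entropy under the
integral. -/
lemma abs_log_heatSmooth_le {a b B : ℝ} (ha : 0 < a) (hab : a ≤ b) (hbB : b < B) :
    ∃ C > 0, ∀ s ∈ Set.Icc a b, ∀ y,
      |Real.log (heatSmooth μ s y)| ≤ C * (1 + |Real.log (heatSmooth μ B y)|) := by
  have hpi := Real.pi_pos
  have hB : 0 < B := by linarith
  obtain ⟨C, hC, h⟩ := heatSmooth_dom μ ha hab hbB
  set A := |Real.log (√(2 * Real.pi * B))⁻¹|
  set D := |Real.log √(2 * Real.pi * a)| + |Real.log √(2 * Real.pi * b)|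
  refine ⟨1 + |Real.log C| + B / a * (1 + A) + D, by positivity, fun s hs y => ?_⟩
  have hs0 : 0 < s := ha.trans_le hs.1
  have hp := heatSmooth_pos μ hs0 y
  have hpB := heatSmooth_pos μ hB y
  set L := Real.log (heatSmooth μ B y)
  have up : Real.log (heatSmooth μ s y) ≤ |Real.log C| + |L| := by
    have := Real.log_le_log hp (h s hs y).1
    rw [Real.log_mul hC.ne' hpB.ne'] at this
    linarith [le_abs_self (Real.log C), le_abs_self L]
  have hrB : B / s ≤ B / a := by gcongr; exact hs.1
  have hr0 : 0 < B / s := by positivity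
  have hD : Real.log √(2 * Real.pi * s) ≤ D := by
    have : Real.log √(2 * Real.pi * s) ≤ Real.log √(2 * Real.pi * b) := by
      apply Real.log_le_log (by positivity)
      apply Real.sqrt_le_sqrt
      have := hs.2
      gcongr
    have h1 := le_abs_self (Real.log √(2 * Real.pi * b))
    have h2 := abs_nonneg (Real.log √(2 * Real.pi * a))
    simp only [D]; linarith
  have lo : B / s * L ≤ B / s * A + D + Real.log (heatSmooth μ s y) := by
    have := Real.log_le_log (by positivity) (heatSmooth_rpow_le μ hs0 (hs.2.trans hbB.le) y)
    rw [Real.log_rpow hpB, Real.log_mul (by positivity) hp.ne', Real.log_mul (by positivity)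
      (by positivity), Real.log_rpow (by positivity)] at this
    have h3 : B / s * Real.log (√(2 * Real.pi * B))⁻¹ ≤ B / s * A := by
      gcongr; exact le_abs_self _
    linarith
  have hA : 0 ≤ A := abs_nonneg _
  have hD0 : 0 ≤ D := by positivity
  have hL := abs_nonneg L
  have hlC := abs_nonneg (Real.log C)
  have q1 : B / s * A ≤ B / a * A := by gcongr
  have q2 : -(B / s * L) ≤ B / a * |L| := by
    calc -(B / s * L) = B / s * (-L) := by ring
      _ ≤ B / s * |L| := by gcongr; exact neg_le_abs L
      _ ≤ _ := by gcongr
  have q3 : 0 ≤ B / a * A := by positivity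
  have q4 : 0 ≤ B / a * A * |L| := by positivity
  have q5 : 0 ≤ B / a := by positivity
  have q6 : 0 ≤ D * |L| := by positivity
  have q7 : 0 ≤ B / a * |L| := by positivity
  have q8 : 0 ≤ |Real.log C| * |L| := by positivity
  have expand : (1 + |Real.log C| + B / a * (1 + A) + D) * (1 + |L|) =
    1 + |L| + |Real.log C| + |Real.log C| * |L| + B / a + B / a * A + B / a * |L| +
      B / a * A * |L| + D + D * |L| := by ring
  rw [expand, abs_le]
  constructor <;> linarith

lemma integrable_sq_heatSmoothDeriv_div {t : ℝ} (ht : 0 < t) :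
    Integrable fun y => heatSmoothDeriv μ t y ^ 2 / heatSmooth μ t y := by
  obtain ⟨C, hC, hdom⟩ := heatSmooth_dom μ ht le_rfl (lt_add_one t)
  refine ((integrable_heatSmooth μ (by linarith : 0 < t + 1)).const_mul C).mono'
    (((continuous_heatSmoothDeriv μ ht).pow 2).div₀ (continuous_heatSmooth μ ht)
      fun y => (heatSmooth_pos μ ht y).ne').aestronglyMeasurable (ae_of_all _ fun y => ?_)
  rw [Real.norm_eq_abs, abs_of_nonneg (div_nonneg (sq_nonneg _) (heatSmooth_nonneg _ _ _))]
  exact (hdom t (by simp) y).2.2.2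

/-- De Bruijn's identity at positive times, for the density of `μ` smoothed by a Gaussian. -/
theorem hasDerivAt_integral_negMulLog_heatSmooth {t B : ℝ} (ht : 0 < t) (htB : t < B)
    (hB : Integrable fun y => Real.negMulLog (heatSmooth μ B y)) :
    HasDerivAt (fun s => ∫ y, Real.negMulLog (heatSmooth μ s y))
      (1 / 2 * ∫ y, heatSmoothDeriv μ t y ^ 2 / heatSmooth μ t y) t := by
  set a := t / 2
  set b := (t + B) / 2
  have ha : 0 < a := by simp only [a]; linarith
  have hat : a < t := by simp only [a]; linarith
  have htb : t < b := by simp only [b]; linarith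
  have hbB : b < B := by simp only [b]; linarith
  have hB0 : 0 < B := ht.trans htB
  obtain ⟨C, hC, hdom⟩ := heatSmooth_dom μ ha (hat.trans htb).le hbB
  obtain ⟨C', hC', hlog⟩ := abs_log_heatSmooth_le μ ha (hat.trans htb).le hbB
  have htab : t ∈ Set.Icc a b := ⟨hat.le, htb.le⟩
  -- A majorant for all times in `[a, b]`, built from the density at time `B` and its logarithm; its
  -- integrability is where the finite entropy at time `B` enters.
  set D : ℝ → ℝ := fun y => C * heatSmooth μ B y * (1 + C' * (1 + |Real.log (heatSmooth μ B y)|))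
  have hD : Integrable D := by
    have h1 := (((integrable_heatSmooth μ hB0).const_mul (C * (1 + C'))).add
      (hB.abs.const_mul (C * C')))
    refine h1.congr (ae_of_all _ fun y => ?_)
    have := heatSmooth_nonneg μ B y
    simp only [D, Real.negMulLog, abs_mul, abs_neg, abs_of_nonneg this, Pi.add_apply]
    ring
  have hcont : ∀ {s}, 0 < s → Continuous fun y => Real.negMulLog (heatSmooth μ s y) :=
    fun hs => Real.continuous_negMulLog.comp (continuous_heatSmooth μ hs)
  have hfac : ∀ s ∈ Set.Icc a b, ∀ y w, |w| ≤ C * heatSmooth μ B y →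
      |w * (Real.log (heatSmooth μ s y) + 1)| ≤ D y := by
    intro s hs y w hw
    rw [abs_mul]
    have h1 : |Real.log (heatSmooth μ s y) + 1| ≤
        1 + C' * (1 + |Real.log (heatSmooth μ B y)|) := by
      refine (abs_add_le _ _).trans ?_
      rw [abs_one]; linarith [hlog s hs y]
    exact mul_le_mul hw h1 (abs_nonneg _) ((abs_nonneg _).trans hw)
  have hint : Integrable fun y => Real.negMulLog (heatSmooth μ t y) := by
    refine hD.mono' (hcont ht).aestronglyMeasurable (ae_of_all _ fun y => ?_)
    have h0 := heatSmooth_nonneg μ t y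
    have h1 : |heatSmooth μ t y| ≤ C * heatSmooth μ B y := by
      rw [abs_of_nonneg h0]; exact (hdom t htab y).1
    rw [Real.norm_eq_abs, Real.negMulLog, abs_mul, abs_neg]
    refine mul_le_mul h1 ((hlog t htab y).trans ?_) (abs_nonneg _) ((abs_nonneg _).trans h1)
    linarith
  have hK2meas : Measurable (heatSmoothDeriv2 μ t) := by
    have : heatSmoothDeriv2 μ t = deriv (heatSmoothDeriv μ t) :=
      funext fun y => (hasDerivAt_heatSmoothDeriv μ ht y).deriv.symm
    rw [this]; exact measurable_deriv _
  have hKm := (continuous_heatSmooth μ ht).measurable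
  have main := hasDerivAt_integral_of_dominated_loc_of_deriv_le (μ := volume)
    (F := fun s y => Real.negMulLog (heatSmooth μ s y))
    (F' := fun s y => (-Real.log (heatSmooth μ s y) - 1) * (heatSmoothDeriv2 μ s y / 2))
    (x₀ := t) (s := Set.Icc a b) (bound := D) (Icc_mem_nhds hat htb)
    ((eventually_gt_nhds ht).mono fun s hs => (hcont hs).aestronglyMeasurable) hint
    (by fun_prop)
    (ae_of_all _ fun y s hs => by
      rw [Real.norm_eq_abs]
      have h2 : |heatSmoothDeriv2 μ s y / 2| ≤ C * heatSmooth μ B y := by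
        have := (hdom s hs y).2.2.1
        rw [abs_div, abs_two]
        linarith [abs_nonneg (heatSmoothDeriv2 μ s y)]
      have := hfac s hs y _ h2
      rwa [← abs_neg, show -((-Real.log (heatSmooth μ s y) - 1) * (heatSmoothDeriv2 μ s y / 2)) =
        heatSmoothDeriv2 μ s y / 2 * (Real.log (heatSmooth μ s y) + 1) by ring])
    hD
    (ae_of_all _ fun y s hs => by
      have hs0 : 0 < s := ha.trans_le hs.1
      exact (Real.hasDerivAt_negMulLog (heatSmooth_pos μ hs0 y).ne').comp s
        (hasDerivAt_heatSmooth_time μ hs0 y))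
  refine main.2.congr_deriv ?_
  have hf2 : Integrable fun y => heatSmoothDeriv2 μ t y * (Real.log (heatSmooth μ t y) + 1) :=
    hD.mono' (by fun_prop) (ae_of_all _ fun y => hfac t htab y _ (hdom t htab y).2.2.1)
  have hK1m := (continuous_heatSmoothDeriv μ ht).measurable
  have hf1 : Integrable fun y => heatSmoothDeriv μ t y * (Real.log (heatSmooth μ t y) + 1) :=
    hD.mono' (by fun_prop) (ae_of_all _ fun y => hfac t htab y _ (hdom t htab y).2.1)
  have hJ := integrable_sq_heatSmoothDeriv_div μ ht
  -- With `K` the density, `K' (log K + 1)` and its derivative `K'' (log K + 1) + K'² / K` are both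
  -- integrable, so there are no boundary terms.
  have ibp := integral_eq_zero_of_hasDerivAt_of_integrable
    (f := fun y => heatSmoothDeriv μ t y * (Real.log (heatSmooth μ t y) + 1))
    (f' := fun y => heatSmoothDeriv2 μ t y * (Real.log (heatSmooth μ t y) + 1) +
      heatSmoothDeriv μ t y ^ 2 / heatSmooth μ t y) (fun y => by
        have h := (hasDerivAt_heatSmoothDeriv μ ht y).mul
          (((hasDerivAt_heatSmooth μ ht y).log (heatSmooth_pos μ ht y).ne').add_const 1)
        convert! h using 1
        ring) (hf2.add hJ) hf1
  rw [integral_add hf2 hJ] at ibp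
  calc ∫ y, (-Real.log (heatSmooth μ t y) - 1) * (heatSmoothDeriv2 μ t y / 2)
      = ∫ y, (-1 / 2) * (heatSmoothDeriv2 μ t y * (Real.log (heatSmooth μ t y) + 1)) := by
        congr 1; ext y; ring
    _ = 1 / 2 * ∫ y, heatSmoothDeriv μ t y ^ 2 / heatSmooth μ t y := by
        rw [integral_const_mul]; linarith

end Smoothing

/-! ### Fatou with an upper bound, and elementary entropy inequalities. -/

/-- Fatou's lemma combined with an upper bound for the integrals. -/
lemma tendsto_integral_of_nonneg_of_le {α ι : Type*} [MeasurableSpace α] {μ : Measure α}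
    {l : Filter ι} [l.IsCountablyGenerated] {f : ι → α → ℝ} {g : α → ℝ} {u : ι → ℝ}
    (hf : ∀ᶠ i in l, Integrable (f i) μ ∧ ∀ x, 0 ≤ f i x) (hg : Integrable g μ)
    (hfg : ∀ᵐ x ∂μ, Tendsto (fun i => f i x) l (𝓝 (g x))) (hu : Tendsto u l (𝓝 (∫ x, g x ∂μ)))
    (hfu : ∀ᶠ i in l, ∫ x, f i x ∂μ ≤ u i) :
    Tendsto (fun i => ∫ x, f i x ∂μ) l (𝓝 (∫ x, g x ∂μ)) := by
  classical
  rcases l.eq_or_neBot with rfl | hl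
  · exact tendsto_bot
  -- Fatou's lemma wants measurability for every index, while the hypotheses hold only eventually;
  -- the exceptional members are replaced by zero.
  set f' : ι → α → ℝ := fun i => if Integrable (f i) μ ∧ ∀ x, 0 ≤ f i x then f i else 0 with hf'
  have hff' : ∀ᶠ i in l, f' i = f i := hf.mono fun i hi => by simp only [f']; rw [if_pos hi]
  have hi' : ∀ i, Integrable (f' i) μ := fun i => by
    simp only [f']; split_ifs with h
    · exact h.1
    · exact integrable_zero _ _ _
  have h0' : ∀ i x, 0 ≤ f' i x := fun i x => by
    simp only [f']; split_ifs with h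
    · exact h.2 x
    · exact le_rfl
  have hg0 : 0 ≤ᵐ[μ] g := by
    filter_upwards [hfg] with x hx
    exact ge_of_tendsto hx (hf.mono fun i hi => hi.2 x)
  have fatou : ENNReal.ofReal (∫ x, g x ∂μ) ≤
      liminf (fun i => ENNReal.ofReal (∫ x, f' i x ∂μ)) l := by
    calc ENNReal.ofReal (∫ x, g x ∂μ) = ∫⁻ x, ENNReal.ofReal (g x) ∂μ :=
          ofReal_integral_eq_lintegral_ofReal hg hg0
      _ = ∫⁻ x, liminf (fun i => ENNReal.ofReal (f' i x)) l ∂μ := by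
          refine lintegral_congr_ae ?_
          filter_upwards [hfg] with x hx
          refine (Tendsto.liminf_eq ?_).symm
          refine (ENNReal.continuous_ofReal.tendsto _).comp (hx.congr' ?_)
          exact hff'.mono fun i hi => (congrFun hi x).symm
      _ ≤ liminf (fun i => ∫⁻ x, ENNReal.ofReal (f' i x) ∂μ) l :=
          lintegral_liminf_le' fun i => (hi' i).aemeasurable.ennreal_ofReal
      _ = _ := by
          congr 1; ext i
          exact (ofReal_integral_eq_lintegral_ofReal (hi' i) (ae_of_all _ (h0' i))).symm
  rw [tendsto_order]
  refine ⟨fun a ha => ?_, fun b hb => ?_⟩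
  · rcases lt_or_ge a 0 with h | h
    · exact hf.mono fun i hi => h.trans_le (integral_nonneg hi.2)
    · have h1 : ENNReal.ofReal a < ENNReal.ofReal (∫ x, g x ∂μ) :=
        (ENNReal.ofReal_lt_ofReal_iff (h.trans_lt ha)).2 ha
      have h2 := eventually_lt_of_lt_liminf (h1.trans_le fatou)
      filter_upwards [h2, hff'] with i hi hi'
      rw [hi'] at hi
      by_contra hcon
      exact absurd hi (not_lt.2 (ENNReal.ofReal_le_ofReal (not_lt.1 hcon)))
  · filter_upwards [hfu, hu.eventually_lt_const hb] with i h1 h2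
    exact h1.trans_lt h2

/-- This is `log x ≤ x - 1` at `x = exp (-l) / a`. Integrated it is Gibbs' inequality; pointwise it
makes the integrand of the relative entropy to `exp (-l)` nonnegative, as Fatou requires. -/
lemma negMulLog_le_mul_add_exp {a : ℝ} (ha : 0 ≤ a) (l : ℝ) :
    Real.negMulLog a ≤ a * l + Real.exp (-l) - a := by
  rcases ha.eq_or_lt with rfl | h
  · simp [Real.exp_nonneg]
  · have h1 := Real.log_le_sub_one_of_pos (div_pos (Real.exp_pos (-l)) h)
    rw [Real.log_div (Real.exp_pos _).ne' h.ne', Real.log_exp] at h1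
    have h2 := mul_le_mul_of_nonneg_left h1 h.le
    have h3 : a * (Real.exp (-l) / a - 1) = Real.exp (-l) - a := by field_simp
    rw [h3] at h2
    unfold Real.negMulLog
    linarith

lemma neg_mul_abs_log_le_negMulLog {a M : ℝ} (ha : 0 ≤ a) (haM : a ≤ M) :
    -(a * |Real.log M|) ≤ Real.negMulLog a := by
  rcases ha.eq_or_lt with rfl | h
  · simp
  · have := (Real.log_le_log h haM).trans (le_abs_self _)
    unfold Real.negMulLog
    nlinarith

/-- A bounded integrable density has finite entropy if its cross entropy with respect to an
integrable weight is finite. -/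
lemma integrable_negMulLog_of_cross {p l : ℝ → ℝ} {M : ℝ} (hp0 : ∀ x, 0 ≤ p x)
    (hpM : ∀ x, p x ≤ M) (hp : Integrable p) (hl : Integrable fun x => Real.exp (-l x))
    (hpl : Integrable fun x => p x * l x) : Integrable fun x => Real.negMulLog (p x) := by
  refine (((hpl.abs.add hl).add hp).add (hp.mul_const |Real.log M|)).mono'
    (Real.continuous_negMulLog.comp_aestronglyMeasurable hp.aestronglyMeasurable)
    (ae_of_all _ fun x => ?_)
  have h1 := negMulLog_le_mul_add_exp (hp0 x) (l x)
  have h2 := neg_mul_abs_log_le_negMulLog (hp0 x) (hpM x)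
  have h3 := Real.exp_pos (-l x)
  have h4 := hp0 x
  have h5 := le_abs_self (p x * l x)
  have h6 : 0 ≤ p x * |Real.log M| := by positivity
  have h7 := abs_nonneg (p x * l x)
  simp only [Pi.add_apply, Real.norm_eq_abs]
  rw [abs_le]
  constructor <;> linarith

/-- Convolution with a probability measure does not decrease the entropy. -/
lemma integral_negMulLog_le_of_conv {κ : Measure ℝ} [IsProbabilityMeasure κ] {p : ℝ → ℝ} {M : ℝ}
    (hp0 : ∀ x, 0 ≤ p x) (hpM : ∀ x, p x ≤ M) (hpc : Continuous p)
    (hp : Integrable fun x => Real.negMulLog (p x))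
    (hP : Integrable fun y => Real.negMulLog (∫ x, p (y - x) ∂κ)) :
    ∫ x, Real.negMulLog (p x) ≤ ∫ y, Real.negMulLog (∫ x, p (y - x) ∂κ) := by
  -- By Fubini and translation invariance the left side is the integral of the averages of
  -- `negMulLog` over the noise, so concavity can be used pointwise in `y`.
  rw [← integral_integral_comp_sub (κ := κ) hp]
  refine integral_mono (integrable_integral_comp_sub hp) hP fun y => ?_
  have hc : Continuous fun x => p (y - x) := by fun_prop
  obtain ⟨C, hC⟩ := isCompact_Icc.exists_bound_of_continuousOn (s := Set.Icc 0 M)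
    Real.continuous_negMulLog.continuousOn
  have hi1 : Integrable (fun x => p (y - x)) κ :=
    Integrable.of_bound (C := M) hc.aestronglyMeasurable (ae_of_all _ fun x => by
      rw [Real.norm_eq_abs, abs_of_nonneg (hp0 _)]; exact hpM _)
  have hi2 : Integrable (fun x => Real.negMulLog (p (y - x))) κ :=
    Integrable.of_bound (C := C) (Real.continuous_negMulLog.comp hc).aestronglyMeasurable
      (ae_of_all _ fun x => hC _ ⟨hp0 _, hpM _⟩)
  exact Real.concaveOn_negMulLog.le_map_integral Real.continuous_negMulLog.continuousOn
    isClosed_Ici (ae_of_all _ fun x => hp0 _) hi1 hi2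

/-! ### Lipschitz weights for the cross entropy. -/

/-- A Lipschitz function `l` such that `exp (-l)` is integrable. -/
structure IsEntropyWeight (l : ℝ → ℝ) : Prop where
  lipschitz : ∃ K, LipschitzWith K l
  integrable_exp : Integrable fun x => Real.exp (-l x)

lemma IsEntropyWeight.continuous {l : ℝ → ℝ} (hl : IsEntropyWeight l) : Continuous l :=
  hl.lipschitz.choose_spec.continuous

/-- Here `exp (-l)` is the Cauchy profile, so finite cross entropy costs only a logarithmic moment.
-/
lemma isEntropyWeight_log : IsEntropyWeight fun x => Real.log (1 + x ^ 2) where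
  lipschitz := by
    have hd : ∀ x : ℝ, HasDerivAt (fun x : ℝ => Real.log (1 + x ^ 2)) (2 * x / (1 + x ^ 2)) x := by
      intro x
      have h := ((hasDerivAt_pow 2 x).const_add 1).log (by positivity)
      convert! h using 1
      norm_num
    refine ⟨1, lipschitzWith_of_nnnorm_deriv_le (fun x => (hd x).differentiableAt) fun x => ?_⟩
    rw [(hd x).deriv, ← NNReal.coe_le_coe, coe_nnnorm, Real.norm_eq_abs, NNReal.coe_one, abs_div,
      abs_of_pos (by positivity : (0 : ℝ) < 1 + x ^ 2), div_le_one (by positivity), abs_le]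
    constructor <;> nlinarith [sq_nonneg (x - 1), sq_nonneg (x + 1)]
  integrable_exp := by
    refine integrable_inv_one_add_sq.congr (ae_of_all _ fun x => ?_)
    dsimp only
    rw [Real.exp_neg, Real.exp_log (by positivity)]

lemma integrable_log_one_add_sq {μ : Measure ℝ} (h : Integrable (fun x => Real.log (1 + |x|)) μ) :
    Integrable (fun x => Real.log (1 + x ^ 2)) μ := by
  refine (h.const_mul 2).mono' isEntropyWeight_log.continuous.aestronglyMeasurable
    (ae_of_all _ fun x => ?_)
  have h1 : 0 ≤ Real.log (1 + x ^ 2) := Real.log_nonneg (by nlinarith [sq_nonneg x])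
  rw [Real.norm_eq_abs, abs_of_nonneg h1, show (2 : ℝ) * Real.log (1 + |x|) =
    Real.log ((1 + |x|) ^ 2) by rw [Real.log_pow]; norm_num]
  apply Real.log_le_log (by positivity)
  nlinarith [abs_nonneg x, sq_abs x]

lemma integrable_exp_neg_abs : Integrable fun x : ℝ => Real.exp (-|x|) := by
  rw [← integrableOn_univ, ← Set.Iic_union_Ioi (a := (0 : ℝ))]
  refine IntegrableOn.union ?_ ?_
  · refine (integrableOn_exp_Iic 0).congr_fun (fun x hx => ?_) measurableSet_Iic
    simp [abs_of_nonpos (Set.mem_Iic.1 hx)]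
  · refine (integrableOn_exp_neg_Ioi 0).congr_fun (fun x hx => ?_) measurableSet_Ioi
    simp [abs_of_pos (Set.mem_Ioi.1 hx)]

/-! ### Densities of finite Fisher information, and the weight they produce. -/

/-- A locally absolutely continuous probability density with finite Fisher information. -/
structure IsFisherDensity (p : ℝ → ℝ) : Prop where
  nonneg : ∀ x, 0 ≤ p x
  absCont : ∀ a b : ℝ, AbsolutelyContinuousOnInterval p a b
  integrable : Integrable p
  integral_eq_one : ∫ x, p x = 1
  integrable_fisher : Integrable fun x => deriv p x ^ 2 / p x

lemma continuous_of_absolutelyContinuousOnInterval {p : ℝ → ℝ}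
    (h : ∀ a b : ℝ, AbsolutelyContinuousOnInterval p a b) : Continuous p := by
  refine continuous_iff_continuousAt.2 fun x => ?_
  refine (h (x - 1) (x + 1)).continuousOn.continuousAt ?_
  rw [Set.uIcc_of_le (by linarith)]
  exact Icc_mem_nhds (by linarith) (by linarith)

/-- A zero of a nonnegative function is a minimum. With the convention `x / 0 = 0`, the
factorisation `p'² = p · (p'² / p)` then holds at zeros of `p` too. -/
lemma deriv_eq_zero_of_nonneg {p : ℝ → ℝ} (hp : ∀ x, 0 ≤ p x) {x : ℝ} (hx : p x = 0) :
    deriv p x = 0 :=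
  IsLocalMin.deriv_eq_zero (Eventually.of_forall fun y => by rw [hx]; exact hp y)

namespace IsFisherDensity

variable {p : ℝ → ℝ} (hp : IsFisherDensity p)
include hp

lemma continuous : Continuous p := continuous_of_absolutelyContinuousOnInterval hp.absCont

lemma sq_deriv_eq (x : ℝ) : deriv p x ^ 2 = p x * (deriv p x ^ 2 / p x) := by
  by_cases h : p x = 0
  · simp [deriv_eq_zero_of_nonneg hp.nonneg h]
  · field_simp

lemma fisher_nonneg (x : ℝ) : 0 ≤ deriv p x ^ 2 / p x := div_nonneg (sq_nonneg _) (hp.nonneg x)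

lemma integrable_deriv : Integrable (deriv p) :=
  (sq_integral_le_of_sq_le_mul hp.integrable hp.integrable_fisher
    (measurable_deriv p).aestronglyMeasurable hp.nonneg hp.fisher_nonneg
    fun x => (hp.sq_deriv_eq x).le).1

lemma abs_sub_le {a b : ℝ} (hab : a ≤ b) : |p b - p a| ≤ ∫ x in Set.Ioc a b, |deriv p x| := by
  rw [← (hp.absCont a b).integral_deriv_eq_sub, intervalIntegral.integral_of_le hab]
  exact abs_integral_le_integral_abs

/-- An integrable function cannot exceed 1 everywhere, and the variation `∫ |p'|` is finite by
Cauchy–Schwarz. -/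
lemma exists_bound : ∃ M, ∀ x, p x ≤ M := by
  obtain ⟨y, hy⟩ : ∃ y, p y ≤ 1 := by
    by_contra! h
    have : Integrable (fun _ : ℝ => (1 : ℝ)) := hp.integrable.mono' (by fun_prop)
      (ae_of_all _ fun x => by simpa using (h x).le)
    simp [integrable_const_iff, isFiniteMeasure_iff] at this
  have hD : ∀ a b, a ≤ b → |p b - p a| ≤ ∫ x, |deriv p x| := fun a b hab =>
    (hp.abs_sub_le hab).trans (setIntegral_le_integral hp.integrable_deriv.abs
      (ae_of_all _ fun x => abs_nonneg _))
  refine ⟨1 + ∫ x, |deriv p x|, fun x => ?_⟩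
  rcases le_total x y with h | h
  · have := abs_le.1 (hD x y h); linarith
  · have := abs_le.1 (hD y x h); linarith

/-- The squared density is controlled by its mass and Fisher information on a unit interval. -/
lemma sq_le_local (x : ℝ) : p x ^ 2 ≤ 2 * (∫ y in Set.Ioc x (x + 1), p y) *
    ((∫ y in Set.Ioc x (x + 1), p y) + ∫ y in Set.Ioc x (x + 1), deriv p y ^ 2 / p y) := by
  set I := Set.Ioc x (x + 1)
  set D := ∫ y in I, |deriv p y|
  have hvol : (volume.restrict I).real Set.univ = 1 := by simp [I, Measure.real]
  -- Average `p x ≤ p y + D` over `y` in the unit interval. The claim follows on bounding `D²` by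
  -- Cauchy–Schwarz and using `(m + D)² ≤ 2 (m² + D²)`, with `m` the mass of the interval.
  have hle : p x ≤ (∫ y in I, p y) + D := by
    have h1 : ∫ y in I, p x ≤ ∫ y in I, (p y + D) := by
      refine setIntegral_mono_on (by simp [I]) (hp.integrable.integrableOn.add (by simp [I]))
        measurableSet_Ioc fun y hy => ?_
      have h2 := abs_le.1 (hp.abs_sub_le hy.1.le)
      have h3 : ∫ z in Set.Ioc x y, |deriv p z| ≤ D :=
        setIntegral_mono_set hp.integrable_deriv.abs.integrableOn
          (ae_of_all _ fun z => abs_nonneg _) (Set.Ioc_subset_Ioc_right hy.2).eventuallyLE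
      linarith
    rw [integral_add hp.integrable.integrableOn (by simp [I]), integral_const, integral_const,
      hvol] at h1
    simpa using h1
  have hcs : D ^ 2 ≤ (∫ y in I, p y) * ∫ y in I, deriv p y ^ 2 / p y :=
    (sq_integral_le_of_sq_le_mul hp.integrable.integrableOn hp.integrable_fisher.integrableOn
      (measurable_deriv p).abs.aestronglyMeasurable hp.nonneg hp.fisher_nonneg
      fun x => by rw [sq_abs]; exact (hp.sq_deriv_eq x).le).2
  have hD0 : 0 ≤ D := integral_nonneg fun _ => abs_nonneg _
  have hm0 : 0 ≤ ∫ y in I, p y := integral_nonneg fun _ => hp.nonneg _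
  nlinarith [sq_nonneg ((∫ y in I, p y) - D), hp.nonneg x]

-- Trades the sharp window for the kernel `exp (-|x - y|)`, which is at least `exp (-1)` on it.
-- Averages of a density against this kernel have a Lipschitz logarithm.
omit hp in
lemma setIntegral_le_exp_mul {f : ℝ → ℝ} (hf : Integrable f) (hf0 : ∀ x, 0 ≤ f x) (x : ℝ) :
    ∫ y in Set.Ioc x (x + 1), f y ≤ Real.exp 1 * ∫ y, f y * Real.exp (-|x - y|) := by
  have hi : Integrable fun y => f y * Real.exp (-|x - y|) := by
    refine hf.mono' (hf.aestronglyMeasurable.mul (by fun_prop)) (ae_of_all _ fun y => ?_)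
    rw [Real.norm_eq_abs, abs_of_nonneg (mul_nonneg (hf0 y) (Real.exp_pos _).le)]
    exact mul_le_of_le_one_right (hf0 y) (Real.exp_le_one_iff.2 (by simp))
  rw [← integral_const_mul]
  refine (setIntegral_mono_on hf.integrableOn (hi.const_mul _).integrableOn measurableSet_Ioc
    fun y hy => ?_).trans (setIntegral_le_integral (hi.const_mul _)
      (ae_of_all _ fun y => by have := hf0 y; positivity))
  have : 1 ≤ Real.exp 1 * Real.exp (-|x - y|) := by
    rw [← Real.exp_add]
    refine Real.one_le_exp ?_
    have : |x - y| ≤ 1 := by rw [abs_le]; constructor <;> linarith [hy.1, hy.2]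
    linarith
  nlinarith [hf0 y]

/-- Finite entropy and Fisher information give finite cross entropy for some Lipschitz weight. -/
lemma exists_entropyWeight (hh : Integrable fun x => Real.negMulLog (p x)) :
    ∃ l, IsEntropyWeight l ∧ Integrable fun x => p x * l x := by
  set E : ℝ → ℝ := fun x => Real.exp (-|x|)
  have hE : Integrable E := integrable_exp_neg_abs
  -- The weight will be `-log q`: averaging at unit scale makes `log q` Lipschitz while `q = exp
  -- (-l)` stays integrable. The same average `k` of the Fisher integrand controls how far `p` can
  -- exceed `q`.
  set q : ℝ → ℝ := fun x => ∫ y, p y * E (x - y)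
  set k : ℝ → ℝ := fun x => ∫ y, deriv p y ^ 2 / p y * E (x - y)
  have hq : Integrable q := integrable_integral_mul_comp_sub hp.integrable hE
  have hk : Integrable k := integrable_integral_mul_comp_sub hp.integrable_fisher hE
  have hk0 : ∀ x, 0 ≤ k x := fun x => integral_nonneg fun y =>
    mul_nonneg (hp.fisher_nonneg y) (Real.exp_pos _).le
  have hi : ∀ x, Integrable fun y => p y * E (x - y) := fun x => by
    refine hp.integrable.mono' (hp.continuous.aestronglyMeasurable.mul (by fun_prop))
      (ae_of_all _ fun y => ?_)
    rw [Real.norm_eq_abs, abs_of_nonneg (mul_nonneg (hp.nonneg y) (Real.exp_pos _).le)]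
    exact mul_le_of_le_one_right (hp.nonneg y) (Real.exp_le_one_iff.2 (by simp))
  have hq0 : ∀ x, 0 < q x := fun x => by
    have h0 : 0 ≤ q x := integral_nonneg fun y => mul_nonneg (hp.nonneg y) (Real.exp_pos _).le
    refine lt_of_le_of_ne h0 fun h => ?_
    have h1 := (integral_eq_zero_iff_of_nonneg
      (fun y => mul_nonneg (hp.nonneg y) (Real.exp_pos _).le) (hi x)).1 h.symm
    have h2 : p =ᵐ[volume] 0 := by
      filter_upwards [h1] with y hy
      exact (mul_eq_zero.1 hy).resolve_right (Real.exp_pos _).ne'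
    have h3 := hp.integral_eq_one
    rw [integral_congr_ae h2] at h3
    simp at h3
  have hq1 : ∀ x, q x ≤ 1 := fun x => by
    rw [← hp.integral_eq_one]
    exact integral_mono (hi x) hp.integrable fun y =>
      mul_le_of_le_one_right (hp.nonneg y) (Real.exp_le_one_iff.2 (by simp))
  have hlip : ∀ x y, Real.log (q x) ≤ Real.log (q y) + |x - y| := fun x y => by
    rw [← Real.log_exp |x - y|, ← Real.log_mul (hq0 y).ne' (Real.exp_pos _).ne']
    refine Real.log_le_log (hq0 x) ?_
    rw [← integral_mul_const]
    refine integral_mono (hi x) ((hi y).mul_const _) fun z => ?_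
    dsimp only [E]
    rw [mul_assoc, ← Real.exp_add]
    refine mul_le_mul_of_nonneg_left (Real.exp_le_exp.2 ?_) (hp.nonneg z)
    have := abs_sub_abs_le_abs_sub (y - z) (x - z)
    rw [show y - z - (x - z) = -(x - y) by ring, abs_neg] at this
    linarith
  have hqc : Continuous fun x => -Real.log (q x) := by
    have : LipschitzWith 1 fun x => -Real.log (q x) := LipschitzWith.of_dist_le_mul fun x y => by
      rw [Real.dist_eq, Real.dist_eq, NNReal.coe_one, one_mul, abs_le]
      have h1 := hlip x y
      have h2 := hlip y x
      rw [abs_sub_comm] at h2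
      constructor <;> linarith
    exact this.continuous
  refine ⟨fun x => -Real.log (q x), ⟨⟨1, LipschitzWith.of_dist_le_mul fun x y => ?_⟩, ?_⟩, ?_⟩
  · rw [Real.dist_eq, Real.dist_eq, NNReal.coe_one, one_mul, abs_le]
    have h1 := hlip x y
    have h2 := hlip y x
    rw [abs_sub_comm] at h2
    constructor <;> linarith
  · refine hq.congr (ae_of_all _ fun x => ?_)
    dsimp only
    rw [neg_neg, Real.exp_log (hq0 x)]
  · refine (hh.abs.add ((hq.add hk).const_mul (2 * Real.exp 1 ^ 2))).mono'
      (hp.continuous.mul hqc).aestronglyMeasurable (ae_of_all _ fun x => ?_)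
    have hlq : 0 ≤ -Real.log (q x) := neg_nonneg.2 (Real.log_nonpos (hq0 x).le (hq1 x))
    rw [Real.norm_eq_abs, abs_of_nonneg (mul_nonneg (hp.nonneg x) hlq)]
    simp only [Pi.add_apply]
    have h1 := le_abs_self (Real.negMulLog (p x))
    have h2 : p x ^ 2 ≤ 2 * Real.exp 1 ^ 2 * (q x + k x) * q x := by
      have hm := setIntegral_le_exp_mul hp.integrable hp.nonneg x
      have hkk := setIntegral_le_exp_mul hp.integrable_fisher hp.fisher_nonneg x
      have hm0 : 0 ≤ ∫ y in Set.Ioc x (x + 1), p y := integral_nonneg fun _ => hp.nonneg _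
      have hkk0 : 0 ≤ ∫ y in Set.Ioc x (x + 1), deriv p y ^ 2 / p y :=
        integral_nonneg fun _ => hp.fisher_nonneg _
      calc p x ^ 2 ≤ _ := hp.sq_le_local x
        _ ≤ 2 * (Real.exp 1 * q x) * (Real.exp 1 * q x + Real.exp 1 * k x) := by
          have := (hq0 x).le
          gcongr
        _ = _ := by ring
    rcases (hp.nonneg x).eq_or_lt with h0 | h0
    · rw [← h0]
      have := hk0 x
      have := hq0 x
      simp only [zero_mul]; positivity
    -- Here `-p log q = -p log p + p log (p / q)`, and the last term is at most `p² / q`, hence at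
    -- most `2 e² (q + k)` by the local bound on `p²`.
    · have h3 := Real.log_le_sub_one_of_pos (div_pos h0 (hq0 x))
      rw [Real.log_div h0.ne' (hq0 x).ne'] at h3
      have h4 := mul_le_mul_of_nonneg_left h3 h0.le
      have h5 : p x * (p x / q x - 1) ≤ 2 * Real.exp 1 ^ 2 * (q x + k x) := by
        have : p x * (p x / q x - 1) ≤ p x ^ 2 / q x := by
          rw [mul_sub, mul_one, sq, mul_div_assoc]; linarith
        exact this.trans ((div_le_iff₀ (hq0 x)).2 h2)
      unfold Real.negMulLog at h1 ⊢
      linarith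

end IsFisherDensity

/-! ### Integrals against a density, and Gaussian moments. -/

section WithDensity

variable {p : ℝ → ℝ}

lemma integral_withDensity_ofReal (hp : Measurable p) (hp0 : ∀ x, 0 ≤ p x) (f : ℝ → ℝ) :
    ∫ x, f x ∂(volume.withDensity fun x => ENNReal.ofReal (p x)) = ∫ x, p x * f x := by
  rw [integral_withDensity_eq_integral_toReal_smul hp.ennreal_ofReal
    (ae_of_all _ fun x => ENNReal.ofReal_lt_top)]
  simp only [ENNReal.toReal_ofReal (hp0 _), smul_eq_mul]

lemma integrable_withDensity_ofReal_iff (hp : Measurable p) (hp0 : ∀ x, 0 ≤ p x) {f : ℝ → ℝ} :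
    Integrable f (volume.withDensity fun x => ENNReal.ofReal (p x)) ↔
      Integrable fun x => p x * f x := by
  rw [integrable_withDensity_iff_integrable_smul' hp.ennreal_ofReal
    (ae_of_all _ fun x => ENNReal.ofReal_lt_top)]
  simp only [ENNReal.toReal_ofReal (hp0 _), smul_eq_mul]

lemma isProbabilityMeasure_withDensity_ofReal (hp0 : ∀ x, 0 ≤ p x) (hp : Integrable p)
    (hp1 : ∫ x, p x = 1) :
    IsProbabilityMeasure (volume.withDensity fun x => ENNReal.ofReal (p x)) := by
  refine ⟨?_⟩
  rw [withDensity_apply _ MeasurableSet.univ, Measure.restrict_univ,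
    ← ofReal_integral_eq_lintegral_ofReal hp (ae_of_all _ hp0), hp1, ENNReal.ofReal_one]

end WithDensity

section Scaling

/-- Moves the variance from the kernel into the argument of `f`, so that limits as `s → 0` become
dominated convergence against one fixed Gaussian. -/
lemma integral_mul_heatKernel_eq_scale {s : ℝ} (hs : 0 < s) (f : ℝ → ℝ) :
    ∫ u, f u * heatKernel s u = ∫ u, f (√s * u) * heatKernel 1 u := by
  have hpi := Real.pi_pos
  have hsq : 0 < √s := Real.sqrt_pos.2 hs
  have h := Measure.integral_comp_mul_left (fun u => f u * heatKernel s u) (√s)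
  have e : ∀ u, heatKernel s (√s * u) = (√s)⁻¹ * heatKernel 1 u := by
    intro u
    unfold heatKernel
    rw [mul_pow, Real.sq_sqrt hs.le, mul_one, mul_one, Real.sqrt_mul (by positivity)]
    have : -(s * u ^ 2) / (2 * s) = -u ^ 2 / 2 := by field_simp
    rw [this, mul_inv]
    ring
  simp only [e] at h
  rw [abs_of_pos (inv_pos.2 hsq), smul_eq_mul] at h
  have h2 : ∫ u, f (√s * u) * ((√s)⁻¹ * heatKernel 1 u) =
      (√s)⁻¹ * ∫ u, f (√s * u) * heatKernel 1 u := by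
    rw [← integral_const_mul]; congr 1; ext u; ring
  rw [h2] at h
  exact (mul_left_cancel₀ (inv_pos.2 hsq).ne' h).symm

lemma integrable_one_add_sq_mul_heatKernel {s : ℝ} (hs : 0 < s) :
    Integrable fun u => (1 + u ^ 2) * heatKernel s u := by
  obtain ⟨C, hC, h⟩ := heatKernel_moment_bound hs le_rfl (lt_add_one s)
  have := continuous_heatKernel s
  refine ((integrable_heatKernel (by linarith : 0 < s + 1)).const_mul C).mono'
    (by fun_prop : Continuous fun u => (1 + u ^ 2) * heatKernel s u).aestronglyMeasurable
    (ae_of_all _ fun u => ?_)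
  rw [Real.norm_eq_abs, abs_of_nonneg (mul_nonneg (by positivity) (heatKernel_nonneg s u))]
  exact h s (by simp) u

lemma integrable_mul_heatKernel_of_le {s C : ℝ} (hs : 0 < s) {f : ℝ → ℝ}
    (hf : Measurable f) (hfC : ∀ u, |f u| ≤ C * (1 + u ^ 2)) :
    Integrable fun u => f u * heatKernel s u := by
  refine ((integrable_one_add_sq_mul_heatKernel hs).const_mul C).mono'
    (hf.mul (continuous_heatKernel s).measurable).aestronglyMeasurable (ae_of_all _ fun u => ?_)
  rw [Real.norm_eq_abs, abs_mul, abs_of_nonneg (heatKernel_nonneg s u), ← mul_assoc]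
  exact mul_le_mul_of_nonneg_right (hfC u) (heatKernel_nonneg s u)

lemma integrable_abs_mul_heatKernel {s : ℝ} (hs : 0 < s) :
    Integrable fun u => |u| * heatKernel s u :=
  integrable_mul_heatKernel_of_le (C := 1) hs (by fun_prop) fun u => by
    rw [abs_abs, abs_le]
    constructor <;> nlinarith [sq_nonneg (u - 1), sq_nonneg (u + 1)]

lemma integrable_id_mul_heatKernel {s : ℝ} (hs : 0 < s) :
    Integrable fun u => u * heatKernel s u :=
  integrable_mul_heatKernel_of_le (C := 1) hs (by fun_prop) fun u => by
    rw [abs_le]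
    constructor <;> nlinarith [sq_nonneg (u - 1), sq_nonneg (u + 1)]

lemma integrable_sq_mul_heatKernel {s : ℝ} (hs : 0 < s) :
    Integrable fun u => u ^ 2 * heatKernel s u :=
  integrable_mul_heatKernel_of_le (C := 1) hs (by fun_prop) fun u => by
    rw [abs_le]
    constructor <;> nlinarith [sq_nonneg u]

lemma integrable_heatKernelDeriv {s : ℝ} (hs : 0 < s) : Integrable (heatKernelDeriv s) := by
  refine ((integrable_id_mul_heatKernel hs).const_mul (-(1 / s))).congr (ae_of_all _ fun u => ?_)
  unfold heatKernelDeriv; dsimp only; ring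

/-- Since `u k = -s k'`, the moment is the integral of a derivative. The second moment is found from
`k''` in the same way. -/
lemma integral_id_mul_heatKernel {s : ℝ} (hs : 0 < s) : ∫ u, u * heatKernel s u = 0 := by
  have h := integral_eq_zero_of_hasDerivAt_of_integrable (fun u => hasDerivAt_heatKernel hs u)
    (integrable_heatKernelDeriv hs) (integrable_heatKernel hs)
  have e : ∀ u, u * heatKernel s u = -s * heatKernelDeriv s u := fun u => by
    unfold heatKernelDeriv; field_simp
  simp only [e, integral_const_mul, h, mul_zero]

lemma integral_sq_mul_heatKernel {s : ℝ} (hs : 0 < s) : ∫ u, u ^ 2 * heatKernel s u = s := by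
  have i2 : Integrable (heatKernelDeriv2 s) := by
    refine (((integrable_sq_mul_heatKernel hs).const_mul (1 / s ^ 2)).sub
      ((integrable_heatKernel hs).const_mul (1 / s))).congr (ae_of_all _ fun u => ?_)
    simp only [Pi.sub_apply, heatKernelDeriv2]; ring
  have h := integral_eq_zero_of_hasDerivAt_of_integrable
    (fun u => hasDerivAt_heatKernelDeriv hs u) i2 (integrable_heatKernelDeriv hs)
  have e : ∀ u, u ^ 2 * heatKernel s u = s ^ 2 * heatKernelDeriv2 s u + s * heatKernel s u :=
    fun u => by unfold heatKernelDeriv2; field_simp; ring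
  simp only [e]
  rw [integral_add (i2.const_mul _) ((integrable_heatKernel hs).const_mul _), integral_const_mul,
    integral_const_mul, h, integral_heatKernel hs]
  ring

lemma tendsto_integral_abs_mul_heatKernel :
    Tendsto (fun s => ∫ u, |u| * heatKernel s u) (𝓝[>] 0) (𝓝 0) := by
  have h : Tendsto (fun s => √s * ∫ u, |u| * heatKernel 1 u) (𝓝[>] 0) (𝓝 0) := by
    have : Tendsto (fun s => √s) (𝓝[>] (0 : ℝ)) (𝓝 0) := by
      have := (Real.continuous_sqrt.tendsto 0).mono_left (nhdsWithin_le_nhds (s := Set.Ioi 0))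
      simpa using this
    simpa using this.mul_const (∫ u, |u| * heatKernel 1 u)
  refine h.congr' ?_
  filter_upwards [self_mem_nhdsWithin] with s hs
  rw [integral_mul_heatKernel_eq_scale hs, ← integral_const_mul]
  congr 1; ext u
  rw [abs_mul, abs_of_nonneg (Real.sqrt_nonneg s)]; ring

end Scaling

/-! ### Cross entropy of a smoothed law with a Lipschitz weight. -/

section CrossEntropy

variable {μ : Measure ℝ} [IsProbabilityMeasure μ] {l g : ℝ → ℝ} {K : ℝ≥0}

/-- The splitting `l y = l x + (l y - l x)`: the first term separates after a shift, and the second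
is at most `K |y - x|`, so a first absolute moment of the noise is enough. -/
lemma integrable_cross_aux (hl : LipschitzWith K l) (hlμ : Integrable l μ)
    (hg0 : ∀ x, 0 ≤ g x) (hgm : Measurable g) (hg : Integrable g)
    (hg1 : Integrable fun u => |u| * g u) :
    Integrable (fun z : ℝ × ℝ => l z.1 * g (z.2 - z.1)) (μ.prod volume) ∧
    Integrable (fun z : ℝ × ℝ => g (z.2 - z.1) * (l z.2 - l z.1)) (μ.prod volume) ∧
    ∀ z : ℝ × ℝ, |g (z.2 - z.1) * (l z.2 - l z.1)| ≤ K * (|z.2 - z.1| * g (z.2 - z.1)) := by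
  have hb : ∀ z : ℝ × ℝ, |g (z.2 - z.1) * (l z.2 - l z.1)| ≤
      K * (|z.2 - z.1| * g (z.2 - z.1)) := fun z => by
    rw [abs_mul, abs_of_nonneg (hg0 _)]
    have := hl.dist_le_mul z.2 z.1
    rw [Real.dist_eq, Real.dist_eq] at this
    calc _ ≤ g (z.2 - z.1) * (K * |z.2 - z.1|) := mul_le_mul_of_nonneg_left this (hg0 _)
      _ = _ := by ring
  refine ⟨integrable_mul_comp_sub hlμ hg, ?_, hb⟩
  have hlc := hl.continuous.measurable
  refine ((integrable_mul_comp_sub (integrable_const (1 : ℝ)) hg1 (κ := μ)).const_mul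
    (K : ℝ)).mono' (by fun_prop) (ae_of_all _ fun z => ?_)
  simpa using hb z

lemma integrable_conv_mul_lipschitz (hl : LipschitzWith K l) (hlμ : Integrable l μ)
    (hg0 : ∀ x, 0 ≤ g x) (hgm : Measurable g) (hg : Integrable g)
    (hg1 : Integrable fun u => |u| * g u) :
    Integrable fun y => (∫ x, g (y - x) ∂μ) * l y := by
  obtain ⟨h1, h2, -⟩ := integrable_cross_aux hl hlμ hg0 hgm hg hg1
  refine (h1.add h2).integral_prod_right.congr (ae_of_all _ fun y => ?_)
  dsimp only
  rw [← integral_mul_const]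
  congr 1; ext x
  simp only [Pi.add_apply]; ring

lemma abs_integral_conv_mul_lipschitz_sub_le (hl : LipschitzWith K l) (hlμ : Integrable l μ)
    (hg0 : ∀ x, 0 ≤ g x) (hgm : Measurable g) (hg : Integrable g)
    (hg1 : Integrable fun u => |u| * g u) (hg2 : ∫ x, g x = 1) :
    |(∫ y, (∫ x, g (y - x) ∂μ) * l y) - ∫ x, l x ∂μ| ≤ K * ∫ u, |u| * g u := by
  obtain ⟨h1, h2, hb⟩ := integrable_cross_aux hl hlμ hg0 hgm hg hg1
  have e1 : ∫ y, (∫ x, g (y - x) ∂μ) * l y =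
      ∫ y, ((∫ x, l x * g (y - x) ∂μ) + ∫ x, g (y - x) * (l y - l x) ∂μ) := by
    refine integral_congr_ae ?_
    filter_upwards [h1.prod_left_ae, h2.prod_left_ae] with y hy1 hy2
    rw [← integral_mul_const, ← integral_add hy1 hy2]
    congr 1; ext x
    ring
  rw [integral_add h1.integral_prod_right h2.integral_prod_right,
    integral_integral_mul_comp_sub hlμ hg, hg2, mul_one] at e1
  rw [e1, add_sub_cancel_left]
  have h3 := integrable_mul_comp_sub (integrable_const (1 : ℝ)) hg1 (κ := μ)
  have e2 := integral_integral_mul_comp_sub (integrable_const (1 : ℝ)) hg1 (κ := μ)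
  simp only [one_mul, integral_const, probReal_univ, smul_eq_mul] at e2 h3
  rw [← e2, ← integral_const_mul]
  refine abs_integral_le_integral_abs.trans
    (integral_mono_ae h2.integral_prod_right.abs (h3.integral_prod_right.const_mul _) ?_)
  filter_upwards [h2.prod_left_ae, h3.prod_left_ae] with y hy2 hy3
  rw [← integral_const_mul]
  exact abs_integral_le_integral_abs.trans
    (integral_mono hy2.abs (hy3.const_mul _) fun x => hb (x, y))

end CrossEntropy

lemma integrable_heatSmooth_mul_weight {μ : Measure ℝ} [IsProbabilityMeasure μ] {l : ℝ → ℝ}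
    (hl : IsEntropyWeight l) (hlμ : Integrable l μ) {s : ℝ} (hs : 0 < s) :
    Integrable fun y => heatSmooth μ s y * l y := by
  obtain ⟨K, hK⟩ := hl.lipschitz
  exact integrable_conv_mul_lipschitz hK hlμ (heatKernel_nonneg s)
    (continuous_heatKernel s).measurable (integrable_heatKernel hs)
    (integrable_abs_mul_heatKernel hs)

lemma integrable_negMulLog_heatSmooth {μ : Measure ℝ} [IsProbabilityMeasure μ] {l : ℝ → ℝ}
    (hl : IsEntropyWeight l) (hlμ : Integrable l μ) {s : ℝ} (hs : 0 < s) :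
    Integrable fun y => Real.negMulLog (heatSmooth μ s y) :=
  integrable_negMulLog_of_cross (heatSmooth_nonneg μ s) (heatSmooth_le μ hs)
    (integrable_heatSmooth μ hs) hl.integrable_exp (integrable_heatSmooth_mul_weight hl hlμ hs)

/-! ### Small-time limits of density, Fisher information and entropy. -/

namespace IsFisherDensity

variable {p : ℝ → ℝ} (hp : IsFisherDensity p)
include hp

lemma isProbabilityMeasure :
    IsProbabilityMeasure (volume.withDensity fun x => ENNReal.ofReal (p x)) :=
  isProbabilityMeasure_withDensity_ofReal hp.nonneg hp.integrable hp.integral_eq_one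

lemma heatSmooth_eq (s y : ℝ) :
    heatSmooth (volume.withDensity fun x => ENNReal.ofReal (p x)) s y =
      ∫ x, p x * heatKernel s (y - x) :=
  integral_withDensity_ofReal hp.continuous.measurable hp.nonneg _

lemma heatSmooth_eq' (s y : ℝ) :
    heatSmooth (volume.withDensity fun x => ENNReal.ofReal (p x)) s y =
      ∫ u, p (y - u) * heatKernel s u := by
  rw [hp.heatSmooth_eq, ← integral_sub_left_eq_self _ volume y]
  simp

lemma heatSmoothDeriv_eq (s y : ℝ) :
    heatSmoothDeriv (volume.withDensity fun x => ENNReal.ofReal (p x)) s y =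
      ∫ x, p x * heatKernelDeriv s (y - x) :=
  integral_withDensity_ofReal hp.continuous.measurable hp.nonneg _

lemma heatSmoothDeriv_eq' (s y : ℝ) :
    heatSmoothDeriv (volume.withDensity fun x => ENNReal.ofReal (p x)) s y =
      ∫ u, (p (y - u) * (-(u / s))) * heatKernel s u := by
  rw [hp.heatSmoothDeriv_eq, ← integral_sub_left_eq_self _ volume y]
  congr 1; ext u
  simp only [heatKernelDeriv, sub_sub_cancel]; ring

lemma tendsto_heatSmooth (y : ℝ) :
    Tendsto (fun s => heatSmooth (volume.withDensity fun x => ENNReal.ofReal (p x)) s y) (𝓝[>] 0)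
      (𝓝 (p y)) := by
  obtain ⟨M, hM⟩ := hp.exists_bound
  have hpc := hp.continuous
  have hk := continuous_heatKernel 1
  have h : Tendsto (fun s => ∫ u, p (y - √s * u) * heatKernel 1 u) (𝓝[>] 0)
      (𝓝 (∫ u, p y * heatKernel 1 u)) := by
    refine tendsto_integral_filter_of_dominated_convergence (fun u => M * heatKernel 1 u)
      (.of_forall fun s => (by fun_prop : Continuous fun u =>
        p (y - √s * u) * heatKernel 1 u).aestronglyMeasurable)
      (.of_forall fun s => ae_of_all _ fun u => ?_)
      ((integrable_heatKernel one_pos).const_mul M) (ae_of_all _ fun u => ?_)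
    · rw [Real.norm_eq_abs, abs_of_nonneg (mul_nonneg (hp.nonneg _) (heatKernel_nonneg _ _))]
      exact mul_le_mul_of_nonneg_right (hM _) (heatKernel_nonneg _ _)
    · have hc : Continuous fun s => p (y - √s * u) * heatKernel 1 u := by fun_prop
      have := (hc.tendsto 0).mono_left (nhdsWithin_le_nhds (s := Set.Ioi 0))
      simpa using this
  rw [integral_const_mul, integral_heatKernel one_pos, mul_one] at h
  refine h.congr' ?_
  filter_upwards [self_mem_nhdsWithin] with s hs
  rw [hp.heatSmooth_eq', integral_mul_heatKernel_eq_scale hs fun u => p (y - u)]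

/-- Close to `y` this is differentiability; beyond distance `ε` the bound `M` on `p` is at most `(M
/ ε) |h|`. It serves as majorant for the difference quotients in `tendsto_heatSmoothDeriv`. -/
lemma exists_abs_sub_le {y : ℝ} (hy : DifferentiableAt ℝ p y) :
    ∃ C, ∀ h, |p y - p (y - h)| ≤ C * |h| := by
  obtain ⟨M, hM⟩ := hp.exists_bound
  obtain ⟨c, hc⟩ := hy.hasDerivAt.isBigO_sub.bound
  rw [Metric.eventually_nhds_iff] at hc
  obtain ⟨ε, hε, hc⟩ := hc
  have hM0 : 0 ≤ M := (hp.nonneg 0).trans (hM 0)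
  refine ⟨|c| + M / ε, fun h => ?_⟩
  rcases lt_or_ge |h| ε with hh | hh
  · have h1 := hc (y := y - h) (by simpa [Real.dist_eq] using hh)
    rw [Real.norm_eq_abs, Real.norm_eq_abs, abs_sub_comm, sub_sub_cancel_left, abs_neg] at h1
    refine h1.trans (mul_le_mul_of_nonneg_right ?_ (abs_nonneg h))
    have : 0 ≤ M / ε := by positivity
    linarith [le_abs_self c]
  · have h1 : |p y - p (y - h)| ≤ M := by
      rw [abs_le]; constructor <;> linarith [hp.nonneg y, hp.nonneg (y - h), hM y, hM (y - h)]
    have h2 : M ≤ M / ε * |h| := by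
      rw [div_mul_eq_mul_div, le_div_iff₀ hε]; gcongr
    nlinarith [mul_nonneg (abs_nonneg c) (abs_nonneg h)]

/-- After scaling, the smoothed derivative is the standard Gaussian average of `-p (y - √s u) u /
√s`. As `u` has mean zero, `p y` may be inserted; the resulting difference quotient times `u` tends
to `p' y · u²`, and `u²` has mean one. -/
lemma tendsto_heatSmoothDeriv {y : ℝ} (hy : DifferentiableAt ℝ p y) :
    Tendsto (fun s => heatSmoothDeriv (volume.withDensity fun x => ENNReal.ofReal (p x)) s y)
      (𝓝[>] 0) (𝓝 (deriv p y)) := by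
  obtain ⟨M, hM⟩ := hp.exists_bound
  obtain ⟨C, hC⟩ := hp.exists_abs_sub_le hy
  have hpc := hp.continuous
  have hk := continuous_heatKernel 1
  have hs0 : Tendsto (fun s => √s) (𝓝[>] (0 : ℝ)) (𝓝[>] 0) := by
    refine tendsto_nhdsWithin_iff.2 ⟨?_, ?_⟩
    · have := (Real.continuous_sqrt.tendsto 0).mono_left (nhdsWithin_le_nhds (s := Set.Ioi 0))
      simpa using this
    · filter_upwards [self_mem_nhdsWithin] with s hs
      exact Real.sqrt_pos.2 hs
  have h : Tendsto (fun s => ∫ u, ((p y - p (y - √s * u)) / √s * u) * heatKernel 1 u) (𝓝[>] 0)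
      (𝓝 (∫ u, (deriv p y * u ^ 2) * heatKernel 1 u)) := by
    refine tendsto_integral_filter_of_dominated_convergence
      (fun u => C * (u ^ 2 * heatKernel 1 u))
      (.of_forall fun s => (by fun_prop : Continuous fun u =>
        ((p y - p (y - √s * u)) / √s * u) * heatKernel 1 u).aestronglyMeasurable)
      ?_ ((integrable_sq_mul_heatKernel one_pos).const_mul C) (ae_of_all _ fun u => ?_)
    · filter_upwards [self_mem_nhdsWithin] with s hs
      have hsq : 0 < √s := Real.sqrt_pos.2 hs
      refine ae_of_all _ fun u => ?_
      rw [Real.norm_eq_abs, abs_mul, abs_of_nonneg (heatKernel_nonneg 1 u), ← mul_assoc]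
      refine mul_le_mul_of_nonneg_right ?_ (heatKernel_nonneg 1 u)
      rw [abs_mul, abs_div, abs_of_pos hsq]
      have h1 := hC (√s * u)
      rw [abs_mul, abs_of_pos hsq] at h1
      calc |p y - p (y - √s * u)| / √s * |u| ≤ (C * (√s * |u|)) / √s * |u| := by gcongr
        _ = C * (|u| * |u|) := by field_simp
        _ = C * u ^ 2 := by rw [abs_mul_abs_self, sq]
    · refine Tendsto.mul_const _ ?_
      rcases eq_or_ne u 0 with rfl | hu
      · simp
      have hd := hy.hasDerivAt
      rw [hasDerivAt_iff_tendsto_slope] at hd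
      have hin : Tendsto (fun s => y - √s * u) (𝓝[>] 0) (𝓝[≠] y) := by
        refine tendsto_nhdsWithin_iff.2 ⟨?_, ?_⟩
        · have := (hs0.mono_right nhdsWithin_le_nhds).mul_const u
          simpa using this.const_sub y
        · filter_upwards [self_mem_nhdsWithin] with s hs
          have hsq : 0 < √s := Real.sqrt_pos.2 hs
          simp [hsq.ne', hu]
      refine ((hd.comp hin).mul_const (u ^ 2)).congr' ?_
      filter_upwards [self_mem_nhdsWithin] with s hs
      have hsq : 0 < √s := Real.sqrt_pos.2 hs
      simp only [Function.comp_apply, slope_def_field, sub_sub_cancel_left]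
      field_simp
      ring
  have e0 : ∫ u, (deriv p y * u ^ 2) * heatKernel 1 u = deriv p y := by
    simp_rw [mul_assoc]
    rw [integral_const_mul, integral_sq_mul_heatKernel one_pos, mul_one]
  rw [e0] at h
  refine h.congr' ?_
  filter_upwards [self_mem_nhdsWithin] with s hs
  have hsq : 0 < √s := Real.sqrt_pos.2 hs
  rw [hp.heatSmoothDeriv_eq', integral_mul_heatKernel_eq_scale hs fun u => p (y - u) * (-(u / s))]
  have i1 : Integrable fun u => (-(p (y - √s * u)) * (1 / √s) * u) * heatKernel 1 u := by
    refine integrable_mul_heatKernel_of_le (C := M * (1 / √s)) one_pos (by fun_prop) fun u => ?_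
    rw [abs_mul, abs_mul, abs_neg, abs_of_nonneg (hp.nonneg _), abs_of_pos
      (by positivity : 0 < 1 / √s)]
    have hM0 : 0 ≤ M := (hp.nonneg 0).trans (hM 0)
    have : |u| ≤ 1 + u ^ 2 := by
      rw [abs_le]; constructor <;> nlinarith [sq_nonneg (u - 1), sq_nonneg (u + 1)]
    gcongr
    exact hM _
  have i2 : Integrable fun u => p y / √s * (u * heatKernel 1 u) :=
    (integrable_id_mul_heatKernel one_pos).const_mul _
  have e1 : ∫ u, p y / √s * (u * heatKernel 1 u) = 0 := by
    rw [integral_const_mul, integral_id_mul_heatKernel one_pos, mul_zero]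
  calc ∫ u, ((p y - p (y - √s * u)) / √s * u) * heatKernel 1 u
      = ∫ u, (p y / √s * (u * heatKernel 1 u) +
          (-(p (y - √s * u)) * (1 / √s) * u) * heatKernel 1 u) := by
        congr 1; ext u; ring
    _ = ∫ u, (-(p (y - √s * u)) * (1 / √s) * u) * heatKernel 1 u := by
        rw [integral_add i2 i1, e1, zero_add]
    _ = _ := by
        congr 1; ext u
        have hss : √s * u / s = 1 / √s * u := by
          field_simp; rw [Real.sq_sqrt (le_of_lt hs), mul_div_cancel_left₀ _ (ne_of_gt hs)]
        rw [hss]; ring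

end IsFisherDensity

lemma tendsto_heatKernel_atTop {s : ℝ} (hs : 0 < s) : Tendsto (heatKernel s) atTop (𝓝 0) :=
  tendsto_zero_of_hasDerivAt_of_integrableOn_Ioi (a := 0)
    (fun u _ => hasDerivAt_heatKernel hs u) (integrable_heatKernelDeriv hs).integrableOn
    (integrable_heatKernel hs).integrableOn

lemma tendsto_heatKernel_atBot {s : ℝ} (hs : 0 < s) : Tendsto (heatKernel s) atBot (𝓝 0) :=
  tendsto_zero_of_hasDerivAt_of_integrableOn_Iic (a := 0)
    (fun u _ => hasDerivAt_heatKernel hs u) (integrable_heatKernelDeriv hs).integrableOn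
    (integrable_heatKernel hs).integrableOn

namespace IsFisherDensity

variable {p : ℝ → ℝ} (hp : IsFisherDensity p)
include hp

/-- Integration by parts: the derivative of the smoothed density is the smoothed derivative. -/
lemma heatSmoothDeriv_eq_integral_deriv {s : ℝ} (hs : 0 < s) (y : ℝ) :
    heatSmoothDeriv (volume.withDensity fun x => ENNReal.ofReal (p x)) s y =
      ∫ x, deriv p x * heatKernel s (y - x) := by
  obtain ⟨M, hM⟩ := hp.exists_bound
  have hM0 : 0 ≤ M := (hp.nonneg 0).trans (hM 0)
  obtain ⟨C, hC, hb⟩ := heatKernel_bounds hs le_rfl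
  have hk := continuous_heatKernel s
  have hk1 := continuous_heatKernelDeriv s
  have hpc := hp.continuous
  have hd : ∀ x, HasDerivAt (fun x => heatKernel s (y - x)) (-heatKernelDeriv s (y - x)) x :=
    fun x => by
      have := (hasDerivAt_heatKernel hs (y - x)).comp x ((hasDerivAt_id x).const_sub y)
      simpa using! this
  have hac : ∀ a b, AbsolutelyContinuousOnInterval (fun x => heatKernel s (y - x)) a b :=
    fun a b => by
      refine (ContDiff.contDiffOn ?_).absolutelyContinuousOnInterval
      unfold heatKernel
      fun_prop
  have i1 : Integrable fun x => p x * heatKernelDeriv s (y - x) := by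
    refine (hp.integrable.mul_const C).mono' (by fun_prop) (ae_of_all _ fun x => ?_)
    rw [Real.norm_eq_abs, abs_mul, abs_of_nonneg (hp.nonneg x)]
    exact mul_le_mul_of_nonneg_left (hb s (by simp) _).2.1 (hp.nonneg x)
  have i2 : Integrable fun x => deriv p x * heatKernel s (y - x) := by
    refine (hp.integrable_deriv.abs.mul_const C).mono'
      ((measurable_deriv p).mul (by fun_prop)).aestronglyMeasurable (ae_of_all _ fun x => ?_)
    rw [Real.norm_eq_abs, abs_mul, abs_of_nonneg (heatKernel_nonneg _ _)]
    exact mul_le_mul_of_nonneg_left (hb s (by simp) _).1 (abs_nonneg _)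
  have hparts : ∀ R : ℝ, ∫ x in (-R)..R, p x * heatKernelDeriv s (y - x) =
      (∫ x in (-R)..R, deriv p x * heatKernel s (y - x)) -
        (p R * heatKernel s (y - R) - p (-R) * heatKernel s (y - -R)) := fun R => by
    have h := (hp.absCont (-R) R).integral_mul_deriv_eq_deriv_mul (hac (-R) R)
    simp only [(hd _).deriv, mul_neg, intervalIntegral.integral_neg] at h
    linarith
  have l1 := intervalIntegral_tendsto_integral i1 tendsto_neg_atTop_atBot tendsto_id
  have l2 := intervalIntegral_tendsto_integral i2 tendsto_neg_atTop_atBot tendsto_id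
  have hz : ∀ g r : ℝ → ℝ, Tendsto (fun R => heatKernel s (r R)) atTop (𝓝 0) →
      Tendsto (fun R => p (g R) * heatKernel s (r R)) atTop (𝓝 0) := fun g r h => by
    refine squeeze_zero (fun R => mul_nonneg (hp.nonneg _) (heatKernel_nonneg _ _))
      (fun R => mul_le_mul_of_nonneg_right (hM (g R)) (heatKernel_nonneg _ _)) ?_
    simpa using h.const_mul M
  have hR : Tendsto (fun R => y - R) atTop atBot := by
    simp only [sub_eq_add_neg]
    exact tendsto_atBot_add_const_left atTop y tendsto_neg_atTop_atBot
  have hR' : Tendsto (fun R => y - -R) atTop atTop := by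
    simp only [sub_neg_eq_add]
    exact tendsto_atTop_add_const_left atTop y tendsto_id
  have z1 := hz id (fun R => y - R) ((tendsto_heatKernel_atBot hs).comp hR)
  have z2 := hz (fun R => -R) (fun R => y - -R) ((tendsto_heatKernel_atTop hs).comp hR')
  have l3 := l2.sub (z1.sub z2)
  simp only [id, sub_zero] at l1 l3
  rw [hp.heatSmoothDeriv_eq]
  refine tendsto_nhds_unique l1 (l3.congr fun R => ?_)
  exact (hparts R).symm

/-- Cauchy–Schwarz in the form `(∫ p' k)² ≤ ∫ p k · ∫ (p'² / p) k`, followed by Fubini, the kernel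
having mass one. -/
lemma integral_fisher_heatSmooth_le {s : ℝ} (hs : 0 < s) :
    ∫ y, heatSmoothDeriv (volume.withDensity fun x => ENNReal.ofReal (p x)) s y ^ 2 /
        heatSmooth (volume.withDensity fun x => ENNReal.ofReal (p x)) s y ≤
      ∫ x, deriv p x ^ 2 / p x := by
  have := hp.isProbabilityMeasure
  obtain ⟨C, hC, hb⟩ := heatKernel_bounds hs le_rfl
  have hk := continuous_heatKernel s
  have hpc := hp.continuous
  have e := integral_integral_mul_comp_sub hp.integrable_fisher (integrable_heatKernel hs)
  rw [integral_heatKernel hs, mul_one] at e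
  rw [← e]
  refine integral_mono (integrable_sq_heatSmoothDeriv_div _ hs)
    (integrable_integral_mul_comp_sub hp.integrable_fisher (integrable_heatKernel hs)) fun y => ?_
  have hbdd : ∀ f : ℝ → ℝ, Integrable f → Integrable fun x => f x * heatKernel s (y - x) :=
    fun f hf => by
      refine (hf.abs.mul_const C).mono' (hf.aestronglyMeasurable.mul (by fun_prop))
        (ae_of_all _ fun x => ?_)
      rw [Real.norm_eq_abs, abs_mul, abs_of_nonneg (heatKernel_nonneg _ _)]
      exact mul_le_mul_of_nonneg_left (hb s (by simp) _).1 (abs_nonneg _)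
  have hcs := (sq_integral_le_of_sq_le_mul (hbdd _ hp.integrable) (hbdd _ hp.integrable_fisher)
    (hbdd _ hp.integrable_deriv).aestronglyMeasurable
    (fun x => mul_nonneg (hp.nonneg x) (heatKernel_nonneg _ _))
    (fun x => mul_nonneg (hp.fisher_nonneg x) (heatKernel_nonneg _ _))
    fun x => by
      have h := hp.sq_deriv_eq x
      generalize deriv p x ^ 2 / p x = J at h ⊢
      rw [mul_pow, h]
      exact le_of_eq (by ring)).2
  dsimp only
  rw [div_le_iff₀ (heatSmooth_pos _ hs y), hp.heatSmoothDeriv_eq_integral_deriv hs,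
    hp.heatSmooth_eq, mul_comm]
  exact hcs

/-- The quotient is seen to converge only where `p ≠ 0`, a set that carries all the Fisher
information of `p`. Fatou handles the integral over this set; its limit and the bound from
`integral_fisher_heatSmooth_le` squeeze the integral over the whole line. -/
lemma tendsto_integral_fisher_heatSmooth :
    Tendsto (fun s => ∫ y,
      heatSmoothDeriv (volume.withDensity fun x => ENNReal.ofReal (p x)) s y ^ 2 /
        heatSmooth (volume.withDensity fun x => ENNReal.ofReal (p x)) s y) (𝓝[>] 0)
      (𝓝 (∫ x, deriv p x ^ 2 / p x)) := by
  have := hp.isProbabilityMeasure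
  set μ := volume.withDensity fun x => ENNReal.ofReal (p x)
  set S : Set ℝ := {x | p x ≠ 0}
  have hS : MeasurableSet S := (hp.continuous.measurable (measurableSet_singleton 0)).compl
  have eS : ∫ x in S, deriv p x ^ 2 / p x = ∫ x, deriv p x ^ 2 / p x :=
    setIntegral_eq_integral_of_forall_compl_eq_zero fun x hx => by
      have : p x = 0 := by simpa [S] using hx
      simp [this]
  have h0 : ∀ s y, 0 ≤ heatSmoothDeriv μ s y ^ 2 / heatSmooth μ s y := fun s y =>
    div_nonneg (sq_nonneg _) (heatSmooth_nonneg _ _ _)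
  have hle : ∀ s > 0, ∫ y in S, heatSmoothDeriv μ s y ^ 2 / heatSmooth μ s y ≤
      ∫ y, heatSmoothDeriv μ s y ^ 2 / heatSmooth μ s y := fun s hs =>
    setIntegral_le_integral (integrable_sq_heatSmoothDeriv_div μ hs) (ae_of_all _ (h0 s))
  have hdiff : ∀ᵐ x, DifferentiableAt ℝ p x := by
    have h : ∀ n : ℕ, ∀ᵐ x, x ∈ Set.uIcc (-(n : ℝ)) n → DifferentiableAt ℝ p x :=
      fun n => (hp.absCont _ _).ae_differentiableAt
    filter_upwards [ae_all_iff.2 h] with x hx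
    obtain ⟨n, hn⟩ := exists_nat_ge |x|
    refine hx n ?_
    rw [Set.uIcc_of_le (by linarith [abs_nonneg x])]
    exact ⟨(abs_le.1 hn).1, (abs_le.1 hn).2⟩
  have hlow : Tendsto (fun s => ∫ y in S, heatSmoothDeriv μ s y ^ 2 / heatSmooth μ s y) (𝓝[>] 0)
      (𝓝 (∫ x in S, deriv p x ^ 2 / p x)) := by
    refine tendsto_integral_of_nonneg_of_le (u := fun _ => ∫ x in S, deriv p x ^ 2 / p x) ?_
      hp.integrable_fisher.integrableOn ?_ tendsto_const_nhds ?_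
    · filter_upwards [self_mem_nhdsWithin] with s hs
      exact ⟨(integrable_sq_heatSmoothDeriv_div μ hs).integrableOn, h0 s⟩
    · filter_upwards [ae_restrict_of_ae hdiff, ae_restrict_mem hS] with y hy hyS
      exact ((hp.tendsto_heatSmoothDeriv hy).pow 2).div (hp.tendsto_heatSmooth y) hyS
    · filter_upwards [self_mem_nhdsWithin] with s hs
      rw [eS]
      exact (hle s hs).trans (hp.integral_fisher_heatSmooth_le hs)
  rw [eS] at hlow
  refine tendsto_of_tendsto_of_tendsto_of_le_of_le' hlow tendsto_const_nhds ?_ ?_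
  · filter_upwards [self_mem_nhdsWithin] with s hs
    exact hle s hs
  · filter_upwards [self_mem_nhdsWithin] with s hs
    exact hp.integral_fisher_heatSmooth_le hs

lemma integral_negMulLog_le_heatSmooth {s : ℝ} (hs : 0 < s)
    (hh : Integrable fun x => Real.negMulLog (p x))
    (hhs : Integrable fun y =>
      Real.negMulLog (heatSmooth (volume.withDensity fun x => ENNReal.ofReal (p x)) s y)) :
    ∫ x, Real.negMulLog (p x) ≤ ∫ y,
      Real.negMulLog (heatSmooth (volume.withDensity fun x => ENNReal.ofReal (p x)) s y) := by
  obtain ⟨M, hM⟩ := hp.exists_bound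
  have := isProbabilityMeasure_withDensity_ofReal (heatKernel_nonneg s) (integrable_heatKernel hs)
    (integral_heatKernel hs)
  have e : ∀ y, heatSmooth (volume.withDensity fun x => ENNReal.ofReal (p x)) s y =
      ∫ x, p (y - x) ∂(volume.withDensity fun x => ENNReal.ofReal (heatKernel s x)) := fun y => by
    rw [hp.heatSmooth_eq', integral_withDensity_ofReal (continuous_heatKernel s).measurable
      (heatKernel_nonneg s)]
    simp_rw [mul_comm]
  simp only [e] at hhs ⊢
  exact integral_negMulLog_le_of_conv hp.nonneg hM hp.continuous hh hhs

/-- The relative entropy to `exp (-l)` has a nonnegative integrand, so Fatou bounds it below; the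
increase of entropy under convolution and the convergence of the cross entropy bound it above.
Subtracting it from the cross entropy recovers the entropy. -/
lemma tendsto_integral_negMulLog_heatSmooth
    (hh : Integrable fun x => Real.negMulLog (p x)) :
    Tendsto (fun s => ∫ y,
      Real.negMulLog (heatSmooth (volume.withDensity fun x => ENNReal.ofReal (p x)) s y)) (𝓝[>] 0)
      (𝓝 (∫ x, Real.negMulLog (p x))) := by
  have := hp.isProbabilityMeasure
  obtain ⟨l, hl, hpl⟩ := hp.exists_entropyWeight hh
  obtain ⟨K, hK⟩ := hl.lipschitz
  set μ := volume.withDensity fun x => ENNReal.ofReal (p x)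
  have hpm := hp.continuous.measurable
  have hlμ : Integrable l μ := (integrable_withDensity_ofReal_iff hpm hp.nonneg).2 hpl
  have elμ : ∫ x, l x ∂μ = ∫ x, p x * l x := integral_withDensity_ofReal hpm hp.nonneg l
  have hcross : Tendsto (fun s => ∫ y, heatSmooth μ s y * l y) (𝓝[>] 0)
      (𝓝 (∫ x, p x * l x)) := by
    rw [← elμ]
    refine tendsto_iff_dist_tendsto_zero.2 ?_
    refine squeeze_zero' (.of_forall fun _ => dist_nonneg) ?_
      (by simpa using tendsto_integral_abs_mul_heatKernel.const_mul (K : ℝ))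
    filter_upwards [self_mem_nhdsWithin] with s hs
    exact abs_integral_conv_mul_lipschitz_sub_le hK hlμ (heatKernel_nonneg s)
      (continuous_heatKernel s).measurable (integrable_heatKernel hs)
      (integrable_abs_mul_heatKernel hs) (integral_heatKernel hs)
  have iK : ∀ s > 0, Integrable fun y => heatSmooth μ s y * l y := fun s hs =>
    integrable_heatSmooth_mul_weight hl hlμ hs
  have iH : ∀ s > 0, Integrable fun y => Real.negMulLog (heatSmooth μ s y) := fun s hs =>
    integrable_negMulLog_heatSmooth hl hlμ hs
  have key : ∀ P : ℝ → ℝ, Integrable P → ∫ x, P x = 1 → (Integrable fun y => P y * l y) →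
      (Integrable fun y => Real.negMulLog (P y)) →
      Integrable (fun y => P y * l y + Real.exp (-l y) - P y - Real.negMulLog (P y)) ∧
      ∫ y, (P y * l y + Real.exp (-l y) - P y - Real.negMulLog (P y)) =
        (∫ y, P y * l y) + (∫ y, Real.exp (-l y)) - 1 - ∫ y, Real.negMulLog (P y) := by
    intro P h1 h2 h3 h4
    have j1 := h3.add hl.integrable_exp
    have j2 := j1.sub h1
    refine ⟨j2.sub h4, ?_⟩
    have e3 := integral_sub j2 h4
    have e2 := integral_sub j1 h1
    have e1 := integral_add h3 hl.integrable_exp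
    simp only [Pi.add_apply, Pi.sub_apply] at e1 e2 e3
    rw [e3, e2, e1, h2]
  have k0 := key p hp.integrable hp.integral_eq_one hpl hh
  have ks := fun s (hs : 0 < s) => key _ (integrable_heatSmooth μ hs) (integral_heatSmooth μ hs)
    (iK s hs) (iH s hs)
  have hG := tendsto_integral_of_nonneg_of_le (μ := volume) (l := 𝓝[>] (0 : ℝ))
    (f := fun s y => heatSmooth μ s y * l y + Real.exp (-l y) - heatSmooth μ s y -
      Real.negMulLog (heatSmooth μ s y))
    (g := fun y => p y * l y + Real.exp (-l y) - p y - Real.negMulLog (p y))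
    (u := fun s => (∫ y, heatSmooth μ s y * l y) + (∫ y, Real.exp (-l y)) - 1 -
      ∫ y, Real.negMulLog (p y))
    (by
      filter_upwards [self_mem_nhdsWithin] with s hs
      refine ⟨(ks s hs).1, fun y => ?_⟩
      linarith [negMulLog_le_mul_add_exp (heatSmooth_nonneg μ s y) (l y)])
    k0.1
    (ae_of_all _ fun y => by
      have h := hp.tendsto_heatSmooth y
      exact (((h.mul_const _).add_const _).sub h).sub
        ((Real.continuous_negMulLog.tendsto _).comp h))
    (by
      rw [k0.2]
      exact ((hcross.add_const _).sub_const _).sub_const _)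
    (by
      filter_upwards [self_mem_nhdsWithin] with s hs
      rw [(ks s hs).2]
      linarith [hp.integral_negMulLog_le_heatSmooth hs hh (iH s hs)])
  have hfin := ((hcross.add_const (∫ y, Real.exp (-l y))).sub_const 1).sub hG
  rw [k0.2] at hfin
  convert! hfin.congr' _ using 2
  · ring
  · filter_upwards [self_mem_nhdsWithin] with s hs
    rw [(ks s hs).2]; ring

/-- De Bruijn's identity at time zero. -/
theorem hasDerivWithinAt_zero (hh : Integrable fun x => Real.negMulLog (p x)) :
    HasDerivWithinAt (fun s => if s = 0 then ∫ x, Real.negMulLog (p x) else ∫ y,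
      Real.negMulLog (heatSmooth (volume.withDensity fun x => ENNReal.ofReal (p x)) s y))
      (1 / 2 * ∫ x, deriv p x ^ 2 / p x) (Set.Ici 0) 0 := by
  have := hp.isProbabilityMeasure
  obtain ⟨l, hl, hpl⟩ := hp.exists_entropyWeight hh
  have hlμ := (integrable_withDensity_ofReal_iff hp.continuous.measurable hp.nonneg).2 hpl
  set μ := volume.withDensity fun x => ENNReal.ofReal (p x)
  -- The case split at `s = 0` is there because `heatKernel 0` vanishes identically, by `0⁻¹ = 0`,
  -- so `heatSmooth μ 0` is not `p`. Near a positive time it is invisible.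
  have hd : ∀ t > 0, HasDerivAt (fun s => if s = 0 then ∫ x, Real.negMulLog (p x) else ∫ y,
      Real.negMulLog (heatSmooth μ s y))
      (1 / 2 * ∫ y, heatSmoothDeriv μ t y ^ 2 / heatSmooth μ t y) t := fun t ht => by
    refine (hasDerivAt_integral_negMulLog_heatSmooth μ ht (lt_add_one t)
      (integrable_negMulLog_heatSmooth hl hlμ (by linarith))).congr_of_eventuallyEq ?_
    filter_upwards [eventually_gt_nhds ht] with s hs
    rw [if_neg hs.ne']
  refine hasDerivWithinAt_Ici_of_tendsto_deriv (s := Set.Ioi 0)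
    (fun t ht => (hd t ht).differentiableAt.differentiableWithinAt) ?_ self_mem_nhdsWithin ?_
  · unfold ContinuousWithinAt
    simp only [if_true]
    refine (hp.tendsto_integral_negMulLog_heatSmooth hh).congr' ?_
    filter_upwards [self_mem_nhdsWithin] with s hs
    rw [if_neg (ne_of_gt hs)]
  · refine (hp.tendsto_integral_fisher_heatSmooth.const_mul (1 / 2)).congr' ?_
    filter_upwards [self_mem_nhdsWithin] with s hs
    exact (hd s hs).deriv.symm

end IsFisherDensity

/-! ### Laws of independent sums; entropy and Fisher information as integrals over a density. -/

section Laws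

variable {Ω : Type*} [MeasurableSpace Ω] {P : Measure Ω}

/-- The joint law of `U` and `f U + V` for independent `U`, `V`, where `V` has density `g`. -/
lemma map_prodMk_add_eq_withDensity [IsProbabilityMeasure P] {U V : Ω → ℝ}
    (hU : Measurable U) (hV : Measurable V)
    (hUV : IndepFun U V P) {f g : ℝ → ℝ} (hf : Measurable f) (hg : Measurable g)
    (hVg : P.map V = volume.withDensity fun x => ENNReal.ofReal (g x)) :
    P.map (fun ω => (U ω, f (U ω) + V ω)) = ((P.map U).prod volume).withDensity
      fun z => ENNReal.ofReal (g (z.2 - f z.1)) := by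
  have : IsProbabilityMeasure (P.map U) := Measure.isProbabilityMeasure_map hU.aemeasurable
  refine Measure.ext_of_lintegral _ fun F hF => ?_
  have h1 : P.map (fun ω => (U ω, V ω)) = (P.map U).prod (P.map V) :=
    (indepFun_iff_map_prod_eq_prod_map_map hU.aemeasurable hV.aemeasurable).1 hUV
  have e1 : ∫⁻ z, F z ∂(P.map fun ω => (U ω, f (U ω) + V ω)) =
      ∫⁻ z, F (z.1, f z.1 + z.2) ∂(P.map fun ω => (U ω, V ω)) := by
    rw [lintegral_map hF (by fun_prop), lintegral_map (by fun_prop) (by fun_prop)]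
  rw [e1, h1, hVg, lintegral_prod _ (by fun_prop),
    lintegral_withDensity_eq_lintegral_mul _ (by fun_prop) hF, lintegral_prod _ (by fun_prop)]
  refine lintegral_congr fun x => ?_
  dsimp only
  rw [lintegral_withDensity_eq_lintegral_mul _ (by fun_prop) (by fun_prop)]
  rw [← lintegral_sub_right_eq_self _ (f x)]
  simp

lemma map_add_eq_withDensity [IsProbabilityMeasure P] {U V : Ω → ℝ} (hU : Measurable U)
    (hV : Measurable V)
    (hUV : IndepFun U V P) {f g : ℝ → ℝ} (hf : Measurable f) (hg : Measurable g)
    (hg0 : ∀ x, 0 ≤ g x) {C : ℝ} (hgC : ∀ x, g x ≤ C)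
    (hVg : P.map V = volume.withDensity fun x => ENNReal.ofReal (g x)) :
    P.map (fun ω => f (U ω) + V ω) = volume.withDensity
      fun y => ENNReal.ofReal (∫ x, g (y - f x) ∂(P.map U)) := by
  have : IsProbabilityMeasure (P.map U) := Measure.isProbabilityMeasure_map hU.aemeasurable
  have h := map_prodMk_add_eq_withDensity hU hV hUV hf hg hVg
  have e : P.map (fun ω => f (U ω) + V ω) =
      (P.map (fun ω => (U ω, f (U ω) + V ω))).map Prod.snd := by
    rw [Measure.map_map measurable_snd (by fun_prop)]; rfl
  rw [e, h]
  refine Measure.ext_of_lintegral _ fun F hF => ?_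
  rw [lintegral_map hF measurable_snd,
    lintegral_withDensity_eq_lintegral_mul _ (by fun_prop) (by fun_prop),
    lintegral_prod_symm _ (by fun_prop)]
  have hm : Measurable fun y => ENNReal.ofReal (∫ x, g (y - f x) ∂(P.map U)) := by
    have : StronglyMeasurable fun y => ∫ x, g (y - f x) ∂(P.map U) := by
      have : StronglyMeasurable (Function.uncurry fun y x => g (y - f x)) :=
        (by fun_prop : Measurable fun z : ℝ × ℝ => g (z.1 - f z.2)).stronglyMeasurable
      exact this.integral_prod_right
    exact this.measurable.ennreal_ofReal
  rw [lintegral_withDensity_eq_lintegral_mul _ hm hF]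
  refine lintegral_congr fun y => ?_
  simp only [Pi.mul_apply]
  rw [lintegral_mul_const _ (by fun_prop), ofReal_integral_eq_lintegral_ofReal _
    (ae_of_all _ fun x => hg0 _)]
  refine Integrable.of_bound (C := C) (by fun_prop : Measurable _).aestronglyMeasurable
    (ae_of_all _ fun x => ?_)
  rw [Real.norm_eq_abs, abs_of_nonneg (hg0 _)]
  exact hgC _

lemma gaussianReal_eq_withDensity_heatKernel (m : ℝ) {v : ℝ≥0} (hv : v ≠ 0) :
    gaussianReal m v = volume.withDensity fun x => ENNReal.ofReal (heatKernel v (x - m)) := by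
  rw [gaussianReal_of_var_ne_zero m hv]
  rfl

lemma map_add_gaussian_eq_withDensity [IsProbabilityMeasure P] {U V : Ω → ℝ}
    (hU : Measurable U) (hV : Measurable V)
    (hUV : IndepFun U V P) {m : ℝ} {v : ℝ≥0} (hv : v ≠ 0) (hVg : P.map V = gaussianReal m v) :
    P.map (fun ω => U ω + V ω) = volume.withDensity
      fun y => ENNReal.ofReal (heatSmooth (P.map U) v (y - m)) := by
  have hv0 : (0 : ℝ) < v := NNReal.coe_pos.2 (pos_iff_ne_zero.2 hv)
  have hk := (continuous_heatKernel v).measurable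
  refine (map_add_eq_withDensity hU hV hUV (f := id) (g := fun x => heatKernel v (x - m))
    measurable_id (by fun_prop) (fun x => heatKernel_nonneg _ _) (fun x => heatKernel_le _ hv0 _)
    (hVg.trans (gaussianReal_eq_withDensity_heatKernel m hv))).trans ?_
  congr 1; ext y
  simp only [id, heatSmooth, sub_right_comm]

section Density

variable {Y : Ω → ℝ} {p : ℝ → ℝ} (hY : Measurable Y) (hp : Measurable p) (hp0 : ∀ x, 0 ≤ p x)
  (hYp : P.map Y = volume.withDensity fun x => ENNReal.ofReal (p x))
include hY hp hp0 hYp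

omit hp0 in
lemma hasPDF_of_map_eq_ofReal : HasPDF Y P volume :=
  hasPDF_of_map_eq_withDensity hY.aemeasurable _ hp.ennreal_ofReal.aemeasurable hYp

/-- The function `pdf` is determined only almost everywhere; here it is exchanged once for the given
density. -/
lemma mul_log_pdf_ae_eq [IsProbabilityMeasure P] :
    (fun y => p y * Real.log (1 / (pdf Y P volume y).toReal)) =ᵐ[volume]
    fun y => Real.negMulLog (p y) := by
  have := hasPDF_of_map_eq_ofReal hY hp hYp
  filter_upwards [(pdf.eq_of_map_eq_withDensity' _ hp.ennreal_ofReal.aemeasurable).1 hYp] with y hy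
  rw [hy, ENNReal.toReal_ofReal (hp0 y), one_div, Real.log_inv, Real.negMulLog]
  ring

lemma hasFiniteEntropy_iff_integrable_negMulLog [IsProbabilityMeasure P] :
    HasFiniteEntropy Y P ↔ Integrable fun y => Real.negMulLog (p y) := by
  have hm : Measurable fun y => Real.log (1 / (pdf Y P volume y).toReal) :=
    ((measurable_pdf Y P volume).ennreal_toReal.const_div 1).log
  unfold HasFiniteEntropy
  rw [and_iff_right (hasPDF_of_map_eq_ofReal hY hp hYp),
    ← integrable_congr (mul_log_pdf_ae_eq hY hp hp0 hYp),
    ← integrable_withDensity_ofReal_iff hp hp0, ← hYp,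
    integrable_map_measure hm.aestronglyMeasurable hY.aemeasurable]
  rfl

lemma diffEntropy_eq_integral_negMulLog [IsProbabilityMeasure P] :
    diffEntropy Y P = ∫ y, Real.negMulLog (p y) := by
  have hm : Measurable fun y => Real.log (1 / (pdf Y P volume y).toReal) :=
    ((measurable_pdf Y P volume).ennreal_toReal.const_div 1).log
  unfold diffEntropy
  rw [← integral_congr_ae (mul_log_pdf_ae_eq hY hp hp0 hYp), ← integral_withDensity_ofReal hp hp0,
    ← hYp, integral_map hY.aemeasurable hm.aestronglyMeasurable]

/-- The law supplies a factor `p`, turning `(p' / p)²` into `p'² / p`; where `p = 0` both sides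
vanish by the convention for division by zero. -/
lemma lintegral_sq_deriv_div_eq :
    ∫⁻ ω, ENNReal.ofReal ((deriv p (Y ω) / p (Y ω)) ^ 2) ∂P =
      ∫⁻ y, ENNReal.ofReal (deriv p y ^ 2 / p y) := by
  have hm : Measurable fun y => ENNReal.ofReal ((deriv p y / p y) ^ 2) :=
    (((measurable_deriv p).div hp).pow_const 2).ennreal_ofReal
  rw [← lintegral_map hm hY, hYp, lintegral_withDensity_eq_lintegral_mul _ hp.ennreal_ofReal hm]
  refine lintegral_congr fun y => ?_
  rw [Pi.mul_apply, ← ENNReal.ofReal_mul (hp0 y)]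
  congr 1
  by_cases h : p y = 0
  · simp [h]
  · field_simp

end Density

lemma IsACDensity.continuous {p : ℝ → ℝ} {Y : Ω → ℝ} (h : IsACDensity p Y P) : Continuous p :=
  continuous_of_absolutelyContinuousOnInterval h.absCont

/-- Two densities of one law agree almost everywhere, and continuous ones then agree everywhere. So
the infimum in `fisherInfo` is the value at the only candidate when there is one. -/
lemma IsACDensity.unique {p q : ℝ → ℝ} {Y : Ω → ℝ} (hp : IsACDensity p Y P)
    (hq : IsACDensity q Y P) : p = q := by
  have h := (withDensity_eq_iff_of_sigmaFinite hp.continuous.measurable.ennreal_ofReal.aemeasurable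
    hq.continuous.measurable.ennreal_ofReal.aemeasurable).1 (hp.map_eq.symm.trans hq.map_eq)
  refine (Continuous.ae_eq_iff_eq volume hp.continuous hq.continuous).1 ?_
  filter_upwards [h] with x hx
  exact (ENNReal.ofReal_eq_ofReal_iff (hp.nonneg x) (hq.nonneg x)).1 hx

lemma IsACDensity.fisherInfo_eq {p : ℝ → ℝ} {Y : Ω → ℝ} (hY : Measurable Y)
    (hp : IsACDensity p Y P) :
    fisherInfo Y P = ∫⁻ y, ENNReal.ofReal (deriv p y ^ 2 / p y) := by
  rw [← lintegral_sq_deriv_div_eq hY hp.continuous.measurable hp.nonneg hp.map_eq]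
  unfold fisherInfo
  refine le_antisymm (iInf₂_le p hp) (le_iInf₂ fun q hq => ?_)
  rw [hp.unique hq]

lemma IsACDensity.integrable [IsProbabilityMeasure P] {p : ℝ → ℝ} {Y : Ω → ℝ} (hY : Measurable Y)
    (hp : IsACDensity p Y P) : Integrable p ∧ ∫ x, p x = 1 := by
  have : IsProbabilityMeasure (P.map Y) := Measure.isProbabilityMeasure_map hY.aemeasurable
  have h1 : ∫⁻ x, ENNReal.ofReal (p x) = 1 := by
    have := measure_univ (μ := P.map Y)
    rwa [hp.map_eq, withDensity_apply _ MeasurableSet.univ, Measure.restrict_univ] at this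
  have hi : Integrable p := by
    rw [← lintegral_ofReal_ne_top_iff_integrable hp.continuous.aestronglyMeasurable
      (ae_of_all _ hp.nonneg), h1]
    exact ENNReal.one_ne_top
  refine ⟨hi, ?_⟩
  rw [integral_eq_lintegral_of_nonneg_ae (ae_of_all _ hp.nonneg) hi.aestronglyMeasurable, h1,
    ENNReal.toReal_one]

/-- A random variable with finite Fisher information has a density of finite Fisher information. -/
lemma exists_isFisherDensity [IsProbabilityMeasure P] {Y : Ω → ℝ} (hY : Measurable Y)
    (h : fisherInfo Y P ≠ ∞) :
    ∃ p, IsFisherDensity p ∧ (P.map Y = volume.withDensity fun x => ENNReal.ofReal (p x)) ∧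
      (fisherInfo Y P).toReal = ∫ x, deriv p x ^ 2 / p x := by
  obtain ⟨p, hp⟩ : ∃ p, IsACDensity p Y P := by
    by_contra! hcon
    exact h (by unfold fisherInfo; simp [hcon])
  have hnn : ∀ x, 0 ≤ deriv p x ^ 2 / p x := fun x => div_nonneg (sq_nonneg _) (hp.nonneg x)
  have hm : Measurable fun x => deriv p x ^ 2 / p x :=
    ((measurable_deriv p).pow_const 2).div hp.continuous.measurable
  have e := hp.fisherInfo_eq hY
  have hi : Integrable fun x => deriv p x ^ 2 / p x := by
    rw [← lintegral_ofReal_ne_top_iff_integrable hm.aestronglyMeasurable (ae_of_all _ hnn), ← e]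
    exact h
  refine ⟨p, ⟨hp.nonneg, hp.absCont, (hp.integrable hY).1, (hp.integrable hY).2, hi⟩, hp.map_eq, ?_⟩
  rw [e, integral_eq_lintegral_of_nonneg_ae (ae_of_all _ hnn) hm.aestronglyMeasurable]

/-- The derivative is at most a multiple of the smoothing at time `s + 1`, which is bounded, so the
density is Lipschitz. -/
lemma isACDensity_heatSmooth {κ : Measure ℝ} [IsProbabilityMeasure κ] {Y : Ω → ℝ} {s m : ℝ}
    (hs : 0 < s)
    (hYp : P.map Y = volume.withDensity fun y => ENNReal.ofReal (heatSmooth κ s (y - m))) :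
    IsACDensity (fun y => heatSmooth κ s (y - m)) Y P where
  nonneg _ := heatSmooth_nonneg _ _ _
  absCont a b := by
    obtain ⟨C, hC, hdom⟩ := heatSmooth_dom κ hs le_rfl (lt_add_one s)
    have hd : ∀ y, HasDerivAt (fun y => heatSmooth κ s (y - m)) (heatSmoothDeriv κ s (y - m)) y :=
      fun y => (hasDerivAt_heatSmooth κ hs (y - m)).comp_sub_const y m
    have hs1 : 0 < s + 1 := by linarith
    refine LipschitzOnWith.absolutelyContinuousOnInterval
      (K := (C * (√(2 * Real.pi * (s + 1)))⁻¹).toNNReal) (LipschitzWith.lipschitzOnWith ?_)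
    refine lipschitzWith_of_nnnorm_deriv_le (fun y => (hd y).differentiableAt) fun y => ?_
    rw [(hd y).deriv, ← NNReal.coe_le_coe, coe_nnnorm, Real.norm_eq_abs]
    refine ((hdom s (by simp) (y - m)).2.1.trans ?_).trans (Real.le_coe_toNNReal _)
    exact mul_le_mul_of_nonneg_left (heatSmooth_le κ hs1 _) hC.le
  map_eq := hYp

lemma fisherInfo_eq_of_heatSmooth {κ : Measure ℝ} [IsProbabilityMeasure κ] {Y : Ω → ℝ} {s m : ℝ}
    (hY : Measurable Y) (hs : 0 < s)
    (hYp : P.map Y = volume.withDensity fun y => ENNReal.ofReal (heatSmooth κ s (y - m))) :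
    fisherInfo Y P = ENNReal.ofReal (∫ y, heatSmoothDeriv κ s y ^ 2 / heatSmooth κ s y) := by
  have hd : ∀ y, deriv (fun y => heatSmooth κ s (y - m)) y = heatSmoothDeriv κ s (y - m) :=
    fun y => ((hasDerivAt_heatSmooth κ hs (y - m)).comp_sub_const y m).deriv
  rw [(isACDensity_heatSmooth hs hYp).fisherInfo_eq hY]
  simp only [hd]
  rw [ofReal_integral_eq_lintegral_ofReal (integrable_sq_heatSmoothDeriv_div κ hs)
    (ae_of_all _ fun y => div_nonneg (sq_nonneg _) (heatSmooth_nonneg _ _ _))]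
  exact lintegral_sub_right_eq_self
    (fun y => ENNReal.ofReal (heatSmoothDeriv κ s y ^ 2 / heatSmooth κ s y)) m

lemma hasFiniteEntropy_iff_of_heatSmooth [IsProbabilityMeasure P] {κ : Measure ℝ}
    [IsProbabilityMeasure κ] {Y : Ω → ℝ}
    {s m : ℝ} (hY : Measurable Y) (hs : 0 < s)
    (hYp : P.map Y = volume.withDensity fun y => ENNReal.ofReal (heatSmooth κ s (y - m))) :
    HasFiniteEntropy Y P ↔ Integrable fun y => Real.negMulLog (heatSmooth κ s y) := by
  have hc := (continuous_heatSmooth κ hs).measurable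
  rw [hasFiniteEntropy_iff_integrable_negMulLog hY (by fun_prop)
    (fun y => heatSmooth_nonneg _ _ _) hYp]
  refine ⟨fun h => ?_, fun h => h.comp_sub_right m⟩
  simpa using h.comp_add_right m

lemma diffEntropy_eq_of_heatSmooth [IsProbabilityMeasure P] {κ : Measure ℝ}
    [IsProbabilityMeasure κ] {Y : Ω → ℝ}
    {s m : ℝ} (hY : Measurable Y) (hs : 0 < s)
    (hYp : P.map Y = volume.withDensity fun y => ENNReal.ofReal (heatSmooth κ s (y - m))) :
    diffEntropy Y P = ∫ y, Real.negMulLog (heatSmooth κ s y) := by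
  have hc := (continuous_heatSmooth κ hs).measurable
  rw [diffEntropy_eq_integral_negMulLog hY (by fun_prop) (fun y => heatSmooth_nonneg _ _ _) hYp]
  exact integral_sub_right_eq_self (fun y => Real.negMulLog (heatSmooth κ s y)) m

end Laws

/-! ### De Bruijn's identity for Gaussian noise. -/

section GaussianNoise

variable {Ω : Type*} [MeasurableSpace Ω] {P : Measure Ω} {X Z : Ω → ℝ}

lemma map_sqrt_mul_gaussian {m : ℝ} {v : ℝ≥0} (hZ : Measurable Z)
    (hZg : P.map Z = gaussianReal m v) {t : ℝ} (ht : 0 ≤ t) :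
    P.map (fun ω => √t * Z ω) = gaussianReal (√t * m) (t.toNNReal * v) := by
  have h := (gaussianReal_const_mul ⟨hZ.aemeasurable, hZg⟩ √t).map_eq
  rw [h]
  congr 2
  ext
  simp [Real.sq_sqrt ht, ht]

/-- The law of `X + √t Z` for Gaussian `Z`. -/
lemma map_add_sqrt_mul_gaussian [IsProbabilityMeasure P] (hX : Measurable X)
    (hZ : Measurable Z) (hXZ : IndepFun X Z P)
    {m : ℝ} {v : ℝ≥0} (hv : v ≠ 0) (hZg : P.map Z = gaussianReal m v) {t : ℝ} (ht : 0 < t) :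
    P.map (fun ω => X ω + √t * Z ω) = volume.withDensity
      fun y => ENNReal.ofReal (heatSmooth (P.map X) (t * v) (y - √t * m)) := by
  have hne : t.toNNReal * v ≠ 0 := mul_ne_zero (by simpa using ht) hv
  rw [map_add_gaussian_eq_withDensity hX (hZ.const_mul √t)
    (hXZ.comp measurable_id (measurable_const_mul √t)) hne (map_sqrt_mul_gaussian hZ hZg ht.le)]
  simp [ht.le]

lemma integrable_of_map_eq_gaussian {m : ℝ} {v : ℝ≥0} (hZ : Measurable Z)
    (hZg : P.map Z = gaussianReal m v) : Integrable Z P := by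
  have h : Integrable (fun x : ℝ => x) (gaussianReal m v) :=
    (memLp_id_gaussianReal 1).integrable le_rfl
  rw [← hZg] at h
  exact (integrable_map_measure aestronglyMeasurable_id hZ.aemeasurable).1 h

/-- Finite entropy and Fisher information of a perturbation of `X` give a Lipschitz weight with
finite cross entropy relative to the law of `X`. -/
lemma exists_entropyWeight_map [IsProbabilityMeasure P] (hX : Measurable X)
    (hZ : Measurable Z) (hZi : Integrable Z P)
    {t : ℝ} (hJ : fisherInfo (fun ω => X ω + √t * Z ω) P ≠ ∞)
    (hh : HasFiniteEntropy (fun ω => X ω + √t * Z ω) P) :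
    ∃ l, IsEntropyWeight l ∧ Integrable l (P.map X) := by
  have hY : Measurable fun ω => X ω + √t * Z ω := by fun_prop
  obtain ⟨p, hp, hYp, -⟩ := exists_isFisherDensity hY hJ
  have hpm := hp.continuous.measurable
  obtain ⟨l, hl, hpl⟩ := hp.exists_entropyWeight
    ((hasFiniteEntropy_iff_integrable_negMulLog hY hpm hp.nonneg hYp).1 hh)
  refine ⟨l, hl, ?_⟩
  have hlc := hl.continuous
  have h1 : Integrable l (P.map fun ω => X ω + √t * Z ω) := by
    rw [hYp]; exact (integrable_withDensity_ofReal_iff hpm hp.nonneg).2 hpl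
  have h2 := (integrable_map_measure hlc.aestronglyMeasurable hY.aemeasurable).1 h1
  refine (integrable_map_measure hlc.aestronglyMeasurable hX.aemeasurable).2 ?_
  -- The Lipschitz bound passes integrability of `l` from `X + √t Z` back to `X` at the cost of
  -- `E|Z|`; from the law of `X` it reaches every other time.
  obtain ⟨K, hK⟩ := hl.lipschitz
  refine (h2.abs.add (hZi.abs.const_mul (K * √t))).mono'
    (hlc.measurable.comp hX).aestronglyMeasurable (ae_of_all _ fun ω => ?_)
  have h3 := hK.dist_le_mul (X ω) (X ω + √t * Z ω)
  rw [Real.dist_eq, Real.dist_eq, sub_add_cancel_left, abs_neg, abs_mul,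
    abs_of_nonneg (Real.sqrt_nonneg t), ← mul_assoc] at h3
  simp only [Pi.add_apply, Function.comp_apply, Real.norm_eq_abs]
  linarith [abs_sub_abs_le_abs_sub (l (X ω)) (l (X ω + √t * Z ω))]

variable [IsProbabilityMeasure P] (hX : Measurable X) (hZ : Measurable Z)
    (hXZ : IndepFun X Z P) {m : ℝ} {v : ℝ≥0}
  (hv : v ≠ 0) (hZg : P.map Z = gaussianReal m v)
include hX hZ hXZ hv hZg

lemma fisherInfo_add_gaussian {t : ℝ} (ht : 0 < t) :
    fisherInfo (fun ω => X ω + √t * Z ω) P = ENNReal.ofReal (∫ y,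
      heatSmoothDeriv (P.map X) (t * v) y ^ 2 / heatSmooth (P.map X) (t * v) y) := by
  have : IsProbabilityMeasure (P.map X) := Measure.isProbabilityMeasure_map hX.aemeasurable
  have hv0 : (0 : ℝ) < v := NNReal.coe_pos.2 (pos_iff_ne_zero.2 hv)
  exact fisherInfo_eq_of_heatSmooth (by fun_prop) (mul_pos ht hv0)
    (map_add_sqrt_mul_gaussian hX hZ hXZ hv hZg ht)

lemma hasFiniteEntropy_add_gaussian {l : ℝ → ℝ} (hl : IsEntropyWeight l)
    (hlX : Integrable l (P.map X)) {t : ℝ} (ht : 0 < t) :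
    HasFiniteEntropy (fun ω => X ω + √t * Z ω) P := by
  have : IsProbabilityMeasure (P.map X) := Measure.isProbabilityMeasure_map hX.aemeasurable
  have hv0 : (0 : ℝ) < v := NNReal.coe_pos.2 (pos_iff_ne_zero.2 hv)
  exact (hasFiniteEntropy_iff_of_heatSmooth (by fun_prop) (mul_pos ht hv0)
    (map_add_sqrt_mul_gaussian hX hZ hXZ hv hZg ht)).2
    (integrable_negMulLog_heatSmooth hl hlX (mul_pos ht hv0))

lemma diffEntropy_add_gaussian {t : ℝ} (ht : 0 < t) :
    diffEntropy (fun ω => X ω + √t * Z ω) P =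
      ∫ y, Real.negMulLog (heatSmooth (P.map X) (t * v) y) := by
  have : IsProbabilityMeasure (P.map X) := Measure.isProbabilityMeasure_map hX.aemeasurable
  have hv0 : (0 : ℝ) < v := NNReal.coe_pos.2 (pos_iff_ne_zero.2 hv)
  exact diffEntropy_eq_of_heatSmooth (by fun_prop) (mul_pos ht hv0)
    (map_add_sqrt_mul_gaussian hX hZ hXZ hv hZg ht)

lemma hasDerivAt_diffEntropy_add_gaussian {l : ℝ → ℝ} (hl : IsEntropyWeight l)
    (hlX : Integrable l (P.map X)) {t : ℝ} (ht : 0 < t) :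
    HasDerivAt (fun s : ℝ => diffEntropy (fun ω => X ω + √s * Z ω) P)
      (1 / 2 * (fisherInfo (fun ω => X ω + √t * Z ω) P).toReal * v) t := by
  have : IsProbabilityMeasure (P.map X) := Measure.isProbabilityMeasure_map hX.aemeasurable
  have hv0 : (0 : ℝ) < v := NNReal.coe_pos.2 (pos_iff_ne_zero.2 hv)
  have htv : 0 < t * v := mul_pos ht hv0
  have h := hasDerivAt_integral_negMulLog_heatSmooth (P.map X) htv (lt_add_one _)
    (integrable_negMulLog_heatSmooth hl hlX (by linarith))
  have h2 := h.comp t ((hasDerivAt_id t).mul_const (v : ℝ))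
  rw [fisherInfo_add_gaussian hX hZ hXZ hv hZg ht, ENNReal.toReal_ofReal (integral_nonneg fun y =>
    div_nonneg (sq_nonneg _) (heatSmooth_nonneg _ _ _))]
  rw [one_mul] at h2
  refine h2.congr_of_eventuallyEq ?_
  filter_upwards [eventually_gt_nhds ht] with s hs
  exact diffEntropy_add_gaussian hX hZ hXZ hv hZg hs

lemma hasFiniteEntropy_of_log_moment (hlog : Integrable (fun ω => Real.log (1 + |X ω|)) P)
    {t : ℝ} (ht : 0 ≤ t) (hJ : fisherInfo (fun ω => X ω + √t * Z ω) P ≠ ∞) :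
    HasFiniteEntropy (fun ω => X ω + √t * Z ω) P := by
  have hlX : Integrable (fun x => Real.log (1 + x ^ 2)) (P.map X) := by
    refine integrable_log_one_add_sq ?_
    exact (integrable_map_measure (by fun_prop : Measurable _).aestronglyMeasurable
      hX.aemeasurable).2 hlog
  rcases ht.eq_or_lt with rfl | ht
  -- Without smoothing, the bound on the density comes from the finite Fisher information.
  · simp only [Real.sqrt_zero, zero_mul, add_zero] at hJ ⊢
    obtain ⟨p, hp, hXp, -⟩ := exists_isFisherDensity hX hJ
    obtain ⟨M, hM⟩ := hp.exists_bound
    have hpm := hp.continuous.measurable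
    rw [hasFiniteEntropy_iff_integrable_negMulLog hX hpm hp.nonneg hXp]
    rw [hXp, integrable_withDensity_ofReal_iff hpm hp.nonneg] at hlX
    exact integrable_negMulLog_of_cross hp.nonneg hM hp.integrable
      isEntropyWeight_log.integrable_exp hlX
  · exact hasFiniteEntropy_add_gaussian hX hZ hXZ hv hZg isEntropyWeight_log hlX ht

/-- De Bruijn's identity, including the right derivative at time zero. -/
theorem hasDerivWithinAt_diffEntropy_add_gaussian {t : ℝ} (ht : 0 ≤ t)
    (hJ : fisherInfo (fun ω => X ω + √t * Z ω) P ≠ ∞)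
    (hh : HasFiniteEntropy (fun ω => X ω + √t * Z ω) P) :
    HasDerivWithinAt (fun s : ℝ => diffEntropy (fun ω => X ω + √s * Z ω) P)
      (1 / 2 * (fisherInfo (fun ω => X ω + √t * Z ω) P).toReal * v) (Set.Ici 0) t := by
  have hv0 : (0 : ℝ) < v := NNReal.coe_pos.2 (pos_iff_ne_zero.2 hv)
  rcases ht.eq_or_lt with rfl | ht
  · simp only [Real.sqrt_zero, zero_mul, add_zero] at hJ hh ⊢
    obtain ⟨p, hp, hXp, eJ⟩ := exists_isFisherDensity hX hJ
    have hpm := hp.continuous.measurable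
    have h := hp.hasDerivWithinAt_zero
      ((hasFiniteEntropy_iff_integrable_negMulLog hX hpm hp.nonneg hXp).1 hh)
    rw [← hXp, ← eJ] at h
    have hlin : HasDerivWithinAt (fun s : ℝ => s * v) v (Set.Ici 0) 0 := by
      simpa using ((hasDerivAt_id (0 : ℝ)).mul_const (v : ℝ)).hasDerivWithinAt
    have h2 := HasDerivWithinAt.comp_of_eq 0 h hlin (fun s hs => mul_nonneg hs hv0.le)
      (zero_mul _).symm
    refine h2.congr (fun s hs => ?_) ?_
    · rcases (Set.mem_Ici.1 hs).eq_or_lt with rfl | hs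
      · simpa using diffEntropy_eq_integral_negMulLog hX hpm hp.nonneg hXp
      · simp only [Function.comp_apply]
        rw [if_neg (mul_pos hs hv0).ne']
        exact diffEntropy_add_gaussian hX hZ hXZ hv hZg hs
    · simpa using diffEntropy_eq_integral_negMulLog hX hpm hp.nonneg hXp
  · obtain ⟨l, hl, hlX⟩ := exists_entropyWeight_map hX hZ
      (integrable_of_map_eq_gaussian hZ hZg) hJ hh
    exact (hasDerivAt_diffEntropy_add_gaussian hX hZ hXZ hv hZg hl hlX ht).hasDerivWithinAt

end GaussianNoise

/-! ### Bayes' formula for a noisy observation. -/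

section Bayes

variable {Ω : Type*} [MeasurableSpace Ω] {P : Measure Ω} [IsProbabilityMeasure P] {U V : Ω → ℝ}
  (hU : Measurable U) (hV : Measurable V) (hUV : IndepFun U V P) {f g : ℝ → ℝ} (hf : Measurable f)
  (hg : Measurable g) (hg0 : ∀ x, 0 ≤ g x)
  (hVg : P.map V = volume.withDensity fun x => ENNReal.ofReal (g x))
include hU hV hUV hf hg hg0 hVg

lemma integrable_comp_prodMk_add_iff {F : ℝ × ℝ → ℝ} (hF : Measurable F) :
    Integrable (fun ω => F (U ω, f (U ω) + V ω)) P ↔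
      Integrable (fun z : ℝ × ℝ => g (z.2 - f z.1) * F z) ((P.map U).prod volume) := by
  have h := map_prodMk_add_eq_withDensity hU hV hUV hf hg hVg
  have h1 := integrable_map_measure (μ := P) (f := fun ω => (U ω, f (U ω) + V ω))
    hF.aestronglyMeasurable (by fun_prop)
  rw [h, integrable_withDensity_iff_integrable_smul' (by fun_prop)
    (ae_of_all _ fun x => ENNReal.ofReal_lt_top)] at h1
  simp only [ENNReal.toReal_ofReal (hg0 _), smul_eq_mul] at h1
  exact h1.symm

lemma integral_comp_prodMk_add {F : ℝ × ℝ → ℝ} (hF : Measurable F) :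
    ∫ ω, F (U ω, f (U ω) + V ω) ∂P =
      ∫ z : ℝ × ℝ, g (z.2 - f z.1) * F z ∂((P.map U).prod volume) := by
  have h := map_prodMk_add_eq_withDensity hU hV hUV hf hg hVg
  have h1 := integral_map (μ := P) (φ := fun ω => (U ω, f (U ω) + V ω)) (by fun_prop)
    hF.aestronglyMeasurable
  rw [h, integral_withDensity_eq_integral_toReal_smul (by fun_prop)
    (ae_of_all _ fun x => ENNReal.ofReal_lt_top)] at h1
  simp only [ENNReal.toReal_ofReal (hg0 _), smul_eq_mul] at h1
  exact h1.symm

lemma integral_comp_prodMk_add' {F : ℝ × ℝ → ℝ} (hF : Measurable F)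
    (hFi : Integrable (fun ω => F (U ω, f (U ω) + V ω)) P) :
    ∫ ω, F (U ω, f (U ω) + V ω) ∂P = ∫ w, ∫ x, g (w - f x) * F (x, w) ∂(P.map U) := by
  have : IsProbabilityMeasure (P.map U) := Measure.isProbabilityMeasure_map hU.aemeasurable
  rw [integral_comp_prodMk_add hU hV hUV hf hg hg0 hVg hF, integral_prod_symm]
  exact (integrable_comp_prodMk_add_iff hU hV hUV hf hg hg0 hVg hF).1 hFi

/-- Bayes' formula for the conditional expectation given a noisy observation. -/
lemma condExp_ae_eq_bayes (hgpos : ∀ x, 0 < g x) {C : ℝ} (hgC : ∀ x, g x ≤ C)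
    (hUi : Integrable U P) :
    P[U | MeasurableSpace.comap (fun ω => f (U ω) + V ω) inferInstance] =ᵐ[P]
      fun ω => (fun w => (∫ x, g (w - f x) * x ∂(P.map U)) / ∫ x, g (w - f x) ∂(P.map U))
        (f (U ω) + V ω) := by
  have : IsProbabilityMeasure (P.map U) := Measure.isProbabilityMeasure_map hU.aemeasurable
  set W : Ω → ℝ := fun ω => f (U ω) + V ω with hW
  have hWm : Measurable W := by fun_prop
  set a : ℝ → ℝ := fun w => ∫ x, g (w - f x) * x ∂(P.map U)
  set r : ℝ → ℝ := fun w => ∫ x, g (w - f x) ∂(P.map U)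
  have hr0 : ∀ w, 0 < r w := fun w => by
    have hi : Integrable (fun x => g (w - f x)) (P.map U) :=
      Integrable.of_bound (C := C) (by fun_prop : Measurable _).aestronglyMeasurable
        (ae_of_all _ fun x => by rw [Real.norm_eq_abs, abs_of_nonneg (hg0 _)]; exact hgC _)
    rw [integral_pos_iff_support_of_nonneg (fun x => hg0 _) hi]
    have : Function.support (fun x => g (w - f x)) = Set.univ := by
      ext x; simp [(hgpos (w - f x)).ne']
    simp [this]
  have ham : Measurable a := by
    have : StronglyMeasurable (Function.uncurry fun w x => g (w - f x) * x) :=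
      (by fun_prop : Measurable fun z : ℝ × ℝ => g (z.1 - f z.2) * z.2).stronglyMeasurable
    exact this.integral_prod_right.measurable
  have hrm : Measurable r := by
    have : StronglyMeasurable (Function.uncurry fun w x => g (w - f x)) :=
      (by fun_prop : Measurable fun z : ℝ × ℝ => g (z.1 - f z.2)).stronglyMeasurable
    exact this.integral_prod_right.measurable
  have hjoint := (integrable_comp_prodMk_add_iff hU hV hUV hf hg hg0 hVg
    (F := fun z => z.1) measurable_fst).1 hUi
  have hai : Integrable a := hjoint.integral_prod_right
  have hlaw : P.map W = volume.withDensity fun w => ENNReal.ofReal (r w) :=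
    map_add_eq_withDensity hU hV hUV hf hg hg0 hgC hVg
  have hmul : ∀ w, r w * (a w / r w) = a w := fun w => mul_div_cancel₀ _ (hr0 w).ne'
  have hGi : Integrable (fun ω => a (W ω) / r (W ω)) P := by
    have h1 : Integrable (fun w => a w / r w) (P.map W) := by
      rw [hlaw, integrable_withDensity_ofReal_iff hrm fun w => (hr0 w).le]
      simpa only [hmul] using hai
    exact (integrable_map_measure (ham.div hrm).aestronglyMeasurable hWm.aemeasurable).1 h1
  refine (ae_eq_condExp_of_forall_setIntegral_eq hWm.comap_le hUi
    (fun s _ _ => hGi.integrableOn) ?_ ?_).symm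
  -- Over `W ⁻¹' B` both integrals equal `∫ w in B, a w`: one by the density `r` of `W`, the other
  -- by the joint density of `U` and `W`.
  · rintro s ⟨B, hB, rfl⟩ -
    have e1 : ∫ ω in W ⁻¹' B, a (W ω) / r (W ω) ∂P = ∫ w in B, a w := by
      rw [← setIntegral_map (f := fun w => a w / r w) (g := W) hB
        (ham.div hrm).aestronglyMeasurable hWm.aemeasurable,
        hlaw, ← integral_indicator hB,
        integral_withDensity_ofReal hrm (fun w => (hr0 w).le), ← integral_indicator hB]
      congr 1; ext w
      by_cases hw : w ∈ B <;> simp [hw, hmul]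
    have hBi : Integrable (fun ω => (W ⁻¹' B).indicator U ω) P := hUi.indicator (hWm hB)
    have e2 : ∫ ω in W ⁻¹' B, U ω ∂P = ∫ w in B, a w := by
      have hF : Measurable fun z : ℝ × ℝ => (Prod.snd ⁻¹' B).indicator Prod.fst z :=
        measurable_fst.indicator (measurable_snd hB)
      have h := integral_comp_prodMk_add' hU hV hUV hf hg hg0 hVg hF hBi
      rw [← integral_indicator (hWm hB), ← integral_indicator hB]
      refine Eq.trans h ?_
      congr 1; ext w
      by_cases hw : w ∈ B
      · simp [hw, a]
      · simp [hw]
    rw [e1, e2]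
  · have h1 : Measurable[MeasurableSpace.comap W inferInstance] W := comap_measurable W
    exact ((ham.div hrm).comp h1).stronglyMeasurable.aestronglyMeasurable

end Bayes

/-! ### Rescaling a Gaussian input into Gaussian noise. -/

section Scaling

/-- The analytic form of `X + √t Z = √t (Z + X / √t)`: a Gaussian input of variance `v` acts as
noise of variance `v / t` on `Z`. -/
lemma heatKernel_scale {v t : ℝ} (hv : 0 < v) (ht : 0 < t) (y z : ℝ) :
    heatKernel v (y - √t * z) = (√t)⁻¹ * heatKernel (v / t) ((√t)⁻¹ * y - z) := by
  have hpi := Real.pi_pos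
  have hst : 0 < √t := Real.sqrt_pos.2 ht
  have h2 : √t ^ 2 = t := Real.sq_sqrt ht.le
  unfold heatKernel
  have e1 : √(2 * Real.pi * (v / t)) = √(2 * Real.pi * v) / √t := by
    rw [← mul_div_assoc, Real.sqrt_div (by positivity)]
  have e2 : -((√t)⁻¹ * y - z) ^ 2 / (2 * (v / t)) = -(y - √t * z) ^ 2 / (2 * v) := by
    have : y - √t * z = √t * ((√t)⁻¹ * y - z) := by field_simp
    rw [this, mul_pow, h2]
    field_simp
  rw [e1, e2]
  have : √(2 * Real.pi * v) ≠ 0 := by positivity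
  field_simp

lemma heatKernelDeriv_scale {v t : ℝ} (hv : 0 < v) (ht : 0 < t) (y z : ℝ) :
    heatKernelDeriv v (y - √t * z) = t⁻¹ * heatKernelDeriv (v / t) ((√t)⁻¹ * y - z) := by
  have hst : 0 < √t := Real.sqrt_pos.2 ht
  have h2 : √t ^ 2 = t := Real.sq_sqrt ht.le
  unfold heatKernelDeriv
  rw [heatKernel_scale hv ht]
  have : y - √t * z = √t * ((√t)⁻¹ * y - z) := by field_simp
  rw [this]
  field_simp

variable {κ : Measure ℝ} [IsProbabilityMeasure κ] {v t : ℝ} (hv : 0 < v) (ht : 0 < t)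
include hv ht

omit [IsProbabilityMeasure κ] in
lemma heatSmooth_map_mul (y : ℝ) : heatSmooth (κ.map fun z => √t * z) v y =
    (√t)⁻¹ * heatSmooth κ (v / t) ((√t)⁻¹ * y) := by
  have hc := continuous_heatKernel v
  unfold heatSmooth
  rw [integral_map (by fun_prop) (by fun_prop : Measurable _).aestronglyMeasurable,
    ← integral_const_mul]
  simp only [heatKernel_scale hv ht]

omit [IsProbabilityMeasure κ] in
lemma heatSmoothDeriv_map_mul (y : ℝ) : heatSmoothDeriv (κ.map fun z => √t * z) v y =
    t⁻¹ * heatSmoothDeriv κ (v / t) ((√t)⁻¹ * y) := by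
  have hc := continuous_heatKernelDeriv v
  unfold heatSmoothDeriv
  rw [integral_map (by fun_prop) (by fun_prop : Measurable _).aestronglyMeasurable,
    ← integral_const_mul]
  simp only [heatKernelDeriv_scale hv ht]

lemma integral_negMulLog_heatSmooth_map_mul
    (h : Integrable fun y => Real.negMulLog (heatSmooth κ (v / t) y)) :
    ∫ y, Real.negMulLog (heatSmooth (κ.map fun z => √t * z) v y) =
      1 / 2 * Real.log t + ∫ y, Real.negMulLog (heatSmooth κ (v / t) y) := by
  have hst : 0 < √t := Real.sqrt_pos.2 ht
  have hvt : 0 < v / t := div_pos hv ht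
  simp only [heatSmooth_map_mul hv ht]
  have h1 := Measure.integral_comp_mul_left
    (fun y => Real.negMulLog ((√t)⁻¹ * heatSmooth κ (v / t) y)) (√t)⁻¹
  rw [h1, inv_inv, abs_of_pos hst, smul_eq_mul]
  simp only [Real.negMulLog_mul]
  rw [integral_add ((integrable_heatSmooth κ hvt).mul_const _) (h.const_mul _),
    integral_mul_const, integral_const_mul, integral_heatSmooth κ hvt, Real.negMulLog,
    Real.log_inv, Real.log_sqrt ht.le]
  field_simp

lemma integral_fisher_heatSmooth_map_mul :
    ∫ y, heatSmoothDeriv (κ.map fun z => √t * z) v y ^ 2 /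
      heatSmooth (κ.map fun z => √t * z) v y =
      t⁻¹ * ∫ y, heatSmoothDeriv κ (v / t) y ^ 2 / heatSmooth κ (v / t) y := by
  have hst : 0 < √t := Real.sqrt_pos.2 ht
  have h2 : √t ^ 2 = t := Real.sq_sqrt ht.le
  simp only [heatSmooth_map_mul hv ht, heatSmoothDeriv_map_mul hv ht]
  have h1 := Measure.integral_comp_mul_left
    (fun y => (t⁻¹ * heatSmoothDeriv κ (v / t) y) ^ 2 / ((√t)⁻¹ * heatSmooth κ (v / t) y)) (√t)⁻¹
  rw [h1, inv_inv, abs_of_pos hst, smul_eq_mul, ← integral_const_mul, ← integral_const_mul]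
  congr 1; ext y
  have : heatSmooth κ (v / t) y ≠ 0 := (heatSmooth_pos κ (div_pos hv ht) y).ne'
  field_simp
  rw [h2]

end Scaling

/-! ### Tweedie's formula and the dual identity at positive times. -/

/-- Tweedie's formula in unnormalized form. -/
lemma integral_heatKernel_mul_id {κ : Measure ℝ} [IsProbabilityMeasure κ] {s : ℝ} (hs : 0 < s)
    (y : ℝ) : ∫ x, heatKernel s (y - x) * x ∂κ =
      y * heatSmooth κ s y + s * heatSmoothDeriv κ s y := by
  unfold heatSmooth heatSmoothDeriv
  rw [← integral_const_mul, ← integral_const_mul,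
    ← integral_add ((integrable_heatKernel_sub κ hs y).const_mul _)
      ((integrable_heatKernelDeriv_sub κ hs y).const_mul _)]
  congr 1; ext x
  unfold heatKernelDeriv
  field_simp
  ring

lemma heatSmooth_dirac_zero (s y : ℝ) : heatSmooth (Measure.dirac 0) s y = heatKernel s y := by
  simp [heatSmooth]

lemma heatSmoothDeriv_dirac_zero (s y : ℝ) :
    heatSmoothDeriv (Measure.dirac 0) s y = heatKernelDeriv s y := by
  simp [heatSmoothDeriv]

section GaussianInput

variable {Ω : Type*} [MeasurableSpace Ω] {P : Measure Ω} {X Z : Ω → ℝ}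

lemma condVariance_eq_ofReal {Y G : Ω → ℝ}
    (h : P[Z | MeasurableSpace.comap Y inferInstance] =ᵐ[P] G)
    (hi : Integrable (fun ω => (Z ω - G ω) ^ 2) P) :
    condVariance Z Y P = ENNReal.ofReal (∫ ω, (Z ω - G ω) ^ 2 ∂P) := by
  rw [ofReal_integral_eq_lintegral_ofReal hi (ae_of_all _ fun ω => sq_nonneg _)]
  refine lintegral_congr_ae ?_
  filter_upwards [h] with ω hω
  rw [hω]

lemma memLp_two_of_map_eq_gaussian {m : ℝ} {v : ℝ≥0} (hX : Measurable X)
    (hXg : P.map X = gaussianReal m v) : MemLp X 2 P := by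
  have h : MemLp id 2 (P.map X) := by rw [hXg]; exact memLp_id_gaussianReal 2
  exact (memLp_map_measure_iff aestronglyMeasurable_id hX.aemeasurable).1 h

lemma integral_sub_sq_of_map_eq_gaussian {m : ℝ} {v : ℝ≥0} (hX : Measurable X)
    (hXg : P.map X = gaussianReal m v) : ∫ ω, (X ω - m) ^ 2 ∂P = v := by
  have h1 : ∫ x, (x - m) ^ 2 ∂(P.map X) = ∫ ω, (X ω - m) ^ 2 ∂P :=
    integral_map hX.aemeasurable (by fun_prop)
  have h2 := variance_fun_id_gaussianReal (μ := m) (v := v)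
  rw [variance_eq_integral (by fun_prop), integral_id_gaussianReal] at h2
  rw [← h1, hXg, h2]

lemma fisherInfo_of_map_eq_gaussian (hX : Measurable X) {m : ℝ} {v : ℝ≥0} (hv : v ≠ 0)
    (hXg : P.map X = gaussianReal m v) : fisherInfo X P = ENNReal.ofReal (1 / v) := by
  have hv0 : (0 : ℝ) < v := NNReal.coe_pos.2 (pos_iff_ne_zero.2 hv)
  rw [fisherInfo_eq_of_heatSmooth (κ := Measure.dirac 0) (m := m) hX hv0 (by
    simp only [heatSmooth_dirac_zero]
    exact hXg.trans (gaussianReal_eq_withDensity_heatKernel m hv))]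
  congr 1
  simp only [heatSmooth_dirac_zero, heatSmoothDeriv_dirac_zero]
  have e : ∀ y, heatKernelDeriv v y ^ 2 / heatKernel v y =
      (1 / v ^ 2 : ℝ) * (y ^ 2 * heatKernel v y) := fun y => by
    have := (heatKernel_pos hv0 y).ne'
    unfold heatKernelDeriv
    field_simp
  simp only [e]
  rw [integral_const_mul, integral_sq_mul_heatKernel hv0]
  field_simp

lemma integrable_entropyWeight_map_mul (hZ : Measurable Z) (hZi : Integrable Z P) (c : ℝ) :
    Integrable (fun x => Real.log (1 + x ^ 2)) ((P.map Z).map fun z => c * z) := by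
  refine integrable_log_one_add_sq ?_
  rw [Measure.map_map (by fun_prop) hZ]
  refine (integrable_map_measure (by fun_prop : Measurable _).aestronglyMeasurable
    (by fun_prop)).2 ?_
  refine (hZi.const_mul c).abs.mono' (by fun_prop : Measurable _).aestronglyMeasurable
    (ae_of_all _ fun ω => ?_)
  simp only [Function.comp_apply, Real.norm_eq_abs]
  rw [abs_of_nonneg (Real.log_nonneg (by linarith [abs_nonneg (c * Z ω)]))]
  linarith [Real.log_le_sub_one_of_pos (by positivity : 0 < 1 + |c * Z ω|)]

variable [IsProbabilityMeasure P] (hX : Measurable X) (hZ : Measurable Z) (hXZ : IndepFun X Z P)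
  {m : ℝ} {v : ℝ≥0} (hv : v ≠ 0) (hXg : P.map X = gaussianReal m v)

include hX hZ hXZ hv hXg

/-- The law of `X + √t Z` for Gaussian `X`. -/
lemma map_gaussian_add_sqrt_mul (t : ℝ) :
    P.map (fun ω => X ω + √t * Z ω) = volume.withDensity
      fun y => ENNReal.ofReal (heatSmooth ((P.map Z).map fun z => √t * z) v (y - m)) := by
  have h := map_add_gaussian_eq_withDensity (hZ.const_mul √t) hX
    (hXZ.symm.comp (measurable_const_mul √t) measurable_id) hv hXg
  rw [Measure.map_map (by fun_prop) hZ]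
  simp only [add_comm (X _)]
  exact h

lemma diffEntropy_gaussian_add (t : ℝ) : diffEntropy (fun ω => X ω + √t * Z ω) P =
    ∫ y, Real.negMulLog (heatSmooth ((P.map Z).map fun z => √t * z) v y) := by
  have : IsProbabilityMeasure (P.map Z) := Measure.isProbabilityMeasure_map hZ.aemeasurable
  have : IsProbabilityMeasure ((P.map Z).map fun z => √t * z) :=
    Measure.isProbabilityMeasure_map (by fun_prop)
  have hv0 : (0 : ℝ) < v := NNReal.coe_pos.2 (pos_iff_ne_zero.2 hv)
  exact diffEntropy_eq_of_heatSmooth (by fun_prop) hv0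
    (map_gaussian_add_sqrt_mul hX hZ hXZ hv hXg t)

lemma hasFiniteEntropy_gaussian_add (hZi : Integrable Z P) (t : ℝ) :
    HasFiniteEntropy (fun ω => X ω + √t * Z ω) P := by
  have : IsProbabilityMeasure (P.map Z) := Measure.isProbabilityMeasure_map hZ.aemeasurable
  have : IsProbabilityMeasure ((P.map Z).map fun z => √t * z) :=
    Measure.isProbabilityMeasure_map (by fun_prop)
  have hv0 : (0 : ℝ) < v := NNReal.coe_pos.2 (pos_iff_ne_zero.2 hv)
  exact (hasFiniteEntropy_iff_of_heatSmooth (by fun_prop) hv0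
    (map_gaussian_add_sqrt_mul hX hZ hXZ hv hXg t)).2
    (integrable_negMulLog_heatSmooth isEntropyWeight_log
      (integrable_entropyWeight_map_mul hZ hZi _) hv0)

/-- The entropy derivative along a Gaussian input, in terms of the Fisher information of the
output. -/
lemma hasDerivAt_diffEntropy_gaussian_add (hZi : Integrable Z P) {t : ℝ} (ht : 0 < t) :
    HasDerivAt (fun s : ℝ => diffEntropy (fun ω => X ω + √s * Z ω) P)
      (1 / 2 * (1 / v) * ((v - v ^ 2 * ∫ y,
        heatSmoothDeriv ((P.map Z).map fun z => √t * z) v y ^ 2 /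
          heatSmooth ((P.map Z).map fun z => √t * z) v y) / t)) t := by
  have : IsProbabilityMeasure (P.map Z) := Measure.isProbabilityMeasure_map hZ.aemeasurable
  have hv0 : (0 : ℝ) < v := NNReal.coe_pos.2 (pos_iff_ne_zero.2 hv)
  have hvt : 0 < v / t := div_pos hv0 ht
  have hw : Integrable (fun x => Real.log (1 + x ^ 2)) (P.map Z) := by
    simpa using integrable_entropyWeight_map_mul hZ hZi 1
  have hH : ∀ s : ℝ, 0 < s → Integrable fun y => Real.negMulLog (heatSmooth (P.map Z) s y) :=
    fun s hs => integrable_negMulLog_heatSmooth isEntropyWeight_log hw hs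
  have h1 := hasDerivAt_integral_negMulLog_heatSmooth (P.map Z) hvt (lt_add_one _)
    (hH _ (by linarith))
  have h2 : HasDerivAt (fun s : ℝ => v / s) (-(v / t ^ 2)) t := by
    have := (hasDerivAt_inv ht.ne').const_mul (v : ℝ)
    convert! this using 1
    field_simp
  -- The entropy is `(1 / 2) log t` plus the entropy of `Z` smoothed for time `v / t`, which runs
  -- backwards with speed `v / t²`.
  have h3 := ((Real.hasDerivAt_log ht.ne').const_mul (1 / 2)).add (h1.comp t h2)
  refine (h3.congr_of_eventuallyEq ?_).congr_deriv ?_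
  · filter_upwards [eventually_gt_nhds ht] with s hs
    rw [diffEntropy_gaussian_add hX hZ hXZ hv hXg,
      integral_negMulLog_heatSmooth_map_mul hv0 hs (hH _ (div_pos hv0 hs))]
    rfl
  · rw [integral_fisher_heatSmooth_map_mul hv0 ht]
    field_simp
    ring

/-- The conditional expectation of `Z` given `X + √t Z` by Bayes' formula. -/
lemma condExp_gaussian_add (hZi : Integrable Z P) (t : ℝ) :
    P[Z | MeasurableSpace.comap (fun ω => X ω + √t * Z ω) inferInstance] =ᵐ[P]
      fun ω => (fun w => (∫ x, heatKernel v (w - √t * x - m) * x ∂(P.map Z)) /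
        ∫ x, heatKernel v (w - √t * x - m) ∂(P.map Z)) (√t * Z ω + X ω) := by
  have hv0 : (0 : ℝ) < v := NNReal.coe_pos.2 (pos_iff_ne_zero.2 hv)
  have hk := (continuous_heatKernel v).measurable
  have h := condExp_ae_eq_bayes hZ hX hXZ.symm (f := fun z => √t * z)
    (g := fun x => heatKernel v (x - m)) (by fun_prop) (by fun_prop)
    (fun x => heatKernel_nonneg _ _) (hXg.trans (gaussianReal_eq_withDensity_heatKernel m hv))
    (fun x => heatKernel_pos hv0 _) (fun x => heatKernel_le _ hv0 _) hZi
  simp only [add_comm (X _)]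
  exact h

/-- The conditional variance of `Z` given `X + √t Z`, in terms of the Fisher information of the
output. -/
lemma condVariance_gaussian_add (hZi : Integrable Z P) {t : ℝ} (ht : 0 < t) :
    0 ≤ (v - v ^ 2 * ∫ y, heatSmoothDeriv ((P.map Z).map fun z => √t * z) v y ^ 2 /
        heatSmooth ((P.map Z).map fun z => √t * z) v y) / t ∧
    condVariance Z (fun ω => X ω + √t * Z ω) P = ENNReal.ofReal
      ((v - v ^ 2 * ∫ y, heatSmoothDeriv ((P.map Z).map fun z => √t * z) v y ^ 2 /
        heatSmooth ((P.map Z).map fun z => √t * z) v y) / t) := by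
  have hκ : IsProbabilityMeasure (P.map Z) := Measure.isProbabilityMeasure_map hZ.aemeasurable
  have hκt : IsProbabilityMeasure ((P.map Z).map fun z => √t * z) :=
    Measure.isProbabilityMeasure_map (by fun_prop)
  have hv0 : (0 : ℝ) < v := NNReal.coe_pos.2 (pos_iff_ne_zero.2 hv)
  have hst : 0 < √t := Real.sqrt_pos.2 ht
  have hk := (continuous_heatKernel v).measurable
  have hk1 := (continuous_heatKernelDeriv v).measurable
  set κ := P.map Z
  set κt := κ.map fun z => √t * z
  set J := ∫ y, heatSmoothDeriv κt v y ^ 2 / heatSmooth κt v y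
  set S : ℝ → ℝ := fun w => heatSmoothDeriv κt v (w - m) / heatSmooth κt v (w - m)
  have hrpos := fun y => heatSmooth_pos κt hv0 y
  have hcr := (continuous_heatSmooth κt hv0).measurable
  have hcd := (continuous_heatSmoothDeriv κt hv0).measurable
  have hSm : Measurable S := by fun_prop
  set W : Ω → ℝ := fun ω => √t * Z ω + X ω
  have hWm : Measurable W := by fun_prop
  have hWlaw : P.map W = volume.withDensity
      fun y => ENNReal.ofReal (heatSmooth κt v (y - m)) := by
    have h := map_gaussian_add_sqrt_mul hX hZ hXZ hv hXg t
    simp only [add_comm (X _)] at h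
    exact h
  have hmap : ∀ (f : ℝ → ℝ), Measurable f → ∀ y : ℝ,
      ∫ x, f (y - √t * x) ∂κ = ∫ z, f (y - z) ∂κt := fun f hf y =>
    (integral_map (by fun_prop) (by fun_prop : Measurable
      fun z => f (y - z)).aestronglyMeasurable).symm
  -- As `√t Z = W - X`, the error in estimating `Z` is, up to sign and the factor `√t`, the error in
  -- estimating `X`. Tweedie's formula gives the estimate `m - v S(W)` of `X`, with `S` the score of
  -- `W`.
  have hG : ∀ ω, Z ω - (fun w => (∫ x, heatKernel v (w - √t * x - m) * x ∂κ) /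
      ∫ x, heatKernel v (w - √t * x - m) ∂κ) (√t * Z ω + X ω) =
      -(X ω - m + v * S (W ω)) / √t := fun ω => by
    have e1 : ∀ w, ∫ x, heatKernel v (w - √t * x - m) ∂κ = heatSmooth κt v (w - m) := fun w => by
      simp only [sub_right_comm w _ m]
      exact hmap _ hk _
    have e2 : ∀ w, √t * ∫ x, heatKernel v (w - √t * x - m) * x ∂κ =
        (w - m) * heatSmooth κt v (w - m) + v * heatSmoothDeriv κt v (w - m) := fun w => by
      have h := integral_map (μ := κ) (φ := fun z => √t * z) (by fun_prop)
        (by fun_prop : Measurable fun z => heatKernel v (w - m - z) * z).aestronglyMeasurable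
      rw [← integral_heatKernel_mul_id hv0, ← integral_const_mul, h]
      refine integral_congr_ae (ae_of_all _ fun x => ?_)
      dsimp only
      rw [sub_right_comm w _ m]; ring
    have e3 : ∀ w, (∫ x, heatKernel v (w - √t * x - m) * x ∂κ) /
        ∫ x, heatKernel v (w - √t * x - m) ∂κ = (w - m + v * S w) / √t := fun w => by
      have h1 := e2 w
      have h2 := (hrpos (w - m)).ne'
      rw [e1, div_eq_div_iff h2 hst.ne', mul_comm, h1]
      simp only [S]
      field_simp
    simp only [e3]
    simp only [W]
    field_simp
    ring
  have hXL : MemLp (fun ω => X ω - m) 2 P :=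
    (memLp_two_of_map_eq_gaussian hX hXg).sub (memLp_const m)
  have hrS : ∀ w, heatSmooth κt v (w - m) * S w ^ 2 =
      heatSmoothDeriv κt v (w - m) ^ 2 / heatSmooth κt v (w - m) := fun w => by
    have := (hrpos (w - m)).ne'
    simp only [S]
    field_simp
  have hJi := (integrable_sq_heatSmoothDeriv_div κt hv0).comp_sub_right m
  have eJ : ∫ w, heatSmoothDeriv κt v (w - m) ^ 2 / heatSmooth κt v (w - m) = J :=
    integral_sub_right_eq_self (fun y => heatSmoothDeriv κt v y ^ 2 / heatSmooth κt v y) m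
  have hS2 : Integrable (fun ω => S (W ω) ^ 2) P := by
    have h1 : Integrable (fun w => S w ^ 2) (P.map W) := by
      rw [hWlaw, integrable_withDensity_ofReal_iff (by fun_prop) fun w => (hrpos _).le]
      simpa only [hrS] using hJi
    exact (integrable_map_measure (hSm.pow_const 2).aestronglyMeasurable hWm.aemeasurable).1 h1
  have eS2 : ∫ ω, S (W ω) ^ 2 ∂P = J := by
    have h1 := integral_map (μ := P) (f := fun w => S w ^ 2) hWm.aemeasurable
      (hSm.pow_const 2).aestronglyMeasurable
    rw [← h1, hWlaw, integral_withDensity_ofReal (by fun_prop) fun w => (hrpos _).le]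
    simp only [hrS, eJ]
  have hSL : MemLp (fun ω => S (W ω)) 2 P :=
    (memLp_two_iff_integrable_sq (hSm.comp hWm).aestronglyMeasurable).2 hS2
  have hXS : Integrable (fun ω => (X ω - m) * S (W ω)) P := hXL.integrable_mul hSL
  -- Given `W`, the mean of `X - m` is `-v S(W)`, so the cross term is `-v E S²`. Expanding the
  -- square of `X - m + v S(W)` then leaves `v - 2 v² J + v² J`.
  have eXS : ∫ ω, (X ω - m) * S (W ω) ∂P = -(v * J) := by
    have h := integral_comp_prodMk_add' hZ hX hXZ.symm (f := fun z => √t * z)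
      (g := fun x => heatKernel v (x - m)) (by fun_prop) (by fun_prop)
      (fun x => heatKernel_nonneg _ _) (hXg.trans (gaussianReal_eq_withDensity_heatKernel m hv))
      (F := fun z => (z.2 - √t * z.1 - m) * S z.2) (by fun_prop)
      (by simpa only [add_sub_cancel_left] using hXS)
    simp only [add_sub_cancel_left] at h
    rw [h, ← eJ, ← integral_const_mul, ← integral_neg]
    congr 1; ext w
    have e4 : ∫ x, heatKernelDeriv v (w - m - √t * x) ∂κ = heatSmoothDeriv κt v (w - m) :=
      hmap _ hk1 _
    have e5 : ∀ x, heatKernel v (w - √t * x - m) * ((w - √t * x - m) * S w) =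
        -(v * S w) * heatKernelDeriv v (w - m - √t * x) := fun x => by
      rw [sub_right_comm w _ m]
      unfold heatKernelDeriv
      field_simp
    simp only [e5]
    rw [integral_const_mul, e4]
    simp only [S]
    ring
  have hX2 : Integrable (fun ω => (X ω - m) ^ 2) P := hXL.integrable_sq
  have eR : ∀ ω, (-(X ω - m + v * S (W ω)) / √t) ^ 2 = t⁻¹ * ((X ω - m) ^ 2 +
      2 * v * ((X ω - m) * S (W ω)) + v ^ 2 * S (W ω) ^ 2) := fun ω => by
    rw [div_pow, Real.sq_sqrt ht.le]
    field_simp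
    ring
  have i1 := hX2.add (hXS.const_mul (2 * v : ℝ))
  have i2 := i1.add (hS2.const_mul (v ^ 2 : ℝ))
  have hint : ∫ ω, (-(X ω - m + v * S (W ω)) / √t) ^ 2 ∂P = (v - v ^ 2 * J) / t := by
    simp only [eR]
    have e1 := integral_add i1 (hS2.const_mul (v ^ 2 : ℝ))
    have e2 := integral_add hX2 (hXS.const_mul (2 * v : ℝ))
    simp only [Pi.add_apply] at e1
    rw [integral_const_mul, e1, e2, integral_const_mul, integral_const_mul, eXS, eS2,
      integral_sub_sq_of_map_eq_gaussian hX hXg]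
    field_simp
    ring
  refine ⟨by rw [← hint]; exact integral_nonneg fun ω => sq_nonneg _, ?_⟩
  refine (condVariance_eq_ofReal (condExp_gaussian_add hX hZ hXZ hv hXg hZi t) ?_).trans ?_
  · refine (integrable_congr (ae_of_all _ fun ω => congrArg (· ^ 2) (hG ω))).2 ?_
    simp only [eR]
    exact i2.const_mul _
  · exact congrArg ENNReal.ofReal
      ((integral_congr_ae (ae_of_all _ fun ω => congrArg (· ^ 2) (hG ω))).trans hint)

end GaussianInput

/-! ### Entropy bounds from a second moment. -/

section SecondMoment

variable {κ : Measure ℝ} [IsProbabilityMeasure κ] {v : ℝ}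

/-- From `w² = x² + 2 x (w - x) + (w - x)²`, where the middle term integrates to zero because the
noise is centred. -/
lemma integral_sq_mul_heatSmooth (hv : 0 < v) (hκ : MemLp id 2 κ) :
    (Integrable fun w => w ^ 2 * heatSmooth κ v w) ∧
      ∫ w, w ^ 2 * heatSmooth κ v w = v + ∫ x, x ^ 2 ∂κ := by
  have h1 : Integrable (fun x : ℝ => x) κ := hκ.integrable one_le_two
  have h2 : Integrable (fun x : ℝ => x ^ 2) κ := hκ.integrable_sq
  have j1 := integrable_mul_comp_sub h2 (integrable_heatKernel hv)
  have j2 := integrable_mul_comp_sub (h1.const_mul 2) (integrable_id_mul_heatKernel hv)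
  have j3 := integrable_mul_comp_sub (integrable_const (1 : ℝ)) (integrable_sq_mul_heatKernel hv)
    (κ := κ)
  have e1 := integral_integral_mul_comp_sub h2 (integrable_heatKernel hv)
  have e2 := integral_integral_mul_comp_sub (h1.const_mul 2) (integrable_id_mul_heatKernel hv)
  have e3 := integral_integral_mul_comp_sub (integrable_const (1 : ℝ))
    (integrable_sq_mul_heatKernel hv) (κ := κ)
  have key : (fun w => w ^ 2 * heatSmooth κ v w) =ᵐ[volume] fun w =>
      (∫ x, x ^ 2 * heatKernel v (w - x) ∂κ) +
        (∫ x, 2 * x * ((w - x) * heatKernel v (w - x)) ∂κ) +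
        ∫ x, 1 * ((w - x) ^ 2 * heatKernel v (w - x)) ∂κ := by
    filter_upwards [j1.prod_left_ae, j2.prod_left_ae, j3.prod_left_ae] with w i1 i2 i3
    have a1 := integral_add i1 i2
    have a2 := integral_add (i1.add i2) i3
    simp only [Pi.add_apply] at a2
    rw [← a1, ← a2, heatSmooth, ← integral_const_mul]
    refine integral_congr_ae (ae_of_all _ fun x => ?_)
    dsimp only
    ring
  have k1 := j1.integral_prod_right
  have k2 := j2.integral_prod_right
  have k3 := j3.integral_prod_right
  refine ⟨((k1.add k2).add k3).congr key.symm, ?_⟩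
  have a1 := integral_add k1 k2
  have a2 := integral_add (k1.add k2) k3
  simp only [Pi.add_apply] at a2
  rw [integral_congr_ae key, a2, a1, e1, e2, e3, integral_heatKernel hv,
    integral_id_mul_heatKernel hv, integral_sq_mul_heatKernel hv]
  simp
  ring

/-- This quadratic weight gives equality in Gibbs' inequality for the Gaussian itself, which makes
the resulting upper bound sharp as the second moment of `κ` tends to zero. -/
lemma exp_neg_gaussian_weight (hv : 0 < v) (w : ℝ) :
    Real.exp (-(Real.log √(2 * Real.pi * v) + (2 * v)⁻¹ * w ^ 2)) = heatKernel v w := by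
  have hpi := Real.pi_pos
  rw [neg_add, Real.exp_add, Real.exp_neg, Real.exp_log (by positivity), heatKernel]
  congr 2
  field_simp

lemma integral_mul_gaussian_weight (hv : 0 < v) (hκ : MemLp id 2 κ) :
    (Integrable fun w =>
      heatSmooth κ v w * (Real.log √(2 * Real.pi * v) + (2 * v)⁻¹ * w ^ 2)) ∧
    ∫ w, heatSmooth κ v w * (Real.log √(2 * Real.pi * v) + (2 * v)⁻¹ * w ^ 2) =
      Real.log √(2 * Real.pi * v) + (2 * v)⁻¹ * (v + ∫ x, x ^ 2 ∂κ) := by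
  obtain ⟨h1, h2⟩ := integral_sq_mul_heatSmooth hv hκ
  have i1 := (integrable_heatSmooth κ hv).mul_const (Real.log √(2 * Real.pi * v))
  have i2 := h1.const_mul (2 * v)⁻¹
  have e : ∀ w, heatSmooth κ v w * (Real.log √(2 * Real.pi * v) + (2 * v)⁻¹ * w ^ 2) =
      heatSmooth κ v w * Real.log √(2 * Real.pi * v) + (2 * v)⁻¹ * (w ^ 2 * heatSmooth κ v w) :=
    fun w => by ring
  simp only [e]
  refine ⟨i1.add i2, ?_⟩
  rw [integral_add i1 i2, integral_mul_const, integral_const_mul, h2, integral_heatSmooth κ hv,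
    one_mul]

lemma integral_negMulLog_heatKernel (hv : 0 < v) :
    (Integrable fun w => Real.negMulLog (heatKernel v w)) ∧
    ∫ w, Real.negMulLog (heatKernel v w) = Real.log √(2 * Real.pi * v) + (2 * v)⁻¹ * v := by
  have hd : MemLp id 2 (Measure.dirac (0 : ℝ)) :=
    (memLp_two_iff_integrable_sq aestronglyMeasurable_id).2
      (integrable_dirac (by simp [enorm]))
  obtain ⟨h1, h2⟩ := integral_mul_gaussian_weight hv hd
  simp only [heatSmooth_dirac_zero] at h1 h2
  have e : ∀ w, Real.negMulLog (heatKernel v w) =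
      heatKernel v w * (Real.log √(2 * Real.pi * v) + (2 * v)⁻¹ * w ^ 2) := fun w => by
    conv_lhs => rw [Real.negMulLog, ← exp_neg_gaussian_weight hv, Real.log_exp]
    rw [exp_neg_gaussian_weight hv]
    ring
  simp only [e]
  refine ⟨h1, h2.trans ?_⟩
  simp

/-- The entropy of a smoothed distribution lies between that of the Gaussian and a bound linear in
the second moment. -/
lemma integral_negMulLog_heatSmooth_bounds (hv : 0 < v) (hκ : MemLp id 2 κ)
    (hh : Integrable fun w => Real.negMulLog (heatSmooth κ v w)) :
    ∫ w, Real.negMulLog (heatKernel v w) ≤ ∫ w, Real.negMulLog (heatSmooth κ v w) ∧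
    ∫ w, Real.negMulLog (heatSmooth κ v w) ≤
      (∫ w, Real.negMulLog (heatKernel v w)) + (2 * v)⁻¹ * ∫ x, x ^ 2 ∂κ := by
  obtain ⟨g1, g2⟩ := integral_negMulLog_heatKernel hv
  obtain ⟨h1, h2⟩ := integral_mul_gaussian_weight hv hκ
  refine ⟨integral_negMulLog_le_of_conv (heatKernel_nonneg v) (heatKernel_le v hv)
    (continuous_heatKernel v) g1 hh, ?_⟩
  have i1 := h1.add (integrable_heatKernel hv)
  have i2 := i1.sub (integrable_heatSmooth κ hv)
  have e1 := integral_add h1 (integrable_heatKernel hv)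
  have e2 := integral_sub i1 (integrable_heatSmooth κ hv)
  simp only [Pi.add_apply] at e2
  rw [e1, h2, integral_heatKernel hv, integral_heatSmooth κ hv] at e2
  have h3 := integral_mono hh i2 fun w => by
    have := negMulLog_le_mul_add_exp (heatSmooth_nonneg κ v w)
      (Real.log √(2 * Real.pi * v) + (2 * v)⁻¹ * w ^ 2)
    rw [exp_neg_gaussian_weight hv] at this
    exact this
  refine h3.trans (le_of_eq ?_)
  refine e2.trans ?_
  rw [g2]; ring

end SecondMoment

/-! ### Conditional variance against variance. -/

section ConditionalVariance

variable {Ω : Type*} [MeasurableSpace Ω] {P : Measure Ω} [IsProbabilityMeasure P] {Y Z : Ω → ℝ}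

omit [IsProbabilityMeasure P] in
lemma integrable_sq_sub_condExp (hZ : MemLp Z 2 P) :
    Integrable (fun ω => (Z ω - (P[Z | MeasurableSpace.comap Y inferInstance]) ω) ^ 2) P :=
  (hZ.sub (MemLp.condExp one_le_two hZ)).integrable_sq

/-- The law of total variance; it is the upper bound that complements Fatou as the signal vanishes.
-/
lemma integral_sq_sub_condExp_le_variance (hY : Measurable Y) (hZ : MemLp Z 2 P) :
    ∫ ω, (Z ω - (P[Z | MeasurableSpace.comap Y inferInstance]) ω) ^ 2 ∂P ≤ Var[Z; P] := by
  have h := integral_condVar_add_variance_condExp hY.comap_le hZ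
  have h2 : P[Var[Z; P | MeasurableSpace.comap Y inferInstance]] =
      ∫ ω, (Z ω - (P[Z | MeasurableSpace.comap Y inferInstance]) ω) ^ 2 ∂P := by
    unfold condVar
    rw [integral_condExp hY.comap_le]
    rfl
  rw [← h, h2]
  exact le_add_of_nonneg_right (variance_nonneg _ _)

/-- For independent variables a finite conditional variance means a finite variance. -/
lemma condVariance_of_indepFun (hY : Measurable Y) (hZ : Measurable Z) (h : IndepFun Y Z P)
    (hfin : condVariance Z Y P ≠ ∞) :
    MemLp Z 2 P ∧ (condVariance Z Y P).toReal = Var[Z; P] := by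
  have hce : P[Z | MeasurableSpace.comap Y inferInstance] =ᵐ[P] fun _ => ∫ ω, Z ω ∂P :=
    condExp_indep_eq hZ.comap_le hY.comap_le (comap_measurable Z).stronglyMeasurable
      ((IndepFun_iff_Indep _ _ _).1 h.symm)
  have e : condVariance Z Y P = ∫⁻ ω, ENNReal.ofReal ((Z ω - ∫ ω, Z ω ∂P) ^ 2) ∂P := by
    refine lintegral_congr_ae ?_
    filter_upwards [hce] with ω hω
    rw [hω]
  have hi : Integrable (fun ω => (Z ω - ∫ ω, Z ω ∂P) ^ 2) P := by
    rw [← lintegral_ofReal_ne_top_iff_integrable (by fun_prop : Measurable _).aestronglyMeasurable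
      (ae_of_all _ fun ω => sq_nonneg _), ← e]
    exact hfin
  have hL : MemLp (fun ω => Z ω - ∫ ω, Z ω ∂P) 2 P :=
    (memLp_two_iff_integrable_sq (by fun_prop)).2 hi
  refine ⟨?_, ?_⟩
  · have := hL.add (memLp_const (∫ ω, Z ω ∂P))
    refine this.ae_eq (ae_of_all _ fun ω => ?_)
    simp
  · rw [e, ← ofReal_integral_eq_lintegral_ofReal hi (ae_of_all _ fun ω => sq_nonneg _),
      ENNReal.toReal_ofReal (integral_nonneg fun ω => sq_nonneg _),
      variance_eq_integral hZ.aemeasurable]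

end ConditionalVariance

/-! ### The dual identity at time zero. -/

section Limit

variable {Ω : Type*} [MeasurableSpace Ω] {P : Measure Ω} [IsProbabilityMeasure P] {X Z : Ω → ℝ}
  (hX : Measurable X) (hZ : Measurable Z) (hXZ : IndepFun X Z P)
  {m : ℝ} {v : ℝ≥0} (hv : v ≠ 0) (hXg : P.map X = gaussianReal m v)

omit [IsProbabilityMeasure P] in
lemma tendsto_sqrt_nhdsGT : Tendsto (fun t => √t) (𝓝[>] (0 : ℝ)) (𝓝 0) := by
  have := (Real.continuous_sqrt.tendsto 0).mono_left (nhdsWithin_le_nhds (s := Set.Ioi 0))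
  simpa using this

include hX hZ hXZ hv hXg

/-- The conditional variance tends to the variance as the signal strength vanishes. -/
lemma tendsto_condVariance_gaussian_add (hZ2 : MemLp Z 2 P) :
    Tendsto (fun t : ℝ => (condVariance Z (fun ω => X ω + √t * Z ω) P).toReal) (𝓝[>] 0)
      (𝓝 Var[Z; P]) := by
  have hκ : IsProbabilityMeasure (P.map Z) := Measure.isProbabilityMeasure_map hZ.aemeasurable
  have hv0 : (0 : ℝ) < v := NNReal.coe_pos.2 (pos_iff_ne_zero.2 hv)
  have hZi : Integrable Z P := hZ2.integrable one_le_two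
  set κ := P.map Z with hκdef
  have hκ2 : MemLp id 2 κ := (memLp_map_measure_iff aestronglyMeasurable_id hZ.aemeasurable).2 hZ2
  have hκi : Integrable (fun x : ℝ => x) κ := hκ2.integrable one_le_two
  have hκsq : Integrable (fun x : ℝ => x ^ 2) κ := hκ2.integrable_sq
  set g : ℝ → ℝ := fun u => heatKernel v (u - m)
  have hgc : Continuous g := by have := continuous_heatKernel v; fun_prop
  have hgm := hgc.measurable
  have hg0 : ∀ x, 0 ≤ g x := fun x => heatKernel_nonneg _ _
  have hgpos : ∀ x, 0 < g x := fun x => heatKernel_pos hv0 _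
  set C := (√(2 * Real.pi * v))⁻¹
  have hgC : ∀ x, g x ≤ C := fun x => heatKernel_le _ hv0 _
  have hgi : Integrable g := (integrable_heatKernel hv0).comp_sub_right m
  have hg1 : ∫ u, g u = 1 :=
    (integral_sub_right_eq_self (heatKernel v) m).trans (integral_heatKernel hv0)
  have hXlaw : P.map X = volume.withDensity fun x => ENNReal.ofReal (g x) :=
    hXg.trans (gaussianReal_eq_withDensity_heatKernel m hv)
  -- Unnormalised posterior moments of `Z` given the observation `w` at amplitude `c`. Below, `G` is
  -- the posterior mean and `F` the posterior variance times the density of the observation.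
  set M : (ℝ → ℝ) → ℝ → ℝ → ℝ := fun h c w => ∫ x, g (w - c * x) * h x ∂κ
  have hbd : ∀ (h : ℝ → ℝ) (c w x : ℝ), ‖g (w - c * x) * h x‖ ≤ C * |h x| := fun h c w x => by
    rw [norm_mul, Real.norm_eq_abs, Real.norm_eq_abs, abs_of_nonneg (hg0 _)]
    exact mul_le_mul_of_nonneg_right (hgC _) (abs_nonneg _)
  have hMi : ∀ h : ℝ → ℝ, Measurable h → Integrable h κ → ∀ c w,
      Integrable (fun x => g (w - c * x) * h x) κ := fun h hm hi c w =>
    (hi.abs.const_mul C).mono' (by fun_prop : Measurable _).aestronglyMeasurable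
      (ae_of_all _ fun x => hbd h c w x)
  have hMlim : ∀ h : ℝ → ℝ, Measurable h → Integrable h κ → ∀ w,
      Tendsto (fun t => M h √t w) (𝓝[>] 0) (𝓝 (g w * ∫ x, h x ∂κ)) := fun h hm hi w => by
    have hc : Continuous fun c => M h c w := continuous_of_dominated
      (fun c => (hMi h hm hi c w).aestronglyMeasurable) (fun c => ae_of_all _ (hbd h c w))
      (hi.abs.const_mul C) (ae_of_all _ fun x => by fun_prop)
    have := (hc.tendsto 0).comp tendsto_sqrt_nhdsGT
    have e : M h 0 w = g w * ∫ x, h x ∂κ := by simp [M, integral_const_mul]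
    rwa [e] at this
  set G : ℝ → ℝ → ℝ := fun t w => M (fun x => x) √t w / M (fun _ => 1) √t w
  set F : ℝ → ℝ → ℝ := fun t w => ∫ x, g (w - √t * x) * (x - G t w) ^ 2 ∂κ
  have hM1pos : ∀ t w, 0 < M (fun _ => 1) √t w := fun t w => by
    simp only [M, mul_one]
    have hi := hMi (fun _ => 1) measurable_const (integrable_const _) √t w
    simp only [mul_one] at hi
    rw [integral_pos_iff_support_of_nonneg (fun x => hg0 _) hi]
    have : Function.support (fun x => g (w - √t * x)) = Set.univ := by
      ext x; simp [(hgpos (w - √t * x)).ne']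
    simp [this]
  have hFeq : ∀ t w, F t w =
      M (fun x => x ^ 2) √t w - M (fun x => x) √t w ^ 2 / M (fun _ => 1) √t w := fun t w => by
    have i0 := (hMi (fun _ => 1) measurable_const (integrable_const _) √t w).const_mul (G t w ^ 2)
    have i1 := (hMi (fun x => x) measurable_id hκi √t w).const_mul (2 * G t w)
    have i2 := hMi (fun x => x ^ 2) (by fun_prop) hκsq √t w
    have e1 := integral_sub i2 i1
    have e2 := integral_add (i2.sub i1) i0
    simp only [Pi.sub_apply] at e2
    rw [e1, integral_const_mul, integral_const_mul] at e2
    calc F t w = _ := by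
          refine Eq.trans ?_ e2
          refine integral_congr_ae (ae_of_all _ fun x => ?_)
          dsimp only
          ring
      _ = _ := by
          change M (fun x => x ^ 2) √t w - 2 * G t w * M (fun x => x) √t w +
            G t w ^ 2 * M (fun _ => 1) √t w = _
          have := (hM1pos t w).ne'
          simp only [G]
          field_simp
          ring
  have hGm : ∀ t, Measurable (G t) := fun t => by
    have hm : ∀ h : ℝ → ℝ, Measurable h → Measurable (M h √t) := fun h hh => by
      have : StronglyMeasurable (Function.uncurry fun w x => g (w - √t * x) * h x) :=
        (by fun_prop : Measurable fun z : ℝ × ℝ => g (z.1 - √t * z.2) * h z.2).stronglyMeasurable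
      exact this.integral_prod_right.measurable
    exact (hm _ measurable_id).div (hm _ measurable_const)
  set V : ℝ → ℝ := fun t => ∫ w, F t w
  have hce : ∀ t, P[Z | MeasurableSpace.comap (fun ω => X ω + √t * Z ω) inferInstance] =ᵐ[P]
      fun ω => G t (√t * Z ω + X ω) := fun t => by
    have h := condExp_gaussian_add hX hZ hXZ hv hXg hZi t
    refine h.trans (ae_of_all _ fun ω => ?_)
    simp only [G, M, g, mul_one]
    rfl
  have hsq : ∀ t, Integrable (fun ω => (Z ω - G t (√t * Z ω + X ω)) ^ 2) P := fun t => by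
    refine (integrable_sq_sub_condExp (Y := fun ω => X ω + √t * Z ω) hZ2).congr ?_
    filter_upwards [hce t] with ω hω
    rw [hω]
  have hFm : ∀ t, Measurable fun z : ℝ × ℝ => (z.1 - G t z.2) ^ 2 := fun t => by
    have := hGm t
    fun_prop
  have hVeq : ∀ t, ∫ ω, (Z ω - G t (√t * Z ω + X ω)) ^ 2 ∂P = V t := fun t =>
    integral_comp_prodMk_add' hZ hX hXZ.symm (f := fun z => √t * z) (g := g) (by fun_prop) hgm hg0
      hXlaw (F := fun z => (z.1 - G t z.2) ^ 2) (hFm t) (hsq t)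
  have hFi : ∀ t, Integrable (F t) := fun t =>
    ((integrable_comp_prodMk_add_iff hZ hX hXZ.symm (f := fun z => √t * z) (g := g) (by fun_prop)
      hgm hg0 hXlaw (F := fun z => (z.1 - G t z.2) ^ 2) (hFm t)).1 (hsq t)).integral_prod_right
  have hVle : ∀ t, V t ≤ Var[Z; P] := fun t => by
    rw [← hVeq t]
    refine le_trans (le_of_eq ?_) (integral_sq_sub_condExp_le_variance
      (Y := fun ω => X ω + √t * Z ω) (by fun_prop) hZ2)
    refine integral_congr_ae ?_
    filter_upwards [hce t] with ω hω
    rw [hω]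
  have hvar : ∫ w, (g w * (∫ x, x ^ 2 ∂κ) - (g w * ∫ x, x ∂κ) ^ 2 / (g w * ∫ _x, (1 : ℝ) ∂κ)) =
      Var[Z; P] := by
    have e : ∀ w, g w * (∫ x, x ^ 2 ∂κ) - (g w * ∫ x, x ∂κ) ^ 2 / (g w * ∫ _x, (1 : ℝ) ∂κ) =
        g w * ((∫ x, x ^ 2 ∂κ) - (∫ x, x ∂κ) ^ 2) := fun w => by
      have := (hgpos w).ne'
      simp only [integral_const, probReal_univ, smul_eq_mul, mul_one]
      field_simp
    simp only [e]
    rw [integral_mul_const, hg1, one_mul, variance_eq_sub hZ2, hκdef,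
      integral_map hZ.aemeasurable (by fun_prop), integral_map hZ.aemeasurable (by fun_prop)]
    rfl
  -- The integrands converge pointwise to `g w` times the variance, whose integral is the constant
  -- upper bound `Var[Z; P]`.
  have hlim := tendsto_integral_of_nonneg_of_le (μ := volume) (l := 𝓝[>] (0 : ℝ)) (f := F)
    (g := fun w => g w * (∫ x, x ^ 2 ∂κ) - (g w * ∫ x, x ∂κ) ^ 2 / (g w * ∫ _x, (1 : ℝ) ∂κ))
    (u := fun _ => Var[Z; P])
    (.of_forall fun t => ⟨hFi t, fun w => integral_nonneg fun x =>
      mul_nonneg (hg0 _) (sq_nonneg _)⟩)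
    (by
      refine (hgi.mul_const ((∫ x, x ^ 2 ∂κ) - (∫ x, x ∂κ) ^ 2)).congr (ae_of_all _ fun w => ?_)
      have := (hgpos w).ne'
      simp only [integral_const, probReal_univ, smul_eq_mul, mul_one]
      field_simp)
    (ae_of_all _ fun w => by
      simp only [hFeq]
      refine (hMlim _ (by fun_prop) hκsq w).sub (((hMlim _ measurable_id hκi w).pow 2).div
        (hMlim _ measurable_const (integrable_const _) w) ?_)
      simpa using (hgpos w).ne')
    (by rw [hvar]; exact tendsto_const_nhds)
    (.of_forall hVle)
  rw [hvar] at hlim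
  refine hlim.congr fun t => ?_
  rw [condVariance_eq_ofReal (hce t) (hsq t), hVeq t, ENNReal.toReal_ofReal]
  rw [← hVeq t]
  exact integral_nonneg fun ω => sq_nonneg _

/-- A squeeze: the entropy exceeds that of `X` by an amount between zero and `t E Z² / (2 v)`. -/
lemma continuousWithinAt_diffEntropy_gaussian_add (hZ2 : MemLp Z 2 P) :
    ContinuousWithinAt (fun t : ℝ => diffEntropy (fun ω => X ω + √t * Z ω) P) (Set.Ioi 0) 0 := by
  have hv0 : (0 : ℝ) < v := NNReal.coe_pos.2 (pos_iff_ne_zero.2 hv)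
  have hZi : Integrable Z P := hZ2.integrable one_le_two
  have hκ : IsProbabilityMeasure (P.map Z) := Measure.isProbabilityMeasure_map hZ.aemeasurable
  have hκt : ∀ t : ℝ, IsProbabilityMeasure ((P.map Z).map fun z => √t * z) := fun t =>
    Measure.isProbabilityMeasure_map (by fun_prop)
  have h2 : ∀ t : ℝ, MemLp id 2 ((P.map Z).map fun z => √t * z) := fun t => by
    rw [Measure.map_map (by fun_prop) hZ]
    exact (memLp_map_measure_iff aestronglyMeasurable_id (by fun_prop)).2 (hZ2.const_mul √t)
  have hb := fun t : ℝ => integral_negMulLog_heatSmooth_bounds hv0 (h2 t)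
    (integrable_negMulLog_heatSmooth isEntropyWeight_log
      (integrable_entropyWeight_map_mul hZ hZi √t) hv0)
  have e0 : diffEntropy (fun ω => X ω + √0 * Z ω) P = ∫ w, Real.negMulLog (heatKernel v w) := by
    rw [diffEntropy_gaussian_add hX hZ hXZ hv hXg]
    simp [Measure.map_const, heatSmooth_dirac_zero]
  have hsq : ∀ t : ℝ, ∫ x, x ^ 2 ∂((P.map Z).map fun z => √t * z) =
      √t ^ 2 * ∫ x, x ^ 2 ∂(P.map Z) := fun t => by
    rw [integral_map (by fun_prop) (by fun_prop), ← integral_const_mul]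
    simp only [mul_pow]
  unfold ContinuousWithinAt
  simp only [e0]
  refine tendsto_of_tendsto_of_tendsto_of_le_of_le tendsto_const_nhds
    (h := fun t : ℝ => (∫ w, Real.negMulLog (heatKernel v w)) +
      (2 * v)⁻¹ * (√t ^ 2 * ∫ x, x ^ 2 ∂(P.map Z))) ?_ (fun t => ?_) (fun t => ?_)
  · have := ((tendsto_sqrt_nhdsGT.pow 2).mul_const (∫ x, x ^ 2 ∂(P.map Z))).const_mul
      (2 * (v : ℝ))⁻¹
    simpa using this.const_add (∫ w, Real.negMulLog (heatKernel v w))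
  · dsimp only
    rw [diffEntropy_gaussian_add hX hZ hXZ hv hXg]
    exact (hb t).1
  · dsimp only
    rw [diffEntropy_gaussian_add hX hZ hXZ hv hXg, ← hsq]
    exact (hb t).2

/-- The dual of de Bruijn's identity, including the right derivative at time zero. -/
theorem hasDerivWithinAt_diffEntropy_gaussian_add (hZi : Integrable Z P) {t : ℝ} (ht : 0 ≤ t)
    (hfin : condVariance Z (fun ω => X ω + √t * Z ω) P ≠ ∞) :
    HasDerivWithinAt (fun s : ℝ => diffEntropy (fun ω => X ω + √s * Z ω) P)
      (1 / 2 * (fisherInfo X P).toReal *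
        (condVariance Z (fun ω => X ω + √t * Z ω) P).toReal) (Set.Ici 0) t := by
  have hv0 : (0 : ℝ) < v := NNReal.coe_pos.2 (pos_iff_ne_zero.2 hv)
  have hJ : (fisherInfo X P).toReal = 1 / v := by
    rw [fisherInfo_of_map_eq_gaussian hX hv hXg, ENNReal.toReal_ofReal (by positivity)]
  have hpos : ∀ s > 0, HasDerivAt (fun s : ℝ => diffEntropy (fun ω => X ω + √s * Z ω) P)
      (1 / 2 * (1 / v) * (condVariance Z (fun ω => X ω + √s * Z ω) P).toReal) s := fun s hs => by
    obtain ⟨h0, h1⟩ := condVariance_gaussian_add hX hZ hXZ hv hXg hZi hs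
    rw [h1, ENNReal.toReal_ofReal h0]
    exact hasDerivAt_diffEntropy_gaussian_add hX hZ hXZ hv hXg hZi hs
  rw [hJ]
  rcases ht.eq_or_lt with rfl | ht
  · have hX0 : (fun ω => X ω + √0 * Z ω) = X := by simp
    rw [hX0] at hfin ⊢
    obtain ⟨hZ2, hvar⟩ := condVariance_of_indepFun hX hZ hXZ hfin
    rw [hvar]
    refine hasDerivWithinAt_Ici_of_tendsto_deriv (s := Set.Ioi 0)
      (fun s hs => (hpos s hs).differentiableAt.differentiableWithinAt)
      (continuousWithinAt_diffEntropy_gaussian_add hX hZ hXZ hv hXg hZ2) self_mem_nhdsWithin ?_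
    refine ((tendsto_condVariance_gaussian_add hX hZ hXZ hv hXg hZ2).const_mul
      (1 / 2 * (1 / v : ℝ))).congr' ?_
    filter_upwards [self_mem_nhdsWithin] with s hs
    exact (hpos s hs).deriv.symm
  · exact (hpos t ht).hasDerivWithinAt

end Limit
end

/-! ### The two identities assembled. -/

theorem theorem2 {Ω : Type*} [MeasurableSpace Ω] (P : Measure Ω) [IsProbabilityMeasure P]
    (X Z : Ω → ℝ) (hX : Measurable X) (hZ : Measurable Z) (hXZ : IndepFun X Z P) :
    -- first identity: `Z` is Gaussian
    (∀ (m : ℝ) (v : ℝ≥0), v ≠ 0 → P.map Z = gaussianReal m v →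
      (∀ t : ℝ, 0 < t → fisherInfo (fun ω => X ω + √t * Z ω) P ≠ ∞) ∧
      (Integrable (fun ω => Real.log (1 + |X ω|)) P →
        ∀ t : ℝ, 0 ≤ t → fisherInfo (fun ω => X ω + √t * Z ω) P ≠ ∞ →
          HasFiniteEntropy (fun ω => X ω + √t * Z ω) P) ∧
      (∀ t : ℝ, 0 ≤ t → fisherInfo (fun ω => X ω + √t * Z ω) P ≠ ∞ →
        HasFiniteEntropy (fun ω => X ω + √t * Z ω) P →
          (∀ s : ℝ, 0 < s → HasFiniteEntropy (fun ω => X ω + √s * Z ω) P) ∧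
          HasDerivWithinAt (fun s : ℝ => diffEntropy (fun ω => X ω + √s * Z ω) P)
            (1 / 2 * (fisherInfo (fun ω => X ω + √t * Z ω) P).toReal * Var[Z; P])
            (Set.Ici 0) t)) ∧
    -- second identity: `X` is Gaussian
    (∀ (m : ℝ) (v : ℝ≥0), v ≠ 0 → P.map X = gaussianReal m v → Integrable Z P →
      fisherInfo X P ≠ ∞ ∧
      (∀ t : ℝ, 0 ≤ t → HasFiniteEntropy (fun ω => X ω + √t * Z ω) P) ∧
      (∀ t : ℝ, 0 < t → condVariance Z (fun ω => X ω + √t * Z ω) P ≠ ∞) ∧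
      (∀ t : ℝ, 0 ≤ t → condVariance Z (fun ω => X ω + √t * Z ω) P ≠ ∞ →
        HasDerivWithinAt (fun s : ℝ => diffEntropy (fun ω => X ω + √s * Z ω) P)
          (1 / 2 * (fisherInfo X P).toReal *
            (condVariance Z (fun ω => X ω + √t * Z ω) P).toReal)
          (Set.Ici 0) t)) := by
  refine ⟨fun m v hv hZg => ?_, fun m v hv hXg hZi => ?_⟩
  · have hvar : Var[Z; P] = v := by
      have := variance_map (X := id) aemeasurable_id (hZ.aemeasurable (μ := P))
      rw [hZg, variance_id_gaussianReal] at this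
      exact this.symm
    refine ⟨fun t ht => ?_, fun hlog t ht hJ => ?_, fun t ht hJ hh => ⟨fun s hs => ?_, ?_⟩⟩
    · rw [fisherInfo_add_gaussian hX hZ hXZ hv hZg ht]
      exact ENNReal.ofReal_ne_top
    · exact hasFiniteEntropy_of_log_moment hX hZ hXZ hv hZg hlog ht hJ
    · obtain ⟨l, hl, hlX⟩ := exists_entropyWeight_map hX hZ
        (integrable_of_map_eq_gaussian hZ hZg) hJ hh
      exact hasFiniteEntropy_add_gaussian hX hZ hXZ hv hZg hl hlX hs
    · rw [hvar]
      exact hasDerivWithinAt_diffEntropy_add_gaussian hX hZ hXZ hv hZg ht hJ hh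
  · refine ⟨?_, fun t _ => hasFiniteEntropy_gaussian_add hX hZ hXZ hv hXg hZi t,
      fun t ht => ?_, fun t ht hfin => ?_⟩
    · rw [fisherInfo_of_map_eq_gaussian hX hv hXg]
      exact ENNReal.ofReal_ne_top
    · rw [(condVariance_gaussian_add hX hZ hXZ hv hXg hZi ht).2]
      exact ENNReal.ofReal_ne_top
    · exact hasDerivWithinAt_diffEntropy_gaussian_add hX hZ hXZ hv hXg hZi ht hfin
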